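/- Let $(N^2,\sigma)$ be a smooth Riemannian surface (completeness is not needed), let $\Omega\subset N$ be open, and let $u:\Omega\to\mathbb R$ be a smooth solution of the translating-graph equation $$\operatorname{div}\Big(\frac{Du}{\sqrt{1+|Du|^2}}\Big)=\frac{1}{\sqrt{1+|Du|^2}},$$ where $D$ and $\operatorname{div}$ are the gradient and divergence of $(N,\sigma)$. Let $r$ be the coordinate on the factor $\mathbb R$. Then the graph $\Sigma=\{(x,u(x)):x\in\Omega\}$ is a stable minimal surface in $N\times\mathbb R$ with the weighted metric $e^{r}(\sigma+dr^2)$. That is: let $F_s:\Omega\to N\times\mathbb R$, $|s|<\varepsilon$, be any smooth variation of $F_0(x)=(x,u(x))$ (so $F$ is smooth in $(s,x)$) such that for some compact $K\subset\Omega$ one has $F_s=F_0$ on $\Omega\setminus K$ for all $s$, and let $A(s)$ be the area of $F_s|_K$ with respect to $e^{r}(\sigma+dr^2)$. Then $A$ is differentiable near $s=0$ and twice differentiable at $s=0$, with $A'(0)=0$ and $A''(0)\ge 0$. Moreover, let $\nu=\Theta(\partial_r-Du)$, $\Theta=1/\sqrt{1+|Du|^2}$, be the upward unit normal of $\Sigma$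 with respect to $\sigma+dr^2$, and write the normal speed $\phi=\langle\partial_sF_s|_{s=0},\nu\rangle_{\sigma+dr^2}$ as $\phi=\eta\,\Theta$. Then $$A''(0)=\int_\Sigma\Theta^2|\nabla\eta|^2e^{r}\,d\mu ,$$ where $\nabla$ and $d\mu$ are the gradient and the area measure of $\Sigma$ in the metric induced by $\sigma+dr^2$. -/

import Mathlib

open Set Filter Topology MeasureTheory
open scoped Manifold ContDiff

-- This instance for `TopCat` objects also fires on plain types, where it would hide
-- `chartedSpaceSelf` behind a wrapper.
attribute [-instance] TopCat.of.chartedSpace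

noncomputable section

namespace TranslatingGraph

/-- The model space of a surface. -/
abbrev Plane : Type := EuclideanSpace ℝ (Fin 2)

/-! ### Forms on tangent spaces

A (pointwise) metric is handled as a function `h p v w` of a point and two tangent vectors there;
all those used below are bilinear in `v` and `w`. -/

section Surface

variable {N : Type*} [TopologicalSpace N] [ChartedSpace Plane N]

/-- The `i`-th standard basis vector of the tangent space at `x`, which is identified with the model
plane through the preferred chart at `x`. -/
def stdVec (x : N) (i : Fin 2) : TangentSpace (𝓡 2) x :=
  (EuclideanSpace.single i 1 : Plane)

/-- The `i`-th coordinate vector field of the preferred chart at `x₀`, at the point of `N` with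
coordinates `y`. -/
def coordVec (x₀ : N) (y : Plane) (i : Fin 2) :
    TangentSpace (𝓡 2) ((extChartAt (𝓡 2) x₀).symm y) :=
  mfderiv 𝓘(ℝ, Plane) (𝓡 2) (extChartAt (𝓡 2) x₀).symm y (stdVec y i)

/-- `det (h_{ij})` in the coordinates of the preferred chart at `x₀`, at the coordinates `y`. -/
def gramDet (h : ∀ x : N, TangentSpace (𝓡 2) x → TangentSpace (𝓡 2) x → ℝ)
    (x₀ : N) (y : Plane) : ℝ :=
  (Matrix.of fun i j : Fin 2 =>
    h ((extChartAt (𝓡 2) x₀).symm y) (coordVec x₀ y i) (coordVec x₀ y j)).det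

/-- The gradient of `f` at `x` with respect to `h`: the vector `h^{ij} (∂_j f) ∂_i`. -/
def grad (h : ∀ x : N, TangentSpace (𝓡 2) x → TangentSpace (𝓡 2) x → ℝ)
    (f : N → ℝ) (x : N) : TangentSpace (𝓡 2) x :=
  ∑ i : Fin 2,
    ((Matrix.of fun i j : Fin 2 => h x (stdVec x i) (stdVec x j))⁻¹.mulVec
      (fun j => (mfderiv (𝓡 2) 𝓘(ℝ, ℝ) f x (stdVec x j) : ℝ))) i • stdVec x i

/-- The divergence of the vector field `X` at `x` with respect to the Riemannian metric `h`:
`(det h)^{-1/2} ∂_i ((det h)^{1/2} X^i)` in the preferred chart at `x`. -/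
def divergence (h : ∀ x : N, TangentSpace (𝓡 2) x → TangentSpace (𝓡 2) x → ℝ)
    (X : ∀ x : N, TangentSpace (𝓡 2) x) (x : N) : ℝ :=
  (√(gramDet h x (extChartAt (𝓡 2) x x)))⁻¹ *
    ∑ i : Fin 2, fderiv ℝ
      (fun y : Plane => √(gramDet h x y) *
        (EuclideanSpace.proj i : Plane →L[ℝ] ℝ)
          (mfderiv (𝓡 2) 𝓘(ℝ, Plane) (extChartAt (𝓡 2) x) ((extChartAt (𝓡 2) x).symm y)
            (X ((extChartAt (𝓡 2) x).symm y))))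
      (extChartAt (𝓡 2) x x) (EuclideanSpace.single i 1)

/-- The area element `√(det h_{ij}) dy¹ dy²` of `h` on the domain of the preferred chart at `x₀`,
extended by zero to the surface. -/
def chartArea [MeasurableSpace N]
    (h : ∀ x : N, TangentSpace (𝓡 2) x → TangentSpace (𝓡 2) x → ℝ) (x₀ : N) : Measure N :=
  ((volume.restrict (extChartAt (𝓡 2) x₀).target).withDensity
    (fun y => ENNReal.ofReal √(gramDet h x₀ y))).map (extChartAt (𝓡 2) x₀).symm

/-- The area measure of `h` on the surface. The measures `chartArea h x₀` agree on the overlaps of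
the charts (change of variables), so that their supremum is the measure which restricts to each of
them on the domain of the corresponding chart. -/
def areaMeasure [MeasurableSpace N]
    (h : ∀ x : N, TangentSpace (𝓡 2) x → TangentSpace (𝓡 2) x → ℝ) : Measure N :=
  ⨆ x₀ : N, chartArea h x₀

end Surface

/-! ### Area of a parametrized surface and its variations -/

section Area

variable {N : Type*} [TopologicalSpace N] [ChartedSpace Plane N]
  {E H M : Type*} [NormedAddCommGroup E] [NormedSpace ℝ E] [TopologicalSpace H]
  (J : ModelWithCorners ℝ E H) [TopologicalSpace M] [ChartedSpace H M]

/-- The pull-back `f^*G`. -/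
def pullback (G : ∀ p : M, TangentSpace J p → TangentSpace J p → ℝ) (f : N → M)
    (x : N) (v w : TangentSpace (𝓡 2) x) : ℝ :=
  G (f x) (mfderiv (𝓡 2) J f x v) (mfderiv (𝓡 2) J f x w)

/-- The area, with respect to the metric `G` of `M`, of the part of the parametrized surface
`f : N → M` that lies over `K`. -/
def area [MeasurableSpace N] (G : ∀ p : M, TangentSpace J p → TangentSpace J p → ℝ)
    (f : N → M) (K : Set N) : ℝ :=
  (areaMeasure (pullback J G f) K).toReal

/-- `F s`, `|s| < ε`, is a smooth variation of the surface `f : Ω → M` which is supported in the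
compact set `K ⊆ Ω`. -/
structure IsVariation (Ω : Set N) (f : N → M) (K : Set N) (ε : ℝ) (F : ℝ → N → M) : Prop where
  isCompact : IsCompact K
  subset : K ⊆ Ω
  pos : 0 < ε
  smooth : ContMDiffOn (𝓘(ℝ, ℝ).prod (𝓡 2)) J ∞ (fun q : ℝ × N => F q.1 q.2)
    (Ioo (-ε) ε ×ˢ Ω)
  start : ∀ x ∈ Ω, F 0 x = f x
  supported : ∀ s ∈ Ioo (-ε) ε, ∀ x ∈ Ω \ K, F s x = f x

/-- The variation field `∂F/∂s` at `s = 0`. -/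
def velocity (F : ℝ → N → M) (x : N) : TangentSpace J (F 0 x) :=
  mfderiv 𝓘(ℝ, ℝ) J (fun s : ℝ => F s x) 0 (1 : ℝ)

/-- `f : Ω → M` is a minimal surface of `(M, G)`: a smooth immersion for which the first variation
of area exists and vanishes for every compactly supported smooth variation. -/
def IsMinimalSurface [MeasurableSpace N]
    (G : ∀ p : M, TangentSpace J p → TangentSpace J p → ℝ) (Ω : Set N) (f : N → M) : Prop :=
  ContMDiffOn (𝓡 2) J ∞ f Ω ∧
  (∀ x ∈ Ω, Function.Injective (mfderiv (𝓡 2) J f x)) ∧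
  ∀ (K : Set N) (ε : ℝ) (F : ℝ → N → M), IsVariation J Ω f K ε F →
    HasDerivAt (fun s => area J G (F s) K) 0 0

/-- `f : Ω → M` is a stable minimal surface of `(M, G)`: it is minimal, and the second variation of
area exists and is nonnegative for every compactly supported smooth variation. -/
def IsStableMinimalSurface [MeasurableSpace N]
    (G : ∀ p : M, TangentSpace J p → TangentSpace J p → ℝ) (Ω : Set N) (f : N → M) : Prop :=
  IsMinimalSurface J G Ω f ∧
  ∀ (K : Set N) (ε : ℝ) (F : ℝ → N → M), IsVariation J Ω f K ε F →
    (∀ᶠ s in 𝓝 (0 : ℝ), DifferentiableAt ℝ (fun s => area J G (F s) K) s) ∧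
    DifferentiableAt ℝ (deriv fun s => area J G (F s) K) 0 ∧
    0 ≤ deriv (deriv fun s => area J G (F s) K) 0

end Area

/-! ### Graphs in `N × ℝ` -/

section Graph

variable {N : Type*} [TopologicalSpace N] [ChartedSpace Plane N] [IsManifold (𝓡 2) ∞ N]

/-- A smooth Riemannian metric on the surface `N`. -/
abbrev SurfaceMetric (N : Type*) [TopologicalSpace N] [ChartedSpace Plane N]
    [IsManifold (𝓡 2) ∞ N] :=
  Bundle.ContMDiffRiemannianMetric (𝓡 2) ∞ Plane (fun x : N => TangentSpace (𝓡 2) x)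

/-- The metric `σ` of `N` as a function of two tangent vectors. -/
def form (σ : SurfaceMetric N) (x : N) (v w : TangentSpace (𝓡 2) x) : ℝ := σ.inner x v w

/-- The product metric `σ + dr²` on `N × ℝ`. -/
def productMetric (σ : SurfaceMetric N) (p : N × ℝ)
    (v w : TangentSpace ((𝓡 2).prod 𝓘(ℝ, ℝ)) p) : ℝ :=
  form σ p.1 v.1 w.1 + v.2 * w.2

/-- The weighted metric `e^r (σ + dr²)` on `N × ℝ`. -/
def weightedMetric (σ : SurfaceMetric N) (p : N × ℝ)
    (v w : TangentSpace ((𝓡 2).prod 𝓘(ℝ, ℝ)) p) : ℝ :=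
  Real.exp p.2 * productMetric σ p v w

/-- The parametrization `x ↦ (x, u x)` of the graph of `u`. -/
def graphMap (u : N → ℝ) (x : N) : N × ℝ := (x, u x)

/-- `1 / √(1 + |Du|²)`, which is also the angle function `Θ = ⟨ν, ∂_r⟩` of the graph. -/
def angle (σ : SurfaceMetric N) (u : N → ℝ) (x : N) : ℝ :=
  1 / √(1 + form σ x (grad (form σ) u x) (grad (form σ) u x))

/-- The upward unit normal `ν = Θ (∂_r - Du)` of the graph with respect to `σ + dr²`. -/
def upNormal (σ : SurfaceMetric N) (u : N → ℝ) (x : N) :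
    TangentSpace ((𝓡 2).prod 𝓘(ℝ, ℝ)) (graphMap u x) :=
  ((-angle σ u x) • (grad (form σ) u x : Plane), angle σ u x)

/-- The translating graph equation `div (Du / √(1 + |Du|²)) = 1 / √(1 + |Du|²)` on `Ω`. -/
def IsTranslatingSolution (σ : SurfaceMetric N) (Ω : Set N) (u : N → ℝ) : Prop :=
  ∀ x ∈ Ω,
    divergence (form σ) (fun y => angle σ u y • grad (form σ) u y) x = angle σ u x

/-- For a variation `F` of the graph of `u`, the function `η = φ / Θ`, where `φ = ⟨∂F/∂s, ν⟩` is
the normal speed of `F` at `s = 0` with respect to `σ + dr²`. -/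
def normalSpeedOverAngle (σ : SurfaceMetric N) (u : N → ℝ) (F : ℝ → N → N × ℝ) (x : N) : ℝ :=
  productMetric σ (graphMap u x) (velocity ((𝓡 2).prod 𝓘(ℝ, ℝ)) F x) (upNormal σ u x) /
    angle σ u x

/-- The metric which the graph of `u` inherits from `σ + dr²`, in the parameter `x`. -/
def graphMetric (σ : SurfaceMetric N) (u : N → ℝ) (x : N) (v w : TangentSpace (𝓡 2) x) : ℝ :=
  pullback ((𝓡 2).prod 𝓘(ℝ, ℝ)) (productMetric σ) (graphMap u) x v w

end Graph

end TranslatingGraph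

end

/-! The proof is a calibration argument carried to second order. Extend `ν` to `Ω × ℝ` independently
of `r` and put `ω = e^r ι_ν dvol`. The translating equation says that `e^r ν` is divergence free, so
`ω` is closed. It even has the explicit primitive `e^r ι_X dA_σ` with `X = Θ Du` (`flux_divergence`,
`calibRep_eq_pd`). Hence the integral of `ω` over `F_s` is constant for `s` near `0`, and it
suffices to expand the difference between area and calibrated area.

In a chart let `a` and `c` be the densities of the weighted area and of `ω` pulled back by `F_s`,
let `R` be the height, `g` the Gram matrix for `σ + dr²`, and `n_i` the components of the pull-back
of `ν♭ = Θ d(r - u)`. Linear algebra gives `a² - c² = e^{2R} (g₁₁ n₀² - 2 g₀₁ n₀ n₁ + g₀₀ n₁²)`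
(`calibration_det_identity`, `calibRep_sq`). Since `r - u` vanishes on the graph, `n_i = 0` at `s =
0`. So `a - c` vanishes to second order there, and its second derivative is `e^{2R} / a` times the
same quadratic form in `∂_s n_i` (`second_deriv_sub_of_sq_sub`). Moreover `∂_s (r - u)(F_s) = η` at
`s = 0`, so that `∂_s n_i = Θ ∂_i η` (`deriv_normalRep`), and the second derivative is `Θ² |∇η|² e^u
√(det g)` (`second_deriv_density`). Integration gives both variation formulas, and the sign is
evident.

Two devices make this global without integrating forms over `N`. The form `ω` is encoded by the
degenerate metric `calibration`, whose area density is `|ω|`, so that the area measure serves for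
both quantities and no orientation is chosen. The constancy of the calibrated area
(`eventually_calibratedAreaOn_eq`) is proved by switching the variation on through a partition of
unity, one chart at a time, so that Green's theorem in the plane is enough. -/

noncomputable section

namespace TranslatingGraph

/-! ### Calculus in the plane -/

/-- The `i`-th standard basis vector of the plane. -/
abbrev e (i : Fin 2) : Plane := EuclideanSpace.single i 1

/-- The `i`-th partial derivative. -/
def pd (i : Fin 2) (f : Plane → ℝ) (y : Plane) : ℝ := fderiv ℝ f y (e i)

theorem plane_eq_sum (v : Plane) : v = ∑ i, v i • e i := by
  ext j
  fin_cases j <;> simp [Fin.sum_univ_two, e]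

theorem pd_congr {i : Fin 2} {f g : Plane → ℝ} {y : Plane} (h : f =ᶠ[𝓝 y] g) :
    pd i f y = pd i g y := by
  unfold pd; rw [h.fderiv_eq]

theorem pd_mul {i : Fin 2} {f g : Plane → ℝ} {y : Plane} (hf : DifferentiableAt ℝ f y)
    (hg : DifferentiableAt ℝ g y) :
    pd i (fun z => f z * g z) y = f y * pd i g y + g y * pd i f y := by
  unfold pd; rw [fderiv_fun_mul hf hg]; simp

theorem pd_sub {i : Fin 2} {f g : Plane → ℝ} {y : Plane} (hf : DifferentiableAt ℝ f y)
    (hg : DifferentiableAt ℝ g y) :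
    pd i (fun z => f z - g z) y = pd i f y - pd i g y := by
  unfold pd; rw [fderiv_fun_sub hf hg]; simp

theorem pd_const_mul {i : Fin 2} {f : Plane → ℝ} {y : Plane} (c : ℝ)
    (hf : DifferentiableAt ℝ f y) :
    pd i (fun z => c * f z) y = c * pd i f y := by
  unfold pd; rw [fderiv_const_mul hf]; simp

theorem pd_exp {i : Fin 2} {f : Plane → ℝ} {y : Plane} (hf : DifferentiableAt ℝ f y) :
    pd i (fun z => Real.exp (f z)) y = Real.exp (f y) * pd i f y := by
  unfold pd; rw [fderiv_exp hf]; simp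

theorem fderiv_apply_coord {P : Plane → Plane} {y : Plane} (hP : DifferentiableAt ℝ P y)
    (i k : Fin 2) : (fderiv ℝ P y (e i)) k = pd i (fun z => P z k) y := by
  have := ((EuclideanSpace.proj k : Plane →L[ℝ] ℝ).hasFDerivAt.comp y hP.hasFDerivAt).fderiv
  unfold pd
  have h2 : (fun z => P z k) = (EuclideanSpace.proj k : Plane →L[ℝ] ℝ) ∘ P := rfl
  rw [h2, this]; rfl

theorem fderiv_eq_sum {f : Plane → ℝ} {y : Plane} (v : Plane) :
    fderiv ℝ f y v = ∑ k, pd k f y * v k := by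
  conv_lhs => rw [plane_eq_sum v]
  rw [map_sum]
  exact Finset.sum_congr rfl fun k _ => by rw [map_smul, smul_eq_mul, mul_comm]; rfl

theorem pd_comp {i : Fin 2} {f : Plane → ℝ} {P : Plane → Plane} {y : Plane}
    (hf : DifferentiableAt ℝ f (P y)) (hP : DifferentiableAt ℝ P y) :
    pd i (fun z => f (P z)) y = ∑ k, pd k f (P y) * pd i (fun z => P z k) y := by
  have := (hf.hasFDerivAt.comp y hP.hasFDerivAt).fderiv
  have h2 : (fun z => f (P z)) = f ∘ P := rfl
  unfold pd at *
  rw [h2, this, ContinuousLinearMap.comp_apply, fderiv_eq_sum]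
  exact Finset.sum_congr rfl fun k _ => by rw [fderiv_apply_coord hP]; rfl

theorem contDiffAt_coord {P : Plane → Plane} {y : Plane} {n : WithTop ℕ∞}
    (hP : ContDiffAt ℝ n P y) (k : Fin 2) : ContDiffAt ℝ n (fun z => P z k) y :=
  (EuclideanSpace.proj k : Plane →L[ℝ] ℝ).contDiff.contDiffAt.comp y hP

theorem contDiffAt_pd {f : Plane → ℝ} {y : Plane} {m n : WithTop ℕ∞}
    (hf : ContDiffAt ℝ n f y) (hmn : m + 1 ≤ n) (i : Fin 2) : ContDiffAt ℝ m (pd i f) y :=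
  (hf.fderiv_right hmn).clm_apply contDiffAt_const

theorem pd_comm {f : Plane → ℝ} {y : Plane} (hf : ContDiffAt ℝ 2 f y) (i j : Fin 2) :
    pd i (pd j f) y = pd j (pd i f) y := by
  have hs := hf.isSymmSndFDerivAt (by simp)
  have hd : DifferentiableAt ℝ (fderiv ℝ f) y :=
    (hf.fderiv_right (m := 1) (by norm_num)).differentiableAt (by norm_num)
  have key : ∀ a b : Fin 2, pd a (pd b f) y = fderiv ℝ (fderiv ℝ f) y (e a) (e b) := by
    intro a b
    unfold pd
    rw [fderiv_clm_apply hd (differentiableAt_const _)]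
    simp
  rw [key, key]; exact hs _ _

/-- The pull-back of the differential of `e^r (b¹ dp² - b² dp¹)` by the map `(P, R)`. -/
theorem pd_pullback_sub {b : Fin 2 → Plane → ℝ} {P : Plane → Plane} {R : Plane → ℝ} {y : Plane}
    (hb : ∀ k, DifferentiableAt ℝ (b k) (P y)) (hP : ContDiffAt ℝ 2 P y)
    (hR : DifferentiableAt ℝ R y) :
    pd 0 (fun z => Real.exp (R z) *
        (b 0 (P z) * pd 1 (fun w => P w 1) z - b 1 (P z) * pd 1 (fun w => P w 0) z)) y -
      pd 1 (fun z => Real.exp (R z) *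
        (b 0 (P z) * pd 0 (fun w => P w 1) z - b 1 (P z) * pd 0 (fun w => P w 0) z)) y =
    Real.exp (R y) *
      ((pd 0 (b 0) (P y) + pd 1 (b 1) (P y)) *
          (pd 0 (fun w => P w 0) y * pd 1 (fun w => P w 1) y -
            pd 0 (fun w => P w 1) y * pd 1 (fun w => P w 0) y) +
        pd 0 R y * (b 0 (P y) * pd 1 (fun w => P w 1) y - b 1 (P y) * pd 1 (fun w => P w 0) y) -
        pd 1 R y * (b 0 (P y) * pd 0 (fun w => P w 1) y - b 1 (P y) * pd 0 (fun w => P w 0) y)) := by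
  have hPd := hP.differentiableAt (by norm_num)
  have hbP : ∀ k, DifferentiableAt ℝ (fun z => b k (P z)) y := fun k => (hb k).comp y hPd
  have hPp : ∀ i k, DifferentiableAt ℝ (pd i (fun w => P w k)) y := fun i k =>
    (contDiffAt_pd (m := 1) (contDiffAt_coord hP k) (by norm_num) i).differentiableAt (by norm_num)
  have hE : DifferentiableAt ℝ (fun z => Real.exp (R z)) y := hR.exp
  -- The second derivatives of `P` occur only as `pd 0 (pd 1 _)` and `pd 1 (pd 0 _)` with opposite
  -- signs. Their cancellation is `d² = 0` applied to the coordinates of `P`.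
  have c0 := pd_comm (contDiffAt_coord hP 0) 0 1
  have c1 := pd_comm (contDiffAt_coord hP 1) 0 1
  have key : ∀ i j : Fin 2, pd i (fun z => Real.exp (R z) *
        (b 0 (P z) * pd j (fun w => P w 1) z - b 1 (P z) * pd j (fun w => P w 0) z)) y = 
      Real.exp (R y) * ((b 0 (P y) * pd i (pd j (fun w => P w 1)) y +
        pd j (fun w => P w 1) y * ∑ k, pd k (b 0) (P y) * pd i (fun z => P z k) y) -
        (b 1 (P y) * pd i (pd j (fun w => P w 0)) y +
        pd j (fun w => P w 0) y * ∑ k, pd k (b 1) (P y) * pd i (fun z => P z k) y)) +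
      (b 0 (P y) * pd j (fun w => P w 1) y - b 1 (P y) * pd j (fun w => P w 0) y) *
        (Real.exp (R y) * pd i R y) := by
    intro i j
    have m : ∀ k l, DifferentiableAt ℝ (fun z => b k (P z) * pd j (fun w => P w l) z) y :=
      fun k l => (hbP k).mul (hPp j l)
    have m' : DifferentiableAt ℝ (fun z => b 0 (P z) * pd j (fun w => P w 1) z -
        b 1 (P z) * pd j (fun w => P w 0) z) y := (m 0 1).sub (m 1 0)
    rw [pd_mul hE m', pd_sub (m 0 1) (m 1 0), pd_mul (hbP 0) (hPp j 1),
      pd_mul (hbP 1) (hPp j 0), pd_comp (hb 0) hPd, pd_comp (hb 1) hPd, pd_exp hR]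
  rw [key, key, c0, c1]
  simp only [Fin.sum_univ_two]
  ring

/-! ### Integrals of partial derivatives. -/

theorem integral_pd_eq_zero {f : Plane → ℝ} (hf : ContDiff ℝ 1 f) (hc : HasCompactSupport f)
    (i : Fin 2) : ∫ y, pd i f y = 0 := by
  have hint : Integrable f := hf.continuous.integrable_of_hasCompactSupport hc
  have hint' : Integrable (fun y => fderiv ℝ f y (e i)) :=
    ((hf.continuous_fderiv (by norm_num)).clm_apply
      continuous_const).integrable_of_hasCompactSupport
        ((hc.fderiv (𝕜 := ℝ)).comp_left (g := fun L : Plane →L[ℝ] ℝ => L (e i)) (by simp))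
  -- Integration by parts against the constant function `1`.
  have := integral_mul_fderiv_eq_neg_fderiv_mul_of_integrable (μ := (volume : Measure Plane))
    (f := fun _ => (1 : ℝ)) (g := f) (v := e i)
    (by simp) (by simpa using hint') (by simpa using hint)
    (fun x _ => differentiableAt_const _) (fun x _ => (hf.differentiable (by norm_num)) x)
  simpa [pd] using this

/-- Green's theorem for fields with compact support. -/
theorem setIntegral_pd_eq_zero {f : Plane → ℝ} {U L : Set Plane} (hU : IsOpen U)
    (hL : IsCompact L) (hLU : L ⊆ U) (hf : ContDiffOn ℝ 1 f U) (h0 : ∀ y ∈ U \ L, f y = 0)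
    (i : Fin 2) : ∫ y in L, pd i f y = 0 := by
  classical
  -- The extension by zero is `C¹`: it agrees with `f` on the open set `U`, it vanishes on the open
  -- set `Lᶜ`, and these two sets cover the plane. No regularity of the boundary of `L` is needed.
  set g : Plane → ℝ := L.indicator f with hg
  have hgU : ∀ y ∈ U, g y = f y := by
    intro y hy
    by_cases hyL : y ∈ L
    · simp [hg, hyL]
    · simp [hg, hyL, h0 y ⟨hy, hyL⟩]
  have hgcd : ContDiff ℝ 1 g := by
    rw [contDiff_iff_contDiffAt]
    intro y
    by_cases hy : y ∈ U
    · exact (hf.contDiffAt (hU.mem_nhds hy)).congr_of_eventuallyEq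
        (eventually_of_mem (hU.mem_nhds hy) hgU)
    · have : y ∈ Lᶜ := fun h => hy (hLU h)
      refine (contDiffAt_const (c := (0 : ℝ))).congr_of_eventuallyEq
        (eventually_of_mem (hL.isClosed.isOpen_compl.mem_nhds this) fun z hz => ?_)
      exact Set.indicator_of_notMem hz f
  have hgc : HasCompactSupport g :=
    HasCompactSupport.intro hL fun y hy => Set.indicator_of_notMem hy f
  have hz := integral_pd_eq_zero hgcd hgc i
  have hoff : ∀ y ∉ L, pd i g y = 0 := by
    intro y hy
    have : g =ᶠ[𝓝 y] fun _ => 0 := eventually_of_mem (hL.isClosed.isOpen_compl.mem_nhds hy)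
      fun z hz => Set.indicator_of_notMem hz f
    unfold pd; rw [this.fderiv_eq]; simp
  rw [← setIntegral_eq_integral_of_forall_compl_eq_zero hoff] at hz
  rw [← hz]
  refine setIntegral_congr_fun hL.isClosed.measurableSet fun y hy => ?_
  exact pd_congr
    (eventually_of_mem (hU.mem_nhds (hLU hy)) fun z hz => (hgU z hz).symm)

/-! ### Functions depending on a parameter -/

theorem two_le_infty : (2 : WithTop ℕ∞) ≤ ∞ := by
  exact WithTop.coe_le_coe.2 (le_top : (2 : ℕ∞) ≤ ⊤)

/-- The derivative of a slice is the total derivative of `f` in the direction `(0, e i)`. In this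
form joint smoothness in the parameter and the point is inherited. -/
theorem contDiffOn_pd_snd {f : ℝ × Plane → ℝ} {W : Set (ℝ × Plane)} (hW : IsOpen W)
    (hf : ContDiffOn ℝ ∞ f W) (i : Fin 2) :
    ContDiffOn ℝ ∞ (fun q : ℝ × Plane => pd i (fun y => f (q.1, y)) q.2) W := by
  have h1 : ContDiffOn ℝ ∞ (fun q => fderiv ℝ f q (0, e i)) W :=
    (hf.fderiv_of_isOpen hW (by simp)).clm_apply contDiffOn_const
  refine h1.congr fun q hq => ?_
  have hd : DifferentiableAt ℝ f (q.1, q.2) :=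
    (hf.contDiffAt (hW.mem_nhds hq)).differentiableAt (by simp)
  have := (hd.hasFDerivAt.comp q.2 (hasFDerivAt_prodMk_right q.1 q.2)).fderiv
  have h2 : (fun y => f (q.1, y)) = f ∘ (fun y => (q.1, y)) := rfl
  unfold pd; rw [h2, this]; simp

theorem hasDerivAt_fst_param {f : ℝ × Plane → ℝ} {W : Set (ℝ × Plane)} (hW : IsOpen W)
    (hf : ContDiffOn ℝ ∞ f W) {s : ℝ} {y : Plane} (h : (s, y) ∈ W) :
    HasDerivAt (fun t => f (t, y)) (fderiv ℝ f (s, y) (1, 0)) s := by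
  have hd : DifferentiableAt ℝ f (s, y) :=
    (hf.contDiffAt (hW.mem_nhds h)).differentiableAt (by simp)
  have := (hd.hasFDerivAt.comp s (hasFDerivAt_prodMk_left s y)).hasDerivAt
  simpa [Function.comp_def] using this

theorem contDiffOn_deriv_fst {f : ℝ × Plane → ℝ} {W : Set (ℝ × Plane)} (hW : IsOpen W)
    (hf : ContDiffOn ℝ ∞ f W) :
    ContDiffOn ℝ ∞ (fun q : ℝ × Plane => deriv (fun s => f (s, q.2)) q.1) W := by
  have h1 : ContDiffOn ℝ ∞ (fun q => fderiv ℝ f q (1, 0)) W :=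
    (hf.fderiv_of_isOpen hW (by simp)).clm_apply contDiffOn_const
  exact h1.congr fun q hq => (hasDerivAt_fst_param hW hf hq).deriv

/-- Both sides are the second derivative of `f` in the directions `(1, 0)` and `(0, e i)`, which is
symmetric. It turns `∂_s ∂_i (r - u)` into `∂_i η` later. -/
theorem deriv_pd_comm {f : ℝ × Plane → ℝ} {W : Set (ℝ × Plane)} (hW : IsOpen W)
    (hf : ContDiffOn ℝ ∞ f W) {s : ℝ} {y : Plane} (h : (s, y) ∈ W) (i : Fin 2) :
    deriv (fun t => pd i (fun z => f (t, z)) y) s = pd i (fun z => deriv (fun t => f (t, z)) s) y := by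
  have hcd : ContDiffAt ℝ ∞ f (s, y) := hf.contDiffAt (hW.mem_nhds h)
  have hs := hcd.isSymmSndFDerivAt (by simpa using two_le_infty)
  have hd : DifferentiableAt ℝ (fderiv ℝ f) (s, y) :=
    (hcd.fderiv_right (m := ∞) (by simp)).differentiableAt (by simp)
  have hq : ∀ q ∈ W, pd i (fun z => f (q.1, z)) q.2 = fderiv ℝ f q (0, e i) := by
    intro q hq
    have hd : DifferentiableAt ℝ f (q.1, q.2) :=
      (hf.contDiffAt (hW.mem_nhds hq)).differentiableAt (by simp)
    have := (hd.hasFDerivAt.comp q.2 (hasFDerivAt_prodMk_right q.1 q.2)).fderiv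
    have h2 : (fun y => f (q.1, y)) = f ∘ (fun y => (q.1, y)) := rfl
    unfold pd; rw [h2, this]; simp
  have hl : (fun t => pd i (fun z => f (t, z)) y) =ᶠ[𝓝 s] fun t => fderiv ℝ f (t, y) (0, e i) := by
    have : ∀ᶠ t in 𝓝 s, (t, y) ∈ W :=
      (by fun_prop : ContinuousAt (fun t : ℝ => (t, y)) s).eventually (hW.mem_nhds h)
    filter_upwards [this] with t ht using hq (t, y) ht
  have hr : (fun z => deriv (fun t => f (t, z)) s) =ᶠ[𝓝 y] fun z => fderiv ℝ f (s, z) (1, 0) := by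
    have : ∀ᶠ z in 𝓝 y, (s, z) ∈ W :=
      (by fun_prop : ContinuousAt (fun z : Plane => (s, z)) y).eventually (hW.mem_nhds h)
    filter_upwards [this] with z hz using (hasDerivAt_fst_param hW hf hz).deriv
  rw [hl.deriv_eq, pd_congr hr]
  have e1 : HasDerivAt (fun t => fderiv ℝ f (t, y)) (fderiv ℝ (fderiv ℝ f) (s, y) (1, 0)) s := by
    have := (hd.hasFDerivAt.comp s (hasFDerivAt_prodMk_left s y)).hasDerivAt
    simpa only [Function.comp_def, ContinuousLinearMap.comp_apply,
      ContinuousLinearMap.inl_apply] using this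
  have e2 : HasFDerivAt (fun z => fderiv ℝ f (s, z))
      ((fderiv ℝ (fderiv ℝ f) (s, y)).comp (ContinuousLinearMap.inr ℝ ℝ Plane)) y :=
    hd.hasFDerivAt.comp y (hasFDerivAt_prodMk_right s y)
  have e1' : deriv (fun t => fderiv ℝ f (t, y) (0, e i)) s =
      fderiv ℝ (fderiv ℝ f) (s, y) (1, 0) (0, e i) := by
    rw [(e1.clm_apply (hasDerivAt_const s ((0 : ℝ), e i))).deriv, map_zero, add_zero]
  have e2' : pd i (fun z => fderiv ℝ f (s, z) (1, 0)) y =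
      fderiv ℝ (fderiv ℝ f) (s, y) (0, e i) (1, 0) := by
    unfold pd
    rw [(e2.clm_apply (hasFDerivAt_const ((1 : ℝ), (0 : Plane)) y)).fderiv]
    simp only [add_apply, ContinuousLinearMap.comp_apply,
      ContinuousLinearMap.flip_apply, ContinuousLinearMap.inr_apply, zero_apply,
      map_zero, zero_add]
  rw [e1', e2']; exact hs _ _

/-- Differentiation under the integral over a relatively compact set. -/
theorem hasDerivAt_setIntegral_param {f : ℝ × Plane → ℝ} {W : Set (ℝ × Plane)} (hW : IsOpen W)
    (hf : ContDiffOn ℝ ∞ f W) {L B : Set Plane} (hL : IsCompact L) (hBm : MeasurableSet B)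
    (hBL : B ⊆ L) {s₀ : ℝ} (h0 : ∀ y ∈ L, (s₀, y) ∈ W) :
    IntegrableOn (fun y => f (s₀, y)) B ∧
    HasDerivAt (fun s => ∫ y in B, f (s, y)) (∫ y in B, deriv (fun s => f (s, y)) s₀) s₀ := by
  -- The tube lemma yields one interval of parameters that works over all of `L`. On its product
  -- with `L` the parameter derivative is bounded, and this constant is the dominating function,
  -- integrable since `B` has finite measure.
  obtain ⟨A, V, hA, hV, hsA, hLV, hAV⟩ := generalized_tube_lemma
    (isCompact_singleton (x := s₀)) hL hW
    (by rintro ⟨a, b⟩ ⟨ha, hb⟩; obtain rfl : a = s₀ := ha; exact h0 b hb)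
  have hs₀ : s₀ ∈ A := hsA rfl
  obtain ⟨δ, hδ, hball⟩ := Metric.isOpen_iff.1 hA s₀ hs₀
  have hC : IsCompact (Metric.closedBall s₀ (δ / 2) ×ˢ L) := (isCompact_closedBall _ _).prod hL
  have hsub : Metric.closedBall s₀ (δ / 2) ×ˢ L ⊆ W := by
    refine fun q hq => hAV ⟨hball ?_, hLV hq.2⟩
    exact Metric.closedBall_subset_ball (by linarith) hq.1
  have hf' := contDiffOn_deriv_fst hW hf
  obtain ⟨M, hM⟩ := hC.exists_bound_of_continuousOn (hf'.continuousOn.mono hsub)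
  have hBfin : volume B ≠ ⊤ := ((measure_mono hBL).trans_lt hL.measure_lt_top).ne
  have hcont : ∀ g : ℝ × Plane → ℝ, ContDiffOn ℝ ∞ g W → ∀ s ∈ Metric.closedBall s₀ (δ / 2),
      ContinuousOn (fun y => g (s, y)) L := by
    intro g hg s hs
    exact hg.continuousOn.comp (by fun_prop) fun y hy => hsub ⟨hs, hy⟩
  have hself : s₀ ∈ Metric.closedBall s₀ (δ / 2) := Metric.mem_closedBall_self (by linarith)
  have hint : IntegrableOn (fun y => f (s₀, y)) B :=
    ((hcont f hf s₀ hself).integrableOn_compact hL).mono_set hBL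
  refine ⟨hint, ?_⟩
  refine (hasDerivAt_integral_of_dominated_loc_of_deriv_le
    (F := fun s y => f (s, y)) (F' := fun s y => deriv (fun s => f (s, y)) s)
    (s := Metric.ball s₀ (δ / 2)) (bound := fun _ => M)
    (Metric.ball_mem_nhds _ (by linarith)) ?_ hint ?_ ?_ ?_ ?_).2
  · filter_upwards [Metric.ball_mem_nhds s₀ (half_pos hδ)] with s hs
    exact ((hcont f hf s (Metric.ball_subset_closedBall hs)).mono hBL).aestronglyMeasurable hBm
  · exact ((hcont _ hf' s₀ hself).mono hBL).aestronglyMeasurable hBm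
  · refine (ae_restrict_iff' hBm).2 (Eventually.of_forall fun y hy s hs => ?_)
    exact hM (s, y) ⟨Metric.ball_subset_closedBall hs, hBL hy⟩
  · exact integrableOn_const hBfin
  · refine (ae_restrict_iff' hBm).2 (Eventually.of_forall fun y hy s hs => ?_)
    have : (s, y) ∈ W := hsub ⟨Metric.ball_subset_closedBall hs, hBL hy⟩
    exact (hasDerivAt_fst_param hW hf this).differentiableAt.hasDerivAt

theorem eventually_param_mem {W : Set (ℝ × Plane)} (hW : IsOpen W) {L : Set Plane}
    (hL : IsCompact L) {s₀ : ℝ} (h0 : ∀ y ∈ L, (s₀, y) ∈ W) :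
    ∀ᶠ s in 𝓝 s₀, ∀ y ∈ L, (s, y) ∈ W := by
  obtain ⟨A, V, hA, hV, hsA, hLV, hAV⟩ := generalized_tube_lemma
    (isCompact_singleton (x := s₀)) hL hW
    (by rintro ⟨a, b⟩ ⟨ha, hb⟩; obtain rfl : a = s₀ := ha; exact h0 b hb)
  filter_upwards [hA.mem_nhds (hsA rfl)] with s hs y hy using hAV ⟨hs, hLV hy⟩

/-! ### Second derivatives of products -/

/-- In `(n k)'' = n'' k + 2 n' k' + n k''` the outer terms vanish, so second derivatives of the
factors do not enter. -/
theorem second_deriv_mul_of_zero {n k : ℝ → ℝ} (hn : ContDiffAt ℝ 2 n 0) (hk : ContDiffAt ℝ 2 k 0)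
    (hn0 : n 0 = 0) (hk0 : k 0 = 0) :
    deriv (fun s => n s * k s) 0 = 0 ∧
      deriv (deriv fun s => n s * k s) 0 = 2 * (deriv n 0 * deriv k 0) := by
  have hd : ∀ {g : ℝ → ℝ}, ContDiffAt ℝ 2 g 0 →
      (∀ᶠ s in 𝓝 (0 : ℝ), DifferentiableAt ℝ g s) ∧ DifferentiableAt ℝ (deriv g) 0 := by
    intro g hg
    constructor
    · filter_upwards [hg.eventually (by simp)] with s hs using hs.differentiableAt (by norm_num)
    · have h1 : ContDiffAt ℝ 1 (fun s => fderiv ℝ g s 1) 0 :=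
        (hg.fderiv_right (m := 1) (by norm_num)).clm_apply contDiffAt_const
      exact h1.differentiableAt (by norm_num)
  obtain ⟨hn1, hn2⟩ := hd hn
  obtain ⟨hk1, hk2⟩ := hd hk
  have hev : (deriv fun s => n s * k s) =ᶠ[𝓝 0] fun s => deriv n s * k s + n s * deriv k s := by
    filter_upwards [hn1, hk1] with s h1 h2
    exact deriv_fun_mul h1 h2
  refine ⟨by rw [hev.eq_of_nhds]; simp [hn0, hk0], ?_⟩
  have m1 : DifferentiableAt ℝ (fun s => deriv n s * k s) 0 := hn2.mul hk1.self_of_nhds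
  have m2 : DifferentiableAt ℝ (fun s => n s * deriv k s) 0 := hn1.self_of_nhds.mul hk2
  rw [hev.deriv_eq, deriv_fun_add m1 m2,
    deriv_fun_mul hn2 hk1.self_of_nhds, deriv_fun_mul hn1.self_of_nhds hk2, hn0, hk0]
  ring

/-! ### Bilinear forms on tangent spaces and their coefficients in a chart -/

/-- The function `h p v w` is bilinear in `v` and `w`. -/
structure IsBilin {E H M : Type*} [NormedAddCommGroup E] [NormedSpace ℝ E] [TopologicalSpace H]
    {J : ModelWithCorners ℝ E H} [TopologicalSpace M] [ChartedSpace H M]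
    (h : ∀ p : M, TangentSpace J p → TangentSpace J p → ℝ) : Prop where
  add_left : ∀ p v v' w, h p (v + v') w = h p v w + h p v' w
  smul_left : ∀ p (a : ℝ) v w, h p (a • v) w = a * h p v w
  add_right : ∀ p v w w', h p v (w + w') = h p v w + h p v w'
  smul_right : ∀ p (a : ℝ) v w, h p v (a • w) = a * h p v w

section

variable {N : Type*} [TopologicalSpace N] [ChartedSpace Plane N]

theorem IsBilin.sum_sum {h : ∀ x : N, TangentSpace (𝓡 2) x → TangentSpace (𝓡 2) x → ℝ}
    (hb : IsBilin h) (x : N) (a b : Fin 2 → ℝ) (v w : Fin 2 → TangentSpace (𝓡 2) x) :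
    h x (∑ i, a i • v i) (∑ j, b j • w j) = ∑ i, ∑ j, a i * b j * h x (v i) (w j) := by
  simp only [Fin.sum_univ_two, hb.add_left, hb.add_right, hb.smul_left, hb.smul_right]
  ring

/-- Every tangent space of `N` is by definition the model plane, so vectors can be moved between the
fibres over points that are only provably equal. -/
theorem form_congr (h : ∀ x : N, TangentSpace (𝓡 2) x → TangentSpace (𝓡 2) x → ℝ) {x x' : N}
    (hx : x = x') (v w : Plane) : h x v w = h x' v w := by
  subst hx; rfl

/-- The coefficients of `h` in the preferred chart at `x₀`. -/
def coeff (h : ∀ x : N, TangentSpace (𝓡 2) x → TangentSpace (𝓡 2) x → ℝ) (x₀ : N) (i j : Fin 2)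
    (y : Plane) : ℝ :=
  h ((extChartAt (𝓡 2) x₀).symm y) (coordVec x₀ y i) (coordVec x₀ y j)

theorem gramDet_eq (h : ∀ x : N, TangentSpace (𝓡 2) x → TangentSpace (𝓡 2) x → ℝ) (x₀ : N)
    (y : Plane) :
    gramDet h x₀ y = coeff h x₀ 0 0 y * coeff h x₀ 1 1 y - coeff h x₀ 0 1 y * coeff h x₀ 1 0 y := by
  unfold gramDet; rw [Matrix.det_fin_two]; rfl

variable [IsManifold (𝓡 2) ∞ N]

theorem mdifferentiableAt_chart_symm {x₀ : N} {y : Plane}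
    (hy : y ∈ (extChartAt (𝓡 2) x₀).target) :
    MDifferentiableAt 𝓘(ℝ, Plane) (𝓡 2) (extChartAt (𝓡 2) x₀).symm y :=
  ((contMDiffOn_extChartAt_symm (n := ∞) x₀).contMDiffAt
    ((isOpen_extChartAt_target x₀).mem_nhds hy)).mdifferentiableAt (by simp)

theorem contMDiffAt_chart {x₀ x : N} (hx : x ∈ (extChartAt (𝓡 2) x₀).source) :
    ContMDiffAt (𝓡 2) 𝓘(ℝ, Plane) ∞ (extChartAt (𝓡 2) x₀) x :=
  (contMDiffOn_extChartAt (n := ∞)).contMDiffAt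
    ((chartAt Plane x₀).open_source.mem_nhds (by rwa [extChartAt_source] at hx))

/-- Near `y` the map factors as the inverse chart after `extChartAt (𝓡 2) x₀ ∘ f`. The chain rule
then expresses its differential in the coordinate frame of the chart at `x₀`. -/
theorem mfderiv_eq_sum_coordVec {f : Plane → N} {y : Plane}
    (hf : MDifferentiableAt 𝓘(ℝ, Plane) (𝓡 2) f y) {x₀ : N}
    (h : f y ∈ (extChartAt (𝓡 2) x₀).source) (v : Plane) :
    (mfderiv 𝓘(ℝ, Plane) (𝓡 2) f y v : Plane) =
      ∑ k, (fderiv ℝ (fun z => extChartAt (𝓡 2) x₀ (f z)) y v) k •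
        (coordVec x₀ (extChartAt (𝓡 2) x₀ (f y)) k : Plane) := by
  set φ := extChartAt (𝓡 2) x₀ with hφ
  have hev : f =ᶠ[𝓝 y] φ.symm ∘ (fun z => φ (f z)) := by
    have : ∀ᶠ z in 𝓝 y, f z ∈ φ.source :=
      hf.continuousAt.eventually ((isOpen_extChartAt_source x₀).mem_nhds h)
    filter_upwards [this] with z hz
    exact (φ.left_inv hz).symm
  have hd : MDifferentiableAt 𝓘(ℝ, Plane) 𝓘(ℝ, Plane) (fun z => φ (f z)) y :=
    ((contMDiffAt_chart h).mdifferentiableAt (by simp)).comp y hf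
  have h1 : mfderiv 𝓘(ℝ, Plane) (𝓡 2) f y =
      mfderiv 𝓘(ℝ, Plane) (𝓡 2) (φ.symm ∘ (fun z => φ (f z))) y := hev.mfderiv_eq
  have h2 := mfderiv_comp (I := 𝓘(ℝ, Plane)) (I' := 𝓘(ℝ, Plane)) (I'' := 𝓡 2) y
    (g := φ.symm) (f := fun z => φ (f z)) (mdifferentiableAt_chart_symm (φ.map_source h)) hd
  have h3 : (mfderiv 𝓘(ℝ, Plane) (𝓡 2) f y v : Plane) =
      (mfderiv 𝓘(ℝ, Plane) (𝓡 2) φ.symm (φ (f y)) : Plane →L[ℝ] Plane)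
        (fderiv ℝ (fun z => φ (f z)) y v) := by
    rw [← mfderiv_eq_fderiv]
    exact (congrArg (fun L : Plane →L[ℝ] Plane => L v) (h1.trans h2) :)
  have h4 : ∀ (A : Plane →L[ℝ] Plane) (w : Plane), A w = ∑ k, w k • A (e k) := fun A w => by
    conv_lhs => rw [plane_eq_sum w]
    simp only [map_sum, map_smul]
  exact h3.trans (h4 _ _)

/-- The transformation law of a covariant two-tensor. With `f` an inverse chart it gives the change
of coordinates; with `f` the first component of a variation it gives the pull-back of `σ`. -/
theorem form_mfderiv {h : ∀ x : N, TangentSpace (𝓡 2) x → TangentSpace (𝓡 2) x → ℝ}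
    (hb : IsBilin h) {f : Plane → N} {y : Plane}
    (hf : MDifferentiableAt 𝓘(ℝ, Plane) (𝓡 2) f y) {x₀ : N}
    (hy : f y ∈ (extChartAt (𝓡 2) x₀).source) (v w : Plane) :
    h (f y) (mfderiv 𝓘(ℝ, Plane) (𝓡 2) f y v) (mfderiv 𝓘(ℝ, Plane) (𝓡 2) f y w) =
      ∑ k, ∑ l, (fderiv ℝ (fun z => extChartAt (𝓡 2) x₀ (f z)) y v) k *
        (fderiv ℝ (fun z => extChartAt (𝓡 2) x₀ (f z)) y w) l *
          coeff h x₀ k l (extChartAt (𝓡 2) x₀ (f y)) := by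
  have hx : f y = (extChartAt (𝓡 2) x₀).symm (extChartAt (𝓡 2) x₀ (f y)) :=
    ((extChartAt (𝓡 2) x₀).left_inv hy).symm
  have h1 := mfderiv_eq_sum_coordVec hf hy v
  have h2 := mfderiv_eq_sum_coordVec hf hy w
  refine (form_congr h hx _ _).trans ?_
  refine (congrArg₂ (fun a b : Plane => h ((extChartAt (𝓡 2) x₀).symm
    (extChartAt (𝓡 2) x₀ (f y))) a b) h1 h2).trans ?_
  exact hb.sum_sum _ _ _ _ _

/-- The transition map between two preferred charts. -/
def trans (x₀ x₁ : N) (y : Plane) : Plane := extChartAt (𝓡 2) x₁ ((extChartAt (𝓡 2) x₀).symm y)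

theorem trans_contDiffAt {x₀ x₁ : N} {y : Plane} (hy : y ∈ (extChartAt (𝓡 2) x₀).target)
    (hy' : (extChartAt (𝓡 2) x₀).symm y ∈ (extChartAt (𝓡 2) x₁).source) :
    ContDiffAt ℝ ∞ (trans x₀ x₁) y := by
  rw [← contMDiffAt_iff_contDiffAt]
  exact (contMDiffAt_chart hy').comp y ((contMDiffOn_extChartAt_symm (n := ∞) x₀).contMDiffAt
    ((isOpen_extChartAt_target x₀).mem_nhds hy))

theorem det_plane (A : Plane →L[ℝ] Plane) :
    A.det = A (e 0) 0 * A (e 1) 1 - A (e 0) 1 * A (e 1) 0 := by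
  rw [ContinuousLinearMap.det, ← LinearMap.det_toMatrix (EuclideanSpace.basisFun (Fin 2) ℝ).toBasis,
    Matrix.det_fin_two]
  simp [LinearMap.toMatrix_apply, e]
  ring

/-- The coefficient matrices are related by `Jᵀ H J`, and determinants are multiplicative. Symmetry
of `h` plays no role. -/
theorem gramDet_trans {h : ∀ x : N, TangentSpace (𝓡 2) x → TangentSpace (𝓡 2) x → ℝ}
    (hb : IsBilin h) {x₀ x₁ : N} {y : Plane} (hy : y ∈ (extChartAt (𝓡 2) x₀).target)
    (hy' : (extChartAt (𝓡 2) x₀).symm y ∈ (extChartAt (𝓡 2) x₁).source) :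
    gramDet h x₀ y = (fderiv ℝ (trans x₀ x₁) y).det ^ 2 * gramDet h x₁ (trans x₀ x₁ y) := by
  have key : ∀ i j, coeff h x₀ i j y = ∑ k, ∑ l, (fderiv ℝ (trans x₀ x₁) y (e i)) k *
      (fderiv ℝ (trans x₀ x₁) y (e j)) l * coeff h x₁ k l (trans x₀ x₁ y) := fun i j =>
    form_mfderiv hb (mdifferentiableAt_chart_symm hy) hy' (e i) (e j)
  rw [gramDet_eq, gramDet_eq, det_plane]
  simp only [key, Fin.sum_univ_two]
  ring

/-! ### The area measure in a chart -/

/-- The set of the coordinates of the points of `B`. -/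
def chartSet (x₀ : N) (B : Set N) : Set Plane :=
  (extChartAt (𝓡 2) x₀).target ∩ (extChartAt (𝓡 2) x₀).symm ⁻¹' B

omit [IsManifold (𝓡 2) ∞ N] in
theorem chartSet_eq_image {x₀ : N} {B : Set N} (hB : B ⊆ (extChartAt (𝓡 2) x₀).source) :
    chartSet x₀ B = extChartAt (𝓡 2) x₀ '' B := by
  ext y
  constructor
  · rintro ⟨h1, h2⟩
    exact ⟨_, h2, (extChartAt (𝓡 2) x₀).right_inv h1⟩
  · rintro ⟨x, hx, rfl⟩
    refine ⟨(extChartAt (𝓡 2) x₀).map_source (hB hx), ?_⟩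
    rw [mem_preimage, (extChartAt (𝓡 2) x₀).left_inv (hB hx)]; exact hx

variable [MeasurableSpace N] [BorelSpace N]

omit [IsManifold (𝓡 2) ∞ N] in
theorem measurableSet_chartSet (x₀ : N) {B : Set N} (hB : MeasurableSet B) :
    MeasurableSet (chartSet x₀ B) := by
  have hT := (isOpen_extChartAt_target (I := 𝓡 2) x₀).measurableSet
  have hm : Measurable ((extChartAt (𝓡 2) x₀).target.domRestrict (extChartAt (𝓡 2) x₀).symm) :=
    (continuousOn_iff_continuous_domRestrict.1 (continuousOn_extChartAt_symm x₀)).measurable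
  have := hT.subtype_image (hm hB)
  convert this using 1
  ext y; simp [chartSet, and_comm]

-- The inverse chart is controlled only on its target, where it is continuous. Absolute continuity
-- then gives a.e. measurability for any density, measurable or not.
omit [IsManifold (𝓡 2) ∞ N] in
theorem aemeasurable_chart_symm (x₀ : N) (d : Plane → ENNReal) :
    AEMeasurable (extChartAt (𝓡 2) x₀).symm
      ((volume.restrict (extChartAt (𝓡 2) x₀).target).withDensity d) :=
  ((continuousOn_extChartAt_symm x₀).aemeasurable
    (isOpen_extChartAt_target (I := 𝓡 2) x₀).measurableSet).mono_ac
      (withDensity_absolutelyContinuous _ _)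

omit [IsManifold (𝓡 2) ∞ N] in
theorem preimage_inter_target (x₀ : N) {B : Set N} (hB : MeasurableSet B) (d : Plane → ENNReal) :
    (((volume.restrict (extChartAt (𝓡 2) x₀).target).withDensity d).map
      (extChartAt (𝓡 2) x₀).symm).restrict B =
    ((volume.restrict (chartSet x₀ B)).withDensity d).map (extChartAt (𝓡 2) x₀).symm := by
  have hT := (isOpen_extChartAt_target (I := 𝓡 2) x₀).measurableSet
  have hm := measurableSet_chartSet x₀ hB
  rw [Measure.restrict_map_of_aemeasurable (aemeasurable_chart_symm x₀ d) hB]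
  congr 1
  have h1 : ((volume.restrict (extChartAt (𝓡 2) x₀).target).withDensity d) =
      (volume.withDensity d).restrict (extChartAt (𝓡 2) x₀).target :=
    (restrict_withDensity hT d).symm
  rw [h1, Measure.restrict_restrict₀' hT.nullMeasurableSet, inter_comm, ← restrict_withDensity hm]
  rfl

omit [IsManifold (𝓡 2) ∞ N] in
theorem chartArea_apply (h : ∀ x : N, TangentSpace (𝓡 2) x → TangentSpace (𝓡 2) x → ℝ) (x₀ : N)
    {B : Set N} (hB : MeasurableSet B) :
    chartArea h x₀ B = ∫⁻ y in chartSet x₀ B, ENNReal.ofReal √(gramDet h x₀ y) := by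
  have := congrArg (fun μ : Measure N => μ univ) (preimage_inter_target x₀ hB
    (fun y => ENNReal.ofReal √(gramDet h x₀ y)))
  simp only [Measure.restrict_apply_univ] at this
  rw [chartArea, this, Measure.map_apply_of_aemeasurable _ MeasurableSet.univ, preimage_univ,
    withDensity_apply _ MeasurableSet.univ, Measure.restrict_univ]
  exact (((continuousOn_extChartAt_symm x₀).mono inter_subset_left).aemeasurable
    (measurableSet_chartSet x₀ hB)).mono_ac (withDensity_absolutelyContinuous _ _)

/-- Change of variables under the transition map: the factor `|det|` is exactly the one by which the
square roots of the Gram determinants differ. -/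
theorem chartArea_congr_chart {h : ∀ x : N, TangentSpace (𝓡 2) x → TangentSpace (𝓡 2) x → ℝ}
    (hb : IsBilin h) {x₀ x₁ : N} {B : Set N} (hB : MeasurableSet B)
    (h0 : B ⊆ (extChartAt (𝓡 2) x₀).source) (h1 : B ⊆ (extChartAt (𝓡 2) x₁).source) :
    chartArea h x₀ B = chartArea h x₁ B := by
  rw [chartArea_apply h x₀ hB, chartArea_apply h x₁ hB]
  have himg : chartSet x₁ B = trans x₀ x₁ '' chartSet x₀ B := by
    rw [chartSet_eq_image h0, chartSet_eq_image h1, image_image]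
    refine image_congr fun x hx => ?_
    simp only [trans, (extChartAt (𝓡 2) x₀).left_inv (h0 hx)]
  rw [himg, lintegral_image_eq_lintegral_abs_det_fderiv_mul volume (measurableSet_chartSet x₀ hB)
    (f' := fderiv ℝ (trans x₀ x₁))]
  · refine setLIntegral_congr_fun (measurableSet_chartSet x₀ hB) fun y hy => ?_
    rw [gramDet_trans hb hy.1 (h1 hy.2), Real.sqrt_mul (sq_nonneg _), Real.sqrt_sq_eq_abs,
      ENNReal.ofReal_mul (abs_nonneg _)]
  · intro y hy
    exact (((trans_contDiffAt hy.1 (h1 hy.2)).differentiableAt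
      (by simp)).hasFDerivAt).hasFDerivWithinAt
  · intro y hy z hz hyz
    have := (extChartAt (𝓡 2) x₁).injOn (h1 hy.2) (h1 hz.2) hyz
    exact (extChartAt (𝓡 2) x₀).symm.injOn hy.1 hz.1 this

omit [IsManifold (𝓡 2) ∞ N] in
theorem chartArea_inter_source (h : ∀ x : N, TangentSpace (𝓡 2) x → TangentSpace (𝓡 2) x → ℝ)
    (x₀ : N) {B : Set N} (hB : MeasurableSet B) :
    chartArea h x₀ B = chartArea h x₀ (B ∩ (extChartAt (𝓡 2) x₀).source) := by
  rw [chartArea_apply h x₀ hB,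
    chartArea_apply h x₀ (hB.inter (isOpen_extChartAt_source x₀).measurableSet)]
  congr 2
  ext y
  simp only [chartSet, mem_inter_iff, mem_preimage]
  exact ⟨fun hy => ⟨hy.1, hy.2, (extChartAt (𝓡 2) x₀).map_target hy.1⟩, fun hy => ⟨hy.1, hy.2.1⟩⟩

variable [SecondCountableTopology N]

-- Countably many chart domains cover a second countable surface, and successive differences make
-- them disjoint. Measures given chart by chart can then be glued as a countable sum.
omit [IsManifold (𝓡 2) ∞ N] in
theorem exists_disjoint_chart_cover (N : Type*) [TopologicalSpace N] [ChartedSpace Plane N]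
    [MeasurableSpace N] [BorelSpace N] [SecondCountableTopology N] [Nonempty N] :
    ∃ (f : ℕ → N) (D : ℕ → Set N), (∀ n, MeasurableSet (D n)) ∧
      Pairwise (Function.onFun Disjoint D) ∧
      (∀ n, D n ⊆ (extChartAt (𝓡 2) (f n)).source) ∧ ⋃ n, D n = univ := by
  obtain ⟨s, hs, hcov⟩ := TopologicalSpace.countable_cover_nhds
    (fun x : N => extChartAt_source_mem_nhds (I := 𝓡 2) x)
  have hne : s.Nonempty := by
    by_contra hcon
    rw [not_nonempty_iff_eq_empty] at hcon
    have : Classical.arbitrary N ∈ ⋃ x ∈ s, (extChartAt (𝓡 2) x).source := hcov ▸ mem_univ _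
    simp [hcon] at this
  obtain ⟨f, hf⟩ := hs.exists_eq_range hne
  refine ⟨f, disjointed fun n => (extChartAt (𝓡 2) (f n)).source,
    MeasurableSet.disjointed fun n => (isOpen_extChartAt_source (f n)).measurableSet,
    disjoint_disjointed _, fun n => disjointed_subset _ n, ?_⟩
  rw [iUnion_disjointed, ← hcov, hf, biUnion_range]

/-- The supremum in `areaMeasure` is taken in the lattice of measures, so it cannot be evaluated set
by set. Gluing the chart measures along a disjoint countable cover gives one measure that dominates
all of them, and that agrees with `chartArea h x₀` on subsets of the chart domain at `x₀`, because
charts agree on overlaps. This is the upper bound; the lower bound is the definition of a supremum.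
-/
theorem areaMeasure_eq_chartArea {h : ∀ x : N, TangentSpace (𝓡 2) x → TangentSpace (𝓡 2) x → ℝ}
    (hb : IsBilin h) {x₀ : N} {B : Set N} (hB : MeasurableSet B)
    (h0 : B ⊆ (extChartAt (𝓡 2) x₀).source) :
    areaMeasure h B = chartArea h x₀ B := by
  have : Nonempty N := ⟨x₀⟩
  have hSm : ∀ x : N, MeasurableSet (extChartAt (𝓡 2) x).source := fun x =>
    (isOpen_extChartAt_source x).measurableSet
  obtain ⟨f, D, hDm, hDd, hDs, hDu⟩ := exists_disjoint_chart_cover N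
  have hsum : ∀ (x : N) (A : Set N), MeasurableSet A → A ⊆ (extChartAt (𝓡 2) x).source →
      chartArea h x A = (Measure.sum fun n => (chartArea h (f n)).restrict (D n)) A := by
    intro x A hA hAx
    rw [Measure.sum_apply _ hA]
    have : A = ⋃ n, A ∩ D n := by rw [← inter_iUnion, hDu, inter_univ]
    conv_lhs => rw [this]
    rw [measure_iUnion (fun i j hij => (hDd hij).mono inter_subset_right
      inter_subset_right) fun n => hA.inter (hDm n)]
    refine tsum_congr fun n => ?_
    rw [Measure.restrict_apply hA]
    exact chartArea_congr_chart hb (hA.inter (hDm n)) (inter_subset_left.trans hAx)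
      (inter_subset_right.trans (hDs n))
  have hle : areaMeasure h ≤ Measure.sum fun n => (chartArea h (f n)).restrict (D n) := by
    refine iSup_le fun x => Measure.le_iff.2 fun A hA => ?_
    rw [chartArea_inter_source h x hA, hsum x _ (hA.inter (hSm x)) inter_subset_right]
    exact measure_mono inter_subset_left
  refine le_antisymm ?_ (Measure.le_iff.1 (le_iSup (chartArea h) x₀) B hB)
  rw [hsum x₀ B hB h0]
  exact Measure.le_iff.1 hle B hB

theorem areaMeasure_apply {h : ∀ x : N, TangentSpace (𝓡 2) x → TangentSpace (𝓡 2) x → ℝ}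
    (hb : IsBilin h) {x₀ : N} {B : Set N} (hB : MeasurableSet B)
    (h0 : B ⊆ (extChartAt (𝓡 2) x₀).source) :
    areaMeasure h B = ∫⁻ y in chartSet x₀ B, ENNReal.ofReal √(gramDet h x₀ y) := by
  rw [areaMeasure_eq_chartArea hb hB h0, chartArea_apply h x₀ hB]

theorem areaMeasure_eq_ofReal {h : ∀ x : N, TangentSpace (𝓡 2) x → TangentSpace (𝓡 2) x → ℝ}
    (hb : IsBilin h) {x₀ : N} {B : Set N} (hB : MeasurableSet B)
    (h0 : B ⊆ (extChartAt (𝓡 2) x₀).source) {a : Plane → ℝ} (ha : IntegrableOn a (chartSet x₀ B))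
    (heq : ∀ y ∈ chartSet x₀ B, √(gramDet h x₀ y) = a y) :
    areaMeasure h B = ENNReal.ofReal (∫ y in chartSet x₀ B, a y) := by
  have hm := measurableSet_chartSet x₀ hB
  rw [areaMeasure_apply hb hB h0, ofReal_integral_eq_lintegral_ofReal ha]
  · exact setLIntegral_congr_fun hm fun y hy => by simp only [heq y hy]
  · exact (ae_restrict_iff' hm).2 (Eventually.of_forall fun y hy => by
      rw [← heq y hy]; exact Real.sqrt_nonneg _)

theorem areaMeasure_restrict {h : ∀ x : N, TangentSpace (𝓡 2) x → TangentSpace (𝓡 2) x → ℝ}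
    (hb : IsBilin h) {x₀ : N} {B : Set N} (hB : MeasurableSet B)
    (h0 : B ⊆ (extChartAt (𝓡 2) x₀).source) :
    (areaMeasure h).restrict B =
      ((volume.restrict (chartSet x₀ B)).withDensity
        fun y => ENNReal.ofReal √(gramDet h x₀ y)).map (extChartAt (𝓡 2) x₀).symm := by
  rw [← preimage_inter_target x₀ hB]
  refine Measure.ext fun A hA => ?_
  rw [Measure.restrict_apply hA, Measure.restrict_apply hA]
  exact areaMeasure_eq_chartArea hb (hA.inter hB) (inter_subset_right.trans h0)

/-- Integration with respect to the area measure in a chart. -/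
theorem setIntegral_areaMeasure {h : ∀ x : N, TangentSpace (𝓡 2) x → TangentSpace (𝓡 2) x → ℝ}
    (hb : IsBilin h) {x₀ : N} {B : Set N} (hB : MeasurableSet B)
    (h0 : B ⊆ (extChartAt (𝓡 2) x₀).source) {f : N → ℝ} {g d : Plane → ℝ}
    (hd : ContinuousOn d (chartSet x₀ B))
    (hgc : ContinuousOn g (chartSet x₀ B))
    (hgi : IntegrableOn (fun y => g y * d y) (chartSet x₀ B))
    (hdh : ∀ y ∈ chartSet x₀ B, √(gramDet h x₀ y) = d y)
    (hfg : ∀ y ∈ chartSet x₀ B, f ((extChartAt (𝓡 2) x₀).symm y) = g y) :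
    IntegrableOn f B (areaMeasure h) ∧
      ∫ x in B, f x ∂(areaMeasure h) = ∫ y in chartSet x₀ B, g y * d y := by
  have hm := measurableSet_chartSet x₀ hB
  have hρ : AEMeasurable (fun y => ENNReal.ofReal √(gramDet h x₀ y))
      (volume.restrict (chartSet x₀ B)) := by
    refine AEMeasurable.congr (f := fun y => ENNReal.ofReal (d y))
      ((hd.aemeasurable hm).ennreal_ofReal) ?_
    exact (ae_restrict_iff' hm).2 (Eventually.of_forall fun y hy => by simp only [hdh y hy])
  have hsym : AEMeasurable (extChartAt (𝓡 2) x₀).symm ((volume.restrict (chartSet x₀ B)).withDensity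
      fun y => ENNReal.ofReal √(gramDet h x₀ y)) :=
    (((continuousOn_extChartAt_symm x₀).mono inter_subset_left).aemeasurable hm).mono_ac
      (withDensity_absolutelyContinuous _ _)
  have hgφ : ∀ x ∈ B, f x = g (extChartAt (𝓡 2) x₀ x) := by
    intro x hx
    have := hfg (extChartAt (𝓡 2) x₀ x) ⟨(extChartAt (𝓡 2) x₀).map_source (h0 hx), by
      rw [mem_preimage, (extChartAt (𝓡 2) x₀).left_inv (h0 hx)]; exact hx⟩
    rwa [(extChartAt (𝓡 2) x₀).left_inv (h0 hx)] at this
  -- Measurability of `f` on `B` is not assumed; it follows since `f` is the continuous function `g`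
  -- read through the chart.
  have hfc : ContinuousOn f B := by
    refine ContinuousOn.congr (f := fun x => g (extChartAt (𝓡 2) x₀ x)) ?_ hgφ
    refine hgc.comp ((continuousOn_extChartAt x₀).mono h0) fun x hx => ?_
    exact ⟨(extChartAt (𝓡 2) x₀).map_source (h0 hx), by
      rw [mem_preimage, (extChartAt (𝓡 2) x₀).left_inv (h0 hx)]; exact hx⟩
  have hfm : AEStronglyMeasurable f ((areaMeasure h).restrict B) := hfc.aestronglyMeasurable hB
  have hcongr : (fun y => (ENNReal.ofReal √(gramDet h x₀ y)).toReal •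
      f ((extChartAt (𝓡 2) x₀).symm y)) =ᵐ[volume.restrict (chartSet x₀ B)]
        fun y => g y * d y :=
    (ae_restrict_iff' hm).2 (Eventually.of_forall fun y hy => by
      beta_reduce
      rw [ENNReal.toReal_ofReal (Real.sqrt_nonneg _), hdh y hy, hfg y hy, smul_eq_mul, mul_comm])
  have hlt : ∀ᵐ y ∂(volume.restrict (chartSet x₀ B)), ENNReal.ofReal √(gramDet h x₀ y) < ⊤ :=
    Eventually.of_forall fun y => ENNReal.ofReal_lt_top
  rw [areaMeasure_restrict hb hB h0] at hfm
  constructor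
  · rw [IntegrableOn, areaMeasure_restrict hb hB h0, integrable_map_measure hfm hsym,
      integrable_withDensity_iff_integrable_smul₀' hρ hlt]
    exact hgi.congr hcongr.symm
  · rw [areaMeasure_restrict hb hB h0, integral_map hsym hfm,
      integral_withDensity_eq_integral_toReal_smul₀ hρ hlt]
    exact integral_congr_ae hcongr

end

section

variable {N : Type*} [TopologicalSpace N] [ChartedSpace Plane N] [IsManifold (𝓡 2) ∞ N]

/-! ### Coordinate vector fields -/

/-- The `k`-th coordinate of a vector of the plane. -/
abbrev planeCoord (k : Fin 2) (v : Plane) : ℝ := v k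

/-- The differential of `f : N → ℝ`. -/
def diff (f : N → ℝ) (x : N) (v : TangentSpace (𝓡 2) x) : ℝ := mfderiv (𝓡 2) 𝓘(ℝ, ℝ) f x v

/-- The coordinate field is the image of a constant field under the tangent map of the inverse
chart. As a map to the tangent bundle it can be inserted into the smooth section `σ`, which makes
the coefficients of `σ` smooth. -/
theorem contMDiffOn_coordVec (x₀ : N) (i : Fin 2) :
    ContMDiffOn 𝓘(ℝ, Plane) (𝓡 2).tangent ∞
      (fun y => (⟨(extChartAt (𝓡 2) x₀).symm y, coordVec x₀ y i⟩ : TangentBundle (𝓡 2) N))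
      (extChartAt (𝓡 2) x₀).target := by
  have hT := isOpen_extChartAt_target (I := 𝓡 2) x₀
  have h1 := (contMDiffOn_extChartAt_symm (I := 𝓡 2) (n := ∞) x₀).contMDiffOn_tangentMapWithin
    (m := ∞) (by simp) hT.uniqueMDiffOn
  have h2 : ContMDiff 𝓘(ℝ, Plane) (𝓘(ℝ, Plane).tangent) ∞
      (fun y : Plane => (⟨y, e i⟩ : TangentBundle 𝓘(ℝ, Plane) Plane)) := by
    intro y
    exact contMDiffAt_vectorSpace_iff_contDiffAt.2 contDiffAt_const
  have h3 := h1.comp (s := (extChartAt (𝓡 2) x₀).target) h2.contMDiffOn (fun y hy => hy)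
  refine h3.congr fun y hy => ?_
  simp only [Function.comp_def, tangentMapWithin, coordVec]
  rw [mfderivWithin_of_isOpen hT hy]
  rfl

theorem contDiffOn_coeff_form (σ : SurfaceMetric N) (x₀ : N) (i j : Fin 2) :
    ContDiffOn ℝ ∞ (coeff (form σ) x₀ i j) (extChartAt (𝓡 2) x₀).target := by
  rw [← contMDiffOn_iff_contDiffOn]
  have h0 := σ.contMDiff.comp_contMDiffOn (contMDiffOn_extChartAt_symm (I := 𝓡 2) (n := ∞) x₀)
  have : ContMDiffOn 𝓘(ℝ, Plane) ((𝓡 2).prod 𝓘(ℝ)) ∞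
      (fun y ↦ Bundle.TotalSpace.mk' ℝ (E := Bundle.Trivial N ℝ)
        ((extChartAt (𝓡 2) x₀).symm y) (coeff (form σ) x₀ i j y)) (extChartAt (𝓡 2) x₀).target := by
    apply ContMDiffOn.clm_bundle_apply₂ (F₁ := Plane) (F₂ := Plane)
    · exact h0
    · exact contMDiffOn_coordVec x₀ i
    · exact contMDiffOn_coordVec x₀ j
  intro y hy
  have := this y hy
  simp only [Bundle.contMDiffWithinAt_totalSpace] at this
  exact this.2

theorem mfderiv_chart_coordVec {x₀ : N} {y : Plane} (hy : y ∈ (extChartAt (𝓡 2) x₀).target)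
    (v : Plane) :
    (mfderiv (𝓡 2) 𝓘(ℝ, Plane) (extChartAt (𝓡 2) x₀) ((extChartAt (𝓡 2) x₀).symm y)
      (mfderiv 𝓘(ℝ, Plane) (𝓡 2) (extChartAt (𝓡 2) x₀).symm y v) : Plane) = v := by
  have h := mfderiv_extChartAt_comp_mfderivWithin_extChartAt_symm (I := 𝓡 2) hy
  rw [ModelWithCorners.range_eq_univ, mfderivWithin_univ] at h
  exact (congrArg (fun L : Plane →L[ℝ] Plane => L v) h :)

theorem coordVec_mfderiv_chart {x₀ : N} {y : Plane} (hy : y ∈ (extChartAt (𝓡 2) x₀).target)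
    (w : TangentSpace (𝓡 2) ((extChartAt (𝓡 2) x₀).symm y)) :
    w = ∑ k, planeCoord k (mfderiv (𝓡 2) 𝓘(ℝ, Plane) (extChartAt (𝓡 2) x₀)
      ((extChartAt (𝓡 2) x₀).symm y) w) • coordVec x₀ y k := by
  have h := mfderivWithin_extChartAt_symm_comp_mfderiv_extChartAt (I := 𝓡 2) hy
  rw [ModelWithCorners.range_eq_univ, mfderivWithin_univ] at h
  have h2 := (congrArg (fun L : Plane →L[ℝ] Plane => L w) h.symm :)
  have h4 : ∀ (A : Plane →L[ℝ] Plane) (w : Plane), A w = ∑ k, w k • A (e k) := fun A w => by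
    conv_lhs => rw [plane_eq_sum w]
    simp only [map_sum, map_smul]
  exact h2.trans (h4 (mfderiv 𝓘(ℝ, Plane) (𝓡 2) (extChartAt (𝓡 2) x₀).symm y) _)

theorem coordVec_linearIndependent {x₀ : N} {y : Plane}
    (hy : y ∈ (extChartAt (𝓡 2) x₀).target) {a b : ℝ}
    (h : a • coordVec x₀ y 0 + b • coordVec x₀ y 1 = 0) : a = 0 ∧ b = 0 := by
  have h1 : (mfderiv 𝓘(ℝ, Plane) (𝓡 2) (extChartAt (𝓡 2) x₀).symm y : Plane →L[ℝ] Plane)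
      (a • e 0 + b • e 1) = 0 := by
    have hA : ∀ A : Plane →L[ℝ] Plane, A (a • e 0 + b • e 1) = a • A (e 0) + b • A (e 1) :=
      fun A => by rw [map_add, map_smul, map_smul]
    exact (hA _).trans h
  have h2 := mfderiv_chart_coordVec hy (a • e 0 + b • e 1)
  have h3 : a • e 0 + b • e 1 = (0 : Plane) := by
    rw [← h2]
    refine (congrArg (mfderiv (𝓡 2) 𝓘(ℝ, Plane) (extChartAt (𝓡 2) x₀)
      ((extChartAt (𝓡 2) x₀).symm y) : Plane →L[ℝ] Plane) h1).trans (map_zero _)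
  constructor
  · simpa [e] using congrArg (fun v : Plane => v 0) h3
  · simpa [e] using congrArg (fun v : Plane => v 1) h3

/-! ### Gram determinants and gradients -/

omit [IsManifold (𝓡 2) ∞ N]

theorem gram_pos {h : ∀ x : N, TangentSpace (𝓡 2) x → TangentSpace (𝓡 2) x → ℝ}
    (hb : IsBilin h) {x : N} (hs : ∀ v w, h x v w = h x w v) (hp : ∀ v, v ≠ 0 → 0 < h x v v)
    {v₀ v₁ : TangentSpace (𝓡 2) x}
    (hli : ∀ a b : ℝ, a • v₀ + b • v₁ = 0 → a = 0 ∧ b = 0) :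
    0 < h x v₀ v₀ * h x v₁ v₁ - h x v₀ v₁ * h x v₁ v₀ := by
  have h0 : v₀ ≠ 0 := by
    rintro rfl
    have := (hli 1 0 (by simp)).1
    norm_num at this
  have hp0 := hp v₀ h0
  -- This vector is `h x v₀ v₀` times the part of `v₁` orthogonal to `v₀`. Its square length is `h x
  -- v₀ v₀` times the Gram determinant.
  have hne : (-(h x v₀ v₁)) • v₀ + (h x v₀ v₀) • v₁ ≠ 0 := fun hz => hp0.ne' (hli _ _ hz).2
  have := hp _ hne
  simp only [hb.add_left, hb.add_right, hb.smul_left, hb.smul_right, hs v₁ v₀] at this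
  rw [hs v₁ v₀]
  have h2 : 0 < h x v₀ v₀ * (h x v₀ v₀ * h x v₁ v₁ - h x v₀ v₁ * h x v₀ v₁) := by
    nlinarith [this]
  exact pos_of_mul_pos_right h2 hp0.le

/-- Duality with the differential determines the gradient independently of the basis used in its
definition. This is what permits computing it in any coordinate frame. -/
theorem form_grad {h : ∀ x : N, TangentSpace (𝓡 2) x → TangentSpace (𝓡 2) x → ℝ}
    (hb : IsBilin h) {x : N} (hs : ∀ v w, h x v w = h x w v) (hp : ∀ v, v ≠ 0 → 0 < h x v v)
    (f : N → ℝ) (w : TangentSpace (𝓡 2) x) :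
    h x (grad h f x) w = diff f x w := by
  set ξ : Fin 2 → ℝ := fun j => diff f x (stdVec x j) with hξ
  set M : Matrix (Fin 2) (Fin 2) ℝ := Matrix.of fun i j : Fin 2 => h x (stdVec x i) (stdVec x j)
    with hM
  have hdet : M.det ≠ 0 := by
    rw [Matrix.det_fin_two]
    refine (gram_pos hb hs hp (v₀ := stdVec x 0) (v₁ := stdVec x 1) fun a b hab => ?_).ne'
    have h3 : a • e 0 + b • e 1 = (0 : Plane) := hab
    constructor
    · simpa [e] using congrArg (fun v : Plane => v 0) h3
    · simpa [e] using congrArg (fun v : Plane => v 1) h3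
  have hw : w = ∑ j, planeCoord j w • stdVec x j := plane_eq_sum (w : Plane)
  have hg : grad h f x = ∑ i, (M⁻¹.mulVec ξ) i • stdVec x i := rfl
  have hT : ∀ j, ∑ i, (M⁻¹.mulVec ξ) i * M i j = ξ j := by
    intro j
    have h1 : M.mulVec (M⁻¹.mulVec ξ) = ξ := by
      rw [Matrix.mulVec_mulVec, Matrix.mul_nonsing_inv _ (isUnit_iff_ne_zero.2 hdet),
        Matrix.one_mulVec]
    have h2 := congrFun h1 j
    rw [← h2, Matrix.mulVec, dotProduct]
    refine Finset.sum_congr rfl fun i _ => ?_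
    rw [mul_comm]; congr 1; exact hs _ _
  have hr : diff f x w = ∑ j, planeCoord j w * ξ j := by
    have h4 : ∀ (A : Plane →L[ℝ] ℝ) (w : Plane), A w = ∑ k, w k * A (e k) := fun A w => by
      conv_lhs => rw [plane_eq_sum w]
      simp only [map_sum, map_smul, smul_eq_mul]
    exact h4 _ _
  rw [hr, hg]
  conv_lhs => rw [hw]
  rw [hb.sum_sum, Finset.sum_comm]
  refine Finset.sum_congr rfl fun j _ => ?_
  rw [← hT j, Finset.mul_sum]
  refine Finset.sum_congr rfl fun i _ => ?_
  have : M i j = h x (stdVec x i) (stdVec x j) := rfl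
  rw [this]; ring

/-- With `M` the Gram matrix of the frame and `ξ = M a`, the left factor is `aᵀ M a = ξᵀ M⁻¹ ξ`.
Multiplication by `det M` turns `M⁻¹` into the cofactor matrix. The same cofactor form measures the
gap between area and calibration, which is how `|∇η|²` arises. -/
theorem form_grad_grad {h : ∀ x : N, TangentSpace (𝓡 2) x → TangentSpace (𝓡 2) x → ℝ}
    (hb : IsBilin h) {x : N} (hs : ∀ v w, h x v w = h x w v) (hp : ∀ v, v ≠ 0 → 0 < h x v v)
    (f : N → ℝ) {v : Fin 2 → TangentSpace (𝓡 2) x} {ξ : Fin 2 → ℝ}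
    (hv : ∃ a : Fin 2 → ℝ, grad h f x = ∑ i, a i • v i)
    (hξ : ∀ i, diff f x (v i) = ξ i) :
    h x (grad h f x) (grad h f x) *
        (h x (v 0) (v 0) * h x (v 1) (v 1) - h x (v 0) (v 1) * h x (v 1) (v 0)) =
      h x (v 1) (v 1) * ξ 0 ^ 2 - 2 * h x (v 0) (v 1) * (ξ 0 * ξ 1) + h x (v 0) (v 0) * ξ 1 ^ 2 := by
  obtain ⟨a, ha⟩ := hv
  have h0 := form_grad hb hs hp f (v 0)
  have h1 := form_grad hb hs hp f (v 1)
  rw [hξ, ha] at h0 h1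
  rw [← h0, ← h1, ha]
  simp only [Fin.sum_univ_two, hb.add_left, hb.add_right, hb.smul_left, hb.smul_right,
    hs (v 1) (v 0)]
  ring

end

/-! ### The metrics -/

section

variable {N : Type*} [TopologicalSpace N] [ChartedSpace Plane N] [IsManifold (𝓡 2) ∞ N]

/-- The one-form on `N × ℝ` dual to the `r`-independent extension of the normal `ν`. -/
def normalForm (σ : SurfaceMetric N) (u : N → ℝ) (p : N × ℝ)
    (v : TangentSpace ((𝓡 2).prod 𝓘(ℝ, ℝ)) p) : ℝ :=
  angle σ u p.1 * (v.2 - diff u p.1 v.1)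

/-- The degenerate metric `e^r (σ + dr² - ν♭ ⊗ ν♭)`. Its area form is the calibration
`e^r ι_ν dvol`. -/
def calibration (σ : SurfaceMetric N) (u : N → ℝ) (p : N × ℝ)
    (v w : TangentSpace ((𝓡 2).prod 𝓘(ℝ, ℝ)) p) : ℝ :=
  Real.exp p.2 * (productMetric σ p v w - normalForm σ u p v * normalForm σ u p w)

theorem isBilin_form (σ : SurfaceMetric N) : IsBilin (form σ) where
  add_left p v v' w := by simp [form]
  smul_left p a v w := by simp [form]
  add_right p v w w' := by simp [form]
  smul_right p a v w := by simp [form]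

theorem form_symm (σ : SurfaceMetric N) (x : N) (v w : TangentSpace (𝓡 2) x) :
    form σ x v w = form σ x w v := σ.symm x v w

theorem form_pos (σ : SurfaceMetric N) (x : N) (v : TangentSpace (𝓡 2) x) (hv : v ≠ 0) :
    0 < form σ x v v := σ.pos x v hv

theorem form_nonneg (σ : SurfaceMetric N) (x : N) (v : TangentSpace (𝓡 2) x) :
    0 ≤ form σ x v v := by
  by_cases hv : v = 0
  · subst hv; simp [form]
  · exact (form_pos σ x v hv).le

theorem isBilin_productMetric (σ : SurfaceMetric N) : IsBilin (productMetric σ) := by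
  have hb := isBilin_form σ
  constructor
  · intro p v v' w
    have h1 := hb.add_left p.1 v.1 v'.1 w.1
    have : (v.2 + v'.2) * w.2 = v.2 * w.2 + v'.2 * w.2 := by ring
    exact (congrArg₂ (· + ·) h1 this).trans (by unfold productMetric; ring)
  · intro p a v w
    have h1 := hb.smul_left p.1 a v.1 w.1
    have : (a * v.2) * w.2 = a * (v.2 * w.2) := by ring
    exact (congrArg₂ (· + ·) h1 this).trans (by unfold productMetric; ring)
  · intro p v w w'
    have h1 := hb.add_right p.1 v.1 w.1 w'.1
    have : v.2 * (w.2 + w'.2) = v.2 * w.2 + v.2 * w'.2 := by ring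
    exact (congrArg₂ (· + ·) h1 this).trans (by unfold productMetric; ring)
  · intro p a v w
    have h1 := hb.smul_right p.1 a v.1 w.1
    have : v.2 * (a * w.2) = a * (v.2 * w.2) := by ring
    exact (congrArg₂ (· + ·) h1 this).trans (by unfold productMetric; ring)

theorem isBilin_weightedMetric (σ : SurfaceMetric N) : IsBilin (weightedMetric σ) := by
  have hb := isBilin_productMetric σ
  constructor <;> intros <;> unfold weightedMetric
  · rw [hb.add_left]; ring
  · rw [hb.smul_left]; ring
  · rw [hb.add_right]; ring
  · rw [hb.smul_right]; ring

theorem normalForm_add (σ : SurfaceMetric N) (u : N → ℝ) (p : N × ℝ)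
    (v w : TangentSpace ((𝓡 2).prod 𝓘(ℝ, ℝ)) p) :
    normalForm σ u p (v + w) = normalForm σ u p v + normalForm σ u p w := by
  have h := map_add (mfderiv (𝓡 2) 𝓘(ℝ, ℝ) u p.1 : Plane →L[ℝ] ℝ) v.1 w.1
  refine (congrArg (fun t : ℝ => angle σ u p.1 * ((v.2 + w.2 : ℝ) - t)) h).trans ?_
  have key : ∀ t a b c d : ℝ, t * ((a + b) - (c + d)) = t * (a - c) + t * (b - d) := by
    intros; ring
  exact key _ _ _ _ _

theorem normalForm_smul (σ : SurfaceMetric N) (u : N → ℝ) (p : N × ℝ) (a : ℝ)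
    (v : TangentSpace ((𝓡 2).prod 𝓘(ℝ, ℝ)) p) :
    normalForm σ u p (a • v) = a * normalForm σ u p v := by
  have h := map_smul (mfderiv (𝓡 2) 𝓘(ℝ, ℝ) u p.1 : Plane →L[ℝ] ℝ) a v.1
  refine (congrArg (fun t : ℝ => angle σ u p.1 * ((a * v.2 : ℝ) - t)) h).trans ?_
  have key : ∀ t b c : ℝ, t * (a * b - a • c) = a * (t * (b - c)) := by
    intros; rw [smul_eq_mul]; ring
  exact key _ _ _

theorem isBilin_calibration (σ : SurfaceMetric N) (u : N → ℝ) : IsBilin (calibration σ u) := by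
  have hb := isBilin_productMetric σ
  constructor <;> intros <;> unfold calibration
  · rw [hb.add_left, normalForm_add]; ring
  · rw [hb.smul_left, normalForm_smul]; ring
  · rw [hb.add_right, normalForm_add]; ring
  · rw [hb.smul_right, normalForm_smul]; ring

omit [IsManifold (𝓡 2) ∞ N] in
theorem IsBilin.pullback {E H M : Type*} [NormedAddCommGroup E] [NormedSpace ℝ E]
    [TopologicalSpace H] {J : ModelWithCorners ℝ E H} [TopologicalSpace M] [ChartedSpace H M]
    {G : ∀ p : M, TangentSpace J p → TangentSpace J p → ℝ} (hG : IsBilin G) (f : N → M) :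
    IsBilin (pullback J G f) := by
  constructor <;> intros <;> unfold TranslatingGraph.pullback
  · rw [map_add, hG.add_left]
  · rw [map_smul, hG.smul_left]
  · rw [map_add, hG.add_right]
  · rw [map_smul, hG.smul_right]

/-! ### Maps to `N × ℝ` in a chart -/

/-- The first component of `G : N → N × ℝ` in the preferred chart at `x₀`. -/
def chartRep (x₀ : N) (G : N → N × ℝ) (y : Plane) : Plane :=
  extChartAt (𝓡 2) x₀ (G ((extChartAt (𝓡 2) x₀).symm y)).1

/-- The second component of `G : N → N × ℝ` in the preferred chart at `x₀`. -/
def heightRep (x₀ : N) (G : N → N × ℝ) (y : Plane) : ℝ := (G ((extChartAt (𝓡 2) x₀).symm y)).2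

/-- The height of `G : N → N × ℝ` above the graph of `u` in the preferred chart at `x₀`. -/
def defectRep (x₀ : N) (u : N → ℝ) (G : N → N × ℝ) (y : Plane) : ℝ :=
  heightRep x₀ G y - u (G ((extChartAt (𝓡 2) x₀).symm y)).1

/-- The coefficients of the metric induced from `σ + dr²` on the image of `G`, in terms of the
chart representation of `G`. -/
def gramRep (σ : SurfaceMetric N) (x₀ : N) (G : N → N × ℝ) (i j : Fin 2) (y : Plane) : ℝ :=
  ∑ k, ∑ l, pd i (fun z => chartRep x₀ G z k) y * pd j (fun z => chartRep x₀ G z l) y *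
    coeff (form σ) x₀ k l (chartRep x₀ G y) + pd i (heightRep x₀ G) y * pd j (heightRep x₀ G) y

/-- Splits the differential of `G` on a coordinate vector into its components along `N` and `ℝ`; the
pull-backs below are computed from these two. -/
theorem mfderiv_coordVec_prod {x₀ : N} {G : N → N × ℝ} {y : Plane}
    (hy : y ∈ (extChartAt (𝓡 2) x₀).target)
    (hG : MDifferentiableAt (𝓡 2) ((𝓡 2).prod 𝓘(ℝ, ℝ)) G ((extChartAt (𝓡 2) x₀).symm y))
    (i : Fin 2) :
    MDifferentiableAt 𝓘(ℝ, Plane) (𝓡 2) (fun z => (G ((extChartAt (𝓡 2) x₀).symm z)).1) y ∧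
    DifferentiableAt ℝ (heightRep x₀ G) y ∧
    (mfderiv (𝓡 2) ((𝓡 2).prod 𝓘(ℝ, ℝ)) G ((extChartAt (𝓡 2) x₀).symm y)
      (coordVec x₀ y i) : Plane × ℝ) =
    ((mfderiv 𝓘(ℝ, Plane) (𝓡 2) (fun z => (G ((extChartAt (𝓡 2) x₀).symm z)).1) y (e i) : Plane),
      pd i (heightRep x₀ G) y) := by
  have hs := mdifferentiableAt_chart_symm hy
  have hc := hG.comp y hs
  have h1 : MDifferentiableAt 𝓘(ℝ, Plane) (𝓡 2)
      (fun z => (G ((extChartAt (𝓡 2) x₀).symm z)).1) y := mdifferentiableAt_fst.comp y hc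
  have h2 : MDifferentiableAt 𝓘(ℝ, Plane) 𝓘(ℝ, ℝ)
      (fun z => (G ((extChartAt (𝓡 2) x₀).symm z)).2) y := mdifferentiableAt_snd.comp y hc
  refine ⟨h1, h2.differentiableAt, ?_⟩
  have h3 := mfderiv_comp y hG hs
  have h4 := mfderiv_prodMk h1 h2
  have h5 : (mfderiv (𝓡 2) ((𝓡 2).prod 𝓘(ℝ, ℝ)) G ((extChartAt (𝓡 2) x₀).symm y)
      (coordVec x₀ y i) : Plane × ℝ) =
      (mfderiv 𝓘(ℝ, Plane) ((𝓡 2).prod 𝓘(ℝ, ℝ)) (G ∘ (extChartAt (𝓡 2) x₀).symm) y :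
        Plane →L[ℝ] Plane × ℝ) (e i) :=
    (congrArg (fun L : Plane →L[ℝ] Plane × ℝ => L (e i)) h3.symm :)
  rw [h5]
  refine (congrArg (fun L : Plane →L[ℝ] Plane × ℝ => L (e i)) h4 :).trans ?_
  refine Prod.ext rfl ?_
  have : (mfderiv 𝓘(ℝ, Plane) 𝓘(ℝ, ℝ) (fun z => (G ((extChartAt (𝓡 2) x₀).symm z)).2) y :
      Plane →L[ℝ] ℝ) = fderiv ℝ (heightRep x₀ G) y := mfderiv_eq_fderiv
  exact (congrArg (fun L : Plane →L[ℝ] ℝ => L (e i)) this :)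

theorem differentiableAt_chartRep {x₀ : N} {G : N → N × ℝ} {y : Plane}
    (hy : y ∈ (extChartAt (𝓡 2) x₀).target)
    (hG : MDifferentiableAt (𝓡 2) ((𝓡 2).prod 𝓘(ℝ, ℝ)) G ((extChartAt (𝓡 2) x₀).symm y))
    (hs : (G ((extChartAt (𝓡 2) x₀).symm y)).1 ∈ (extChartAt (𝓡 2) x₀).source) :
    DifferentiableAt ℝ (chartRep x₀ G) y :=
  (((contMDiffAt_chart hs).mdifferentiableAt (by simp)).comp y
    (mfderiv_coordVec_prod hy hG 0).1).differentiableAt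

theorem coeff_pullback_product (σ : SurfaceMetric N) {x₀ : N} {G : N → N × ℝ} {y : Plane}
    (hy : y ∈ (extChartAt (𝓡 2) x₀).target)
    (hG : MDifferentiableAt (𝓡 2) ((𝓡 2).prod 𝓘(ℝ, ℝ)) G ((extChartAt (𝓡 2) x₀).symm y))
    (hs : (G ((extChartAt (𝓡 2) x₀).symm y)).1 ∈ (extChartAt (𝓡 2) x₀).source) (i j : Fin 2) :
    coeff (pullback ((𝓡 2).prod 𝓘(ℝ, ℝ)) (productMetric σ) G) x₀ i j y =
      gramRep σ x₀ G i j y := by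
  obtain ⟨h1, h2, h3⟩ := mfderiv_coordVec_prod hy hG i
  have h4 := (mfderiv_coordVec_prod hy hG j).2.2
  have hP := differentiableAt_chartRep hy hG hs
  have h5 : coeff (pullback ((𝓡 2).prod 𝓘(ℝ, ℝ)) (productMetric σ) G) x₀ i j y =
      (fun a b : Plane × ℝ => productMetric σ (G ((extChartAt (𝓡 2) x₀).symm y)) a b)
        (mfderiv (𝓡 2) ((𝓡 2).prod 𝓘(ℝ, ℝ)) G ((extChartAt (𝓡 2) x₀).symm y) (coordVec x₀ y i))
        (mfderiv (𝓡 2) ((𝓡 2).prod 𝓘(ℝ, ℝ)) G ((extChartAt (𝓡 2) x₀).symm y) (coordVec x₀ y j)) :=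
    rfl
  rw [h5]
  refine (congrArg₂ (fun a b : Plane × ℝ =>
    productMetric σ (G ((extChartAt (𝓡 2) x₀).symm y)) a b) h3 h4).trans ?_
  unfold gramRep
  refine congrArg₂ (· + ·) ?_ rfl
  refine (form_mfderiv (isBilin_form σ) h1 hs (e i) (e j)).trans ?_
  refine Finset.sum_congr rfl fun k _ => Finset.sum_congr rfl fun l _ => ?_
  rw [← fderiv_apply_coord hP, ← fderiv_apply_coord hP]
  rfl

theorem coeff_pullback_weighted (σ : SurfaceMetric N) {x₀ : N} {G : N → N × ℝ} {y : Plane}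
    (hy : y ∈ (extChartAt (𝓡 2) x₀).target)
    (hG : MDifferentiableAt (𝓡 2) ((𝓡 2).prod 𝓘(ℝ, ℝ)) G ((extChartAt (𝓡 2) x₀).symm y))
    (hs : (G ((extChartAt (𝓡 2) x₀).symm y)).1 ∈ (extChartAt (𝓡 2) x₀).source) (i j : Fin 2) :
    coeff (pullback ((𝓡 2).prod 𝓘(ℝ, ℝ)) (weightedMetric σ) G) x₀ i j y =
      Real.exp (heightRep x₀ G y) * gramRep σ x₀ G i j y := by
  rw [← coeff_pullback_product σ hy hG hs]; rfl

/-- The one-form `ν♭` equals `Θ d(r - u)`, and `defectRep` is `(r - u) ∘ G` in the chart, so the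
pull-back is `Θ ∘ G` times an exact form. -/
theorem normalForm_coordVec (σ : SurfaceMetric N) (u : N → ℝ) {x₀ : N} {G : N → N × ℝ} {y : Plane}
    (hy : y ∈ (extChartAt (𝓡 2) x₀).target)
    (hG : MDifferentiableAt (𝓡 2) ((𝓡 2).prod 𝓘(ℝ, ℝ)) G ((extChartAt (𝓡 2) x₀).symm y))
    (hu : MDifferentiableAt (𝓡 2) 𝓘(ℝ, ℝ) u (G ((extChartAt (𝓡 2) x₀).symm y)).1) (i : Fin 2) :
    normalForm σ u (G ((extChartAt (𝓡 2) x₀).symm y))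
        (mfderiv (𝓡 2) ((𝓡 2).prod 𝓘(ℝ, ℝ)) G ((extChartAt (𝓡 2) x₀).symm y) (coordVec x₀ y i)) =
      angle σ u (G ((extChartAt (𝓡 2) x₀).symm y)).1 * pd i (defectRep x₀ u G) y := by
  obtain ⟨h1, h2, h3⟩ := mfderiv_coordVec_prod hy hG i
  refine (congrArg (fun a : Plane × ℝ =>
    normalForm σ u (G ((extChartAt (𝓡 2) x₀).symm y)) a) h3).trans ?_
  refine congrArg (fun t : ℝ => angle σ u (G ((extChartAt (𝓡 2) x₀).symm y)).1 * t) ?_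
  have h4 := hu.comp y h1
  have h5 := mfderiv_comp y hu h1
  have h6 : pd i (defectRep x₀ u G) y = pd i (heightRep x₀ G) y -
      pd i (fun z => u (G ((extChartAt (𝓡 2) x₀).symm z)).1) y := pd_sub h2 h4.differentiableAt
  rw [h6]
  refine congrArg (fun t : ℝ => pd i (heightRep x₀ G) y - t) ?_
  refine Eq.trans (congrArg (fun L : Plane →L[ℝ] ℝ => L (e i)) h5.symm :) ?_
  exact (congrArg (fun L : Plane →L[ℝ] ℝ => L (e i)) mfderiv_eq_fderiv :)

theorem coeff_pullback_calibration (σ : SurfaceMetric N) (u : N → ℝ) {x₀ : N} {G : N → N × ℝ}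
    {y : Plane} (hy : y ∈ (extChartAt (𝓡 2) x₀).target)
    (hG : MDifferentiableAt (𝓡 2) ((𝓡 2).prod 𝓘(ℝ, ℝ)) G ((extChartAt (𝓡 2) x₀).symm y))
    (hs : (G ((extChartAt (𝓡 2) x₀).symm y)).1 ∈ (extChartAt (𝓡 2) x₀).source)
    (hu : MDifferentiableAt (𝓡 2) 𝓘(ℝ, ℝ) u (G ((extChartAt (𝓡 2) x₀).symm y)).1) (i j : Fin 2) :
    coeff (pullback ((𝓡 2).prod 𝓘(ℝ, ℝ)) (calibration σ u) G) x₀ i j y =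
      Real.exp (heightRep x₀ G y) * (gramRep σ x₀ G i j y -
        (angle σ u (G ((extChartAt (𝓡 2) x₀).symm y)).1 * pd i (defectRep x₀ u G) y) *
        (angle σ u (G ((extChartAt (𝓡 2) x₀).symm y)).1 * pd j (defectRep x₀ u G) y)) := by
  rw [← coeff_pullback_product σ hy hG hs, ← normalForm_coordVec σ u hy hG hu,
    ← normalForm_coordVec σ u hy hG hu]; rfl

end

section

variable {N : Type*} [TopologicalSpace N] [ChartedSpace Plane N]

theorem isOpen_chartSet (x₀ : N) {Ω : Set N} (hΩ : IsOpen Ω) : IsOpen (chartSet x₀ Ω) :=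
  (continuousOn_extChartAt_symm x₀).isOpen_inter_preimage (isOpen_extChartAt_target x₀) hΩ

variable [IsManifold (𝓡 2) ∞ N]

/-! ### The gradient of `u` in a chart -/

/-- The coordinates of `Du` in the preferred chart at `x₀`. -/
def gradCoord (σ : SurfaceMetric N) (u : N → ℝ) (x₀ : N) (k : Fin 2) (x : N) : ℝ :=
  planeCoord k (mfderiv (𝓡 2) 𝓘(ℝ, Plane) (extChartAt (𝓡 2) x₀) x (grad (form σ) u x))

/-- The coordinates of the vector density `√(det σ) Du / √(1 + |Du|²)` in the preferred chart
at `x₀`. -/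
def flux (σ : SurfaceMetric N) (u : N → ℝ) (x₀ : N) (k : Fin 2) (z : Plane) : ℝ :=
  √(gramDet (form σ) x₀ z) * (angle σ u ((extChartAt (𝓡 2) x₀).symm z) *
    gradCoord σ u x₀ k ((extChartAt (𝓡 2) x₀).symm z))

/-- The function `f` in the preferred chart at `x₀`. -/
def funRep (x₀ : N) (f : N → ℝ) (z : Plane) : ℝ := f ((extChartAt (𝓡 2) x₀).symm z)

theorem gramDet_form_pos (σ : SurfaceMetric N) {x₀ : N} {z : Plane}
    (hz : z ∈ (extChartAt (𝓡 2) x₀).target) : 0 < gramDet (form σ) x₀ z := by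
  rw [gramDet_eq]
  exact gram_pos (isBilin_form σ) (form_symm σ _) (form_pos σ _)
    fun a b h => coordVec_linearIndependent hz h

theorem contDiffOn_gramDet_form (σ : SurfaceMetric N) (x₀ : N) :
    ContDiffOn ℝ ∞ (gramDet (form σ) x₀) (extChartAt (𝓡 2) x₀).target := by
  refine ContDiffOn.congr (f := fun z => coeff (form σ) x₀ 0 0 z * coeff (form σ) x₀ 1 1 z -
    coeff (form σ) x₀ 0 1 z * coeff (form σ) x₀ 1 0 z) ?_ fun z _ => gramDet_eq _ _ _
  exact ((contDiffOn_coeff_form σ x₀ 0 0).mul (contDiffOn_coeff_form σ x₀ 1 1)).sub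
    ((contDiffOn_coeff_form σ x₀ 0 1).mul (contDiffOn_coeff_form σ x₀ 1 0))

theorem diff_coordVec {f : N → ℝ} {x₀ : N} {z : Plane} (hz : z ∈ (extChartAt (𝓡 2) x₀).target)
    (hf : MDifferentiableAt (𝓡 2) 𝓘(ℝ, ℝ) f ((extChartAt (𝓡 2) x₀).symm z)) (i : Fin 2) :
    diff f ((extChartAt (𝓡 2) x₀).symm z) (coordVec x₀ z i) = pd i (funRep x₀ f) z := by
  have h5 := mfderiv_comp z hf (mdifferentiableAt_chart_symm hz)
  refine Eq.trans (congrArg (fun L : Plane →L[ℝ] ℝ => L (e i)) h5.symm :) ?_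
  exact (congrArg (fun L : Plane →L[ℝ] ℝ => L (e i)) mfderiv_eq_fderiv :)

theorem grad_eq_sum (σ : SurfaceMetric N) (u : N → ℝ) {x₀ : N} {z : Plane}
    (hz : z ∈ (extChartAt (𝓡 2) x₀).target) :
    grad (form σ) u ((extChartAt (𝓡 2) x₀).symm z) =
      ∑ k, gradCoord σ u x₀ k ((extChartAt (𝓡 2) x₀).symm z) • coordVec x₀ z k :=
  coordVec_mfderiv_chart hz _

section

variable {σ : SurfaceMetric N} {Ω : Set N} (hΩ : IsOpen Ω) {u : N → ℝ}
  (hu : ContMDiffOn (𝓡 2) 𝓘(ℝ, ℝ) ∞ u Ω)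

include hΩ hu

omit [IsManifold (𝓡 2) ∞ N] in
theorem mdifferentiableAt_of_mem {x : N} (hx : x ∈ Ω) : MDifferentiableAt (𝓡 2) 𝓘(ℝ, ℝ) u x :=
  (hu.contMDiffAt (hΩ.mem_nhds hx)).mdifferentiableAt (by simp)

omit hΩ in
theorem contDiffOn_funRep (x₀ : N) : ContDiffOn ℝ ∞ (funRep x₀ u) (chartSet x₀ Ω) := by
  rw [← contMDiffOn_iff_contDiffOn]
  exact hu.comp ((contMDiffOn_extChartAt_symm (n := ∞) x₀).mono inter_subset_left)
    fun z hz => hz.2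

/-- Lowering the index of `Du` with `σ` gives back `du`. -/
theorem sum_gradCoord_coeff {x₀ : N} {z : Plane} (hz : z ∈ chartSet x₀ Ω) (i : Fin 2) :
    ∑ k, gradCoord σ u x₀ k ((extChartAt (𝓡 2) x₀).symm z) * coeff (form σ) x₀ k i z =
      pd i (funRep x₀ u) z := by
  rw [← diff_coordVec hz.1 (mdifferentiableAt_of_mem hΩ hu hz.2),
    ← form_grad (isBilin_form σ) (form_symm σ _) (form_pos σ _) u, grad_eq_sum σ u hz.1]
  have hb := isBilin_form σ
  simp only [Fin.sum_univ_two, hb.add_left, hb.smul_left]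
  rfl

theorem form_grad_grad_chart {x₀ : N} {z : Plane} (hz : z ∈ chartSet x₀ Ω) :
    form σ ((extChartAt (𝓡 2) x₀).symm z) (grad (form σ) u ((extChartAt (𝓡 2) x₀).symm z))
      (grad (form σ) u ((extChartAt (𝓡 2) x₀).symm z)) =
    ∑ k, gradCoord σ u x₀ k ((extChartAt (𝓡 2) x₀).symm z) * pd k (funRep x₀ u) z := by
  have h1 := form_grad (isBilin_form σ) (form_symm σ _) (form_pos σ _) u
    (grad (form σ) u ((extChartAt (𝓡 2) x₀).symm z))
  rw [h1]
  conv_lhs => rw [grad_eq_sum σ u hz.1]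
  have hlin : ∀ (A : Plane →L[ℝ] ℝ) (a : Fin 2 → ℝ) (v : Fin 2 → Plane),
      A (∑ k, a k • v k) = ∑ k, a k * A (v k) := fun A a v => by
    simp only [map_sum, map_smul, smul_eq_mul]
  refine (hlin (mfderiv (𝓡 2) 𝓘(ℝ, ℝ) u ((extChartAt (𝓡 2) x₀).symm z)) _ _).trans ?_
  refine Finset.sum_congr rfl fun k _ => ?_
  rw [← diff_coordVec hz.1 (mdifferentiableAt_of_mem hΩ hu hz.2)]
  rfl

omit hΩ hu in
theorem angle_pos (x : N) : 0 < angle σ u x := by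
  have := form_nonneg σ x (grad (form σ) u x)
  unfold angle
  positivity

theorem angle_sq {x₀ : N} {z : Plane} (hz : z ∈ chartSet x₀ Ω) :
    angle σ u ((extChartAt (𝓡 2) x₀).symm z) ^ 2 *
      (1 + ∑ k, gradCoord σ u x₀ k ((extChartAt (𝓡 2) x₀).symm z) * pd k (funRep x₀ u) z) = 1 := by
  rw [← form_grad_grad_chart hΩ hu hz]
  have h := form_nonneg σ _ (grad (form σ) u ((extChartAt (𝓡 2) x₀).symm z))
  unfold angle
  rw [div_pow, Real.sq_sqrt (by positivity), one_pow]
  exact one_div_mul_cancel (by positivity)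

theorem contDiffOn_pd_funRep (x₀ : N) (i : Fin 2) :
    ContDiffOn ℝ ∞ (pd i (funRep x₀ u)) (chartSet x₀ Ω) :=
  ((contDiffOn_funRep hu x₀).fderiv_of_isOpen (isOpen_chartSet x₀ hΩ)
    (by simp)).clm_apply contDiffOn_const

/-- The coordinates of `Du` solve the linear system of `sum_gradCoord_coeff`. Cramer's rule writes
them as quotients of smooth functions with denominator `det σ > 0`. -/
theorem contDiffOn_gradCoord (x₀ : N) (k : Fin 2) :
    ContDiffOn ℝ ∞ (funRep x₀ (gradCoord σ u x₀ k)) (chartSet x₀ Ω) := by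
  have hS : ∀ i j, ContDiffOn ℝ ∞ (coeff (form σ) x₀ i j) (chartSet x₀ Ω) := fun i j =>
    (contDiffOn_coeff_form σ x₀ i j).mono inter_subset_left
  have hG : ContDiffOn ℝ ∞ (gramDet (form σ) x₀) (chartSet x₀ Ω) :=
    (contDiffOn_gramDet_form σ x₀).mono inter_subset_left
  have hG0 : ∀ z ∈ chartSet x₀ Ω, gramDet (form σ) x₀ z ≠ 0 := fun z hz =>
    (gramDet_form_pos σ hz.1).ne'
  have hp := contDiffOn_pd_funRep hΩ hu x₀
  have key0 : ∀ z ∈ chartSet x₀ Ω, funRep x₀ (gradCoord σ u x₀ 0) z =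
      (coeff (form σ) x₀ 1 1 z * pd 0 (funRep x₀ u) z -
        coeff (form σ) x₀ 1 0 z * pd 1 (funRep x₀ u) z) / gramDet (form σ) x₀ z := by
    intro z hz
    rw [eq_div_iff (hG0 z hz), gramDet_eq, ← sum_gradCoord_coeff hΩ hu hz (σ := σ) 0,
      ← sum_gradCoord_coeff hΩ hu hz (σ := σ) 1]
    simp only [Fin.sum_univ_two, funRep]
    ring
  have key1 : ∀ z ∈ chartSet x₀ Ω, funRep x₀ (gradCoord σ u x₀ 1) z =
      (coeff (form σ) x₀ 0 0 z * pd 1 (funRep x₀ u) z -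
        coeff (form σ) x₀ 0 1 z * pd 0 (funRep x₀ u) z) / gramDet (form σ) x₀ z := by
    intro z hz
    rw [eq_div_iff (hG0 z hz), gramDet_eq, ← sum_gradCoord_coeff hΩ hu hz (σ := σ) 0,
      ← sum_gradCoord_coeff hΩ hu hz (σ := σ) 1]
    simp only [Fin.sum_univ_two, funRep]
    ring
  fin_cases k
  · exact ((((hS 1 1).mul (hp 0)).sub ((hS 1 0).mul (hp 1))).div hG hG0).congr key0
  · exact ((((hS 0 0).mul (hp 1)).sub ((hS 0 1).mul (hp 0))).div hG hG0).congr key1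

theorem contDiffOn_angle (x₀ : N) : ContDiffOn ℝ ∞ (funRep x₀ (angle σ u)) (chartSet x₀ Ω) := by
  have hq : ContDiffOn ℝ ∞ (fun z => 1 + ∑ k, funRep x₀ (gradCoord σ u x₀ k) z *
      pd k (funRep x₀ u) z) (chartSet x₀ Ω) :=
    contDiffOn_const.add (ContDiffOn.sum fun k _ => (contDiffOn_gradCoord hΩ hu x₀ k).mul
      (contDiffOn_pd_funRep hΩ hu x₀ k))
  have hpos : ∀ z ∈ chartSet x₀ Ω, 1 + ∑ k, funRep x₀ (gradCoord σ u x₀ k) z *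
      pd k (funRep x₀ u) z ≠ 0 := fun z hz h0 => by
    have h1 := angle_sq (σ := σ) hΩ hu hz
    simp only [funRep] at h0 h1
    rw [h0, mul_zero] at h1
    exact zero_ne_one h1
  have hp2 : ∀ z ∈ chartSet x₀ Ω, √(1 + ∑ k, funRep x₀ (gradCoord σ u x₀ k) z *
      pd k (funRep x₀ u) z) ≠ 0 := fun z hz => by
    have h := form_nonneg σ _ (grad (form σ) u ((extChartAt (𝓡 2) x₀).symm z))
    rw [form_grad_grad_chart hΩ hu hz] at h
    exact (Real.sqrt_pos.2 (by simp only [funRep] at h ⊢; positivity)).ne'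
  refine ((contDiffOn_const (c := (1 : ℝ))).div (hq.sqrt hpos) hp2).congr fun z hz => ?_
  change angle σ u ((extChartAt (𝓡 2) x₀).symm z) = _
  unfold angle
  rw [form_grad_grad_chart hΩ hu hz]
  rfl

theorem contDiffOn_flux (x₀ : N) (k : Fin 2) :
    ContDiffOn ℝ ∞ (flux σ u x₀ k) (chartSet x₀ Ω) :=
  (((contDiffOn_gramDet_form σ x₀).mono inter_subset_left).sqrt fun _ hz =>
    (gramDet_form_pos σ hz.1).ne').mul
      ((contDiffOn_angle hΩ hu x₀).mul (contDiffOn_gradCoord hΩ hu x₀ k))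

omit hΩ hu in
theorem gradCoord_trans {x₀ x₁ : N} {y : Plane} (hy : y ∈ (extChartAt (𝓡 2) x₀).target)
    (hy' : (extChartAt (𝓡 2) x₀).symm y ∈ (extChartAt (𝓡 2) x₁).source) (k : Fin 2) :
    gradCoord σ u x₁ k ((extChartAt (𝓡 2) x₀).symm y) =
      ∑ j, gradCoord σ u x₀ j ((extChartAt (𝓡 2) x₀).symm y) *
        pd j (fun z => trans x₀ x₁ z k) y := by
  have hd : DifferentiableAt ℝ (trans x₀ x₁) y :=
    (trans_contDiffAt hy hy').differentiableAt (by simp)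
  have hc := mfderiv_comp y ((contMDiffAt_chart hy').mdifferentiableAt (by simp))
    (mdifferentiableAt_chart_symm hy)
  have hA : ∀ j, planeCoord k (mfderiv (𝓡 2) 𝓘(ℝ, Plane) (extChartAt (𝓡 2) x₁)
      ((extChartAt (𝓡 2) x₀).symm y) (coordVec x₀ y j)) = pd j (fun z => trans x₀ x₁ z k) y := by
    intro j
    rw [← fderiv_apply_coord hd]
    refine Eq.trans (congrArg (fun L : Plane →L[ℝ] Plane => planeCoord k (L (e j))) hc.symm :) ?_
    exact (congrArg (fun L : Plane →L[ℝ] Plane => planeCoord k (L (e j))) mfderiv_eq_fderiv :)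
  conv_lhs => rw [gradCoord, grad_eq_sum σ u hy]
  have hlin : ∀ (A : Plane →L[ℝ] Plane) (a : Fin 2 → ℝ) (v : Fin 2 → Plane),
      planeCoord k (A (∑ j, a j • v j)) = ∑ j, a j * planeCoord k (A (v j)) := fun A a v => by
    simp [planeCoord, map_smul]
  refine (hlin (mfderiv (𝓡 2) 𝓘(ℝ, Plane) (extChartAt (𝓡 2) x₁)
    ((extChartAt (𝓡 2) x₀).symm y)) _ _).trans ?_
  exact Finset.sum_congr rfl fun j _ => by rw [← hA]; rfl

/-- The translating graph equation in a chart. -/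
theorem flux_divergence (heq : IsTranslatingSolution σ Ω u) {x₀ : N} {z₀ : Plane}
    (hz₀ : z₀ ∈ chartSet x₀ Ω) :
    pd 0 (flux σ u x₀ 0) z₀ + pd 1 (flux σ u x₀ 1) z₀ =
      √(gramDet (form σ) x₀ z₀) * angle σ u ((extChartAt (𝓡 2) x₀).symm z₀) := by
  -- `divergence` at `x` is computed in the preferred chart at `x`, but the claim concerns the chart
  -- at `x₀`. What follows is the invariance of the divergence of a vector density under the
  -- transition map `ψ`.
  set x := (extChartAt (𝓡 2) x₀).symm z₀ with hx
  set y₀ := extChartAt (𝓡 2) x x with hy₀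
  set ψ := trans x x₀ with hψ
  have hsy : (extChartAt (𝓡 2) x).symm y₀ = x := extChartAt_to_inv x
  have hψ0 : ψ y₀ = z₀ := by
    rw [hψ, trans, hsy, hx]; exact (extChartAt (𝓡 2) x₀).right_inv hz₀.1
  have hxs : x ∈ (extChartAt (𝓡 2) x₀).source := (extChartAt (𝓡 2) x₀).map_target hz₀.1
  set U : Set Plane := chartSet x (Ω ∩ (extChartAt (𝓡 2) x₀).source) with hU
  have hUo : IsOpen U := isOpen_chartSet x (hΩ.inter (isOpen_extChartAt_source x₀))
  have hy₀U : y₀ ∈ U := ⟨mem_extChartAt_target x, by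
    rw [mem_preimage, hsy]; exact ⟨hz₀.2, hxs⟩⟩
  have hψc : ∀ y ∈ U, ContDiffAt ℝ ∞ ψ y := fun y hy => trans_contDiffAt hy.1 hy.2.2
  set J : Plane → ℝ := fun y => (fderiv ℝ ψ y).det with hJ
  have hJe : ∀ y ∈ U, J y = pd 0 (fun z => ψ z 0) y * pd 1 (fun z => ψ z 1) y -
      pd 0 (fun z => ψ z 1) y * pd 1 (fun z => ψ z 0) y := by
    intro y hy
    have hd := (hψc y hy).differentiableAt (by simp)
    simp only [hJ]
    rw [det_plane]
    simp only [fderiv_apply_coord hd]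
  have hgram : ∀ y ∈ U, gramDet (form σ) x y = J y ^ 2 * gramDet (form σ) x₀ (ψ y) :=
    fun y hy => gramDet_trans (isBilin_form σ) hy.1 hy.2.2
  have hJ0 : ∀ y ∈ U, J y ≠ 0 := by
    intro y hy h0
    have h1 := gramDet_form_pos σ hy.1
    rw [hgram y hy, h0] at h1
    simp at h1
  have hJc : ContinuousAt J y₀ := by
    have h1 : ContDiffAt ℝ 1 (fun y => pd 0 (fun z => ψ z 0) y * pd 1 (fun z => ψ z 1) y -
      pd 0 (fun z => ψ z 1) y * pd 1 (fun z => ψ z 0) y) y₀ := by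
      have h2 : ∀ i k : Fin 2, ContDiffAt ℝ 1 (pd i (fun z => ψ z k)) y₀ := fun i k =>
        contDiffAt_pd (contDiffAt_coord (hψc y₀ hy₀U) k) (by
          have := two_le_infty; norm_num; exact this) i
      exact ((h2 0 0).mul (h2 1 1)).sub ((h2 0 1).mul (h2 1 0))
    exact h1.continuousAt.congr (eventually_of_mem (hUo.mem_nhds hy₀U) fun y hy => (hJe y hy).symm)
  -- The factor `√(det σ)` makes the fluxes transform with `|J|`. Near `y₀` the Jacobian has
  -- constant sign `ε`, so the absolute value can be removed.
  obtain ⟨ε, hε, hεJ⟩ : ∃ ε : ℝ, ε * ε = 1 ∧ ∀ᶠ y in 𝓝 y₀, |J y| = ε * J y := by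
    rcases lt_or_gt_of_ne (hJ0 y₀ hy₀U) with h | h
    · refine ⟨-1, by norm_num, ?_⟩
      filter_upwards [hJc.eventually (gt_mem_nhds h)] with y hy
      rw [abs_of_neg hy]; ring
    · refine ⟨1, by norm_num, ?_⟩
      filter_upwards [hJc.eventually (lt_mem_nhds h)] with y hy
      rw [abs_of_pos hy]; ring
  have hsqrt : ∀ y ∈ U, √(gramDet (form σ) x y) = |J y| * √(gramDet (form σ) x₀ (ψ y)) := by
    intro y hy
    rw [hgram y hy, Real.sqrt_mul (sq_nonneg _), Real.sqrt_sq_eq_abs]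
  have hflux : ∀ y ∈ U, ∀ k, |J y| * flux σ u x₀ k (ψ y) =
      ∑ j, flux σ u x j y * pd j (fun z => ψ z k) y := by
    intro y hy k
    have hinv : (extChartAt (𝓡 2) x₀).symm (ψ y) = (extChartAt (𝓡 2) x).symm y :=
      (extChartAt (𝓡 2) x₀).left_inv hy.2.2
    unfold flux
    rw [hinv, gradCoord_trans hy.1 hy.2.2 k, hsqrt y hy]
    simp only [Fin.sum_univ_two]
    ring
  -- The relation `hflux` is inverted with the cofactors of the differential of `ψ`. Up to `ε`, the
  -- flux in one chart becomes the pull-back of `b¹ dp² - b² dp¹`, so `pd_pullback_sub` applies with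
  -- `R = 0`; the factor `Real.exp 0` is kept to match it.
  have hcof : ∀ᶠ y in 𝓝 y₀,
      flux σ u x 0 y = ε * (Real.exp 0 * (flux σ u x₀ 0 (ψ y) * pd 1 (fun w => ψ w 1) y -
        flux σ u x₀ 1 (ψ y) * pd 1 (fun w => ψ w 0) y)) ∧
      flux σ u x 1 y = -ε * (Real.exp 0 * (flux σ u x₀ 0 (ψ y) * pd 0 (fun w => ψ w 1) y -
        flux σ u x₀ 1 (ψ y) * pd 0 (fun w => ψ w 0) y)) := by
    filter_upwards [hεJ, hUo.mem_nhds hy₀U] with y hy hyU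
    have f0 := hflux y hyU 0
    have f1 := hflux y hyU 1
    simp only [Fin.sum_univ_two] at f0 f1
    rw [hy] at f0 f1
    have hJy := hJe y hyU
    rw [Real.exp_zero]
    constructor
    · apply mul_left_cancel₀ (hJ0 y hyU)
      linear_combination (-pd 1 (fun w => ψ w 1) y) * f0 + (pd 1 (fun w => ψ w 0) y) * f1 +
        flux σ u x 0 y * hJy
    · apply mul_left_cancel₀ (hJ0 y hyU)
      linear_combination (pd 0 (fun w => ψ w 1) y) * f0 - (pd 0 (fun w => ψ w 0) y) * f1 +
        flux σ u x 1 y * hJy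
  have hbd : ∀ k, DifferentiableAt ℝ (flux σ u x₀ k) (ψ y₀) := fun k => by
    rw [hψ0]
    exact ((contDiffOn_flux hΩ hu x₀ k).contDiffAt
      ((isOpen_chartSet x₀ hΩ).mem_nhds hz₀)).differentiableAt (by simp)
  have hψ2 : ContDiffAt ℝ 2 ψ y₀ := (hψc y₀ hy₀U).of_le two_le_infty
  have hmain := pd_pullback_sub (b := flux σ u x₀) (P := ψ) (R := fun _ => (0 : ℝ)) (y := y₀) hbd hψ2
    (differentiableAt_const _)
  have hψd : DifferentiableAt ℝ ψ y₀ := hψ2.differentiableAt (by norm_num)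
  have hda : ∀ i, DifferentiableAt ℝ (fun z => Real.exp 0 *
      (flux σ u x₀ 0 (ψ z) * pd i (fun w => ψ w 1) z -
        flux σ u x₀ 1 (ψ z) * pd i (fun w => ψ w 0) z)) y₀ := by
    intro i
    have h2 : ∀ k : Fin 2, DifferentiableAt ℝ (pd i (fun z => ψ z k)) y₀ := fun k =>
      (contDiffAt_pd (m := 1) (contDiffAt_coord hψ2 k) (by norm_num) i).differentiableAt (by norm_num)
    exact ((((hbd 0).comp y₀ hψd).mul (h2 1)).sub (((hbd 1).comp y₀ hψd).mul (h2 0))).const_mul _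
  have hp0 := (pd_congr (i := 0) (hcof.mono fun y hy => hy.1)).trans (pd_const_mul ε (hda 1))
  have hp1 := (pd_congr (i := 1) (hcof.mono fun y hy => hy.2)).trans (pd_const_mul (-ε) (hda 0))
  have hconst : ∀ i, pd i (fun _ => (0 : ℝ)) y₀ = 0 := fun i => by simp [pd]
  have hdiv := heq x hz₀.2
  have hflin : ∀ i, (fun y : Plane => √(gramDet (form σ) x y) *
        (EuclideanSpace.proj i : Plane →L[ℝ] ℝ)
          (mfderiv (𝓡 2) 𝓘(ℝ, Plane) (extChartAt (𝓡 2) x) ((extChartAt (𝓡 2) x).symm y)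
            ((fun y => angle σ u y • grad (form σ) u y) ((extChartAt (𝓡 2) x).symm y)))) =
      flux σ u x i := by
    intro i
    funext y
    unfold flux
    congr 1
    have hlin : ∀ (A : Plane →L[ℝ] Plane) (a : ℝ) (v : Plane),
      planeCoord i (A (a • v)) = a * planeCoord i (A v) := fun A a v => by simp
    exact hlin _ _ _
  rw [divergence] at hdiv
  simp only [hflin] at hdiv
  have hs0 : 0 < √(gramDet (form σ) x y₀) := Real.sqrt_pos.2 (gramDet_form_pos σ hy₀U.1)
  rw [inv_mul_eq_iff_eq_mul₀ hs0.ne', Fin.sum_univ_two, hsqrt y₀ hy₀U, hψ0] at hdiv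
  change pd 0 (flux σ u x 0) y₀ + pd 1 (flux σ u x 1) y₀ = _ at hdiv
  rw [hp0, hp1] at hdiv
  rw [hconst, hconst, Real.exp_zero, ← hJe y₀ hy₀U, hψ0] at hmain
  rw [Real.exp_zero] at hdiv
  have habs := hεJ.self_of_nhds
  -- Both sides of the equation in the chart at `x` carry the factor `|J|`, the left one as `ε * J`.
  apply mul_left_cancel₀ (abs_ne_zero.2 (hJ0 y₀ hy₀U))
  linear_combination hdiv - ε * hmain +
    (pd 0 (flux σ u x₀ 0) z₀ + pd 1 (flux σ u x₀ 1) z₀) * habs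

end

end

/-! ### The calibration identity -/

/-- Let `X = (A, B, r0)` and `Y = (C, E, r1)` be tangent vectors of the product, `d` the coordinates
of `Du` and `p` those of `du`. The left side is the Gram determinant of the projections of `X` and
`Y` orthogonal to `ν`, the right side is `dvol(ν, X, Y)²`. They agree because `ν` is a unit vector,
which is `hθ`: before `hθ` is used, the two sides differ by the Gram determinant of `X`, `Y` times
`1 - θ² (1 + |Du|²)`. -/
theorem calibration_det_identity {s00 s01 s11 d0 d1 θ A B C E r0 r1 p0 p1 : ℝ}
    (hp0 : p0 = d0 * s00 + d1 * s01) (hp1 : p1 = d0 * s01 + d1 * s11)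
    (hθ : θ ^ 2 * (1 + (d0 * p0 + d1 * p1)) = 1) :
    (A * A * s00 + 2 * (A * B * s01) + B * B * s11 + r0 * r0 -
        (θ * (r0 - (p0 * A + p1 * B))) * (θ * (r0 - (p0 * A + p1 * B)))) *
      (C * C * s00 + 2 * (C * E * s01) + E * E * s11 + r1 * r1 -
        (θ * (r1 - (p0 * C + p1 * E))) * (θ * (r1 - (p0 * C + p1 * E)))) -
      (A * C * s00 + (A * E + B * C) * s01 + B * E * s11 + r0 * r1 -
        (θ * (r0 - (p0 * A + p1 * B))) * (θ * (r1 - (p0 * C + p1 * E)))) ^ 2 =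
    (s00 * s11 - s01 * s01) * θ ^ 2 *
      ((A * E - B * C) + r0 * (d0 * E - d1 * C) - r1 * (d0 * B - d1 * A)) ^ 2 := by
  subst hp0 hp1
  linear_combination (-((A * A * s00 + 2 * (A * B * s01) + B * B * s11 + r0 * r0) *
    (C * C * s00 + 2 * (C * E * s01) + E * E * s11 + r1 * r1) -
    (A * C * s00 + (A * E + B * C) * s01 + B * E * s11 + r0 * r1) ^ 2)) * hθ

section

variable {N : Type*} [TopologicalSpace N] [ChartedSpace Plane N] [IsManifold (𝓡 2) ∞ N]

/-- The determinant of the metric induced from `σ + dr²` on the image of `G`. -/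
def detRep (σ : SurfaceMetric N) (x₀ : N) (G : N → N × ℝ) (y : Plane) : ℝ :=
  gramRep σ x₀ G 0 0 y * gramRep σ x₀ G 1 1 y - gramRep σ x₀ G 0 1 y * gramRep σ x₀ G 1 0 y

/-- The pull-back of the form `ν♭` by `G` in a chart. -/
def normalRep (σ : SurfaceMetric N) (u : N → ℝ) (x₀ : N) (G : N → N × ℝ) (i : Fin 2)
    (y : Plane) : ℝ :=
  angle σ u (G ((extChartAt (𝓡 2) x₀).symm y)).1 * pd i (defectRep x₀ u G) y

/-- The pull-back of the calibrating two-form `e^r ι_ν dvol` by `G` in a chart. -/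
def calibRep (σ : SurfaceMetric N) (u : N → ℝ) (x₀ : N) (G : N → N × ℝ) (y : Plane) : ℝ :=
  Real.exp (heightRep x₀ G y) *
    ((√(gramDet (form σ) x₀ (chartRep x₀ G y)) *
        angle σ u ((extChartAt (𝓡 2) x₀).symm (chartRep x₀ G y))) *
        (pd 0 (fun w => chartRep x₀ G w 0) y * pd 1 (fun w => chartRep x₀ G w 1) y -
          pd 0 (fun w => chartRep x₀ G w 1) y * pd 1 (fun w => chartRep x₀ G w 0) y) +
      pd 0 (heightRep x₀ G) y *
        (flux σ u x₀ 0 (chartRep x₀ G y) * pd 1 (fun w => chartRep x₀ G w 1) y -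
          flux σ u x₀ 1 (chartRep x₀ G y) * pd 1 (fun w => chartRep x₀ G w 0) y) -
      pd 1 (heightRep x₀ G) y *
        (flux σ u x₀ 0 (chartRep x₀ G y) * pd 0 (fun w => chartRep x₀ G w 1) y -
          flux σ u x₀ 1 (chartRep x₀ G y) * pd 0 (fun w => chartRep x₀ G w 0) y))

omit [IsManifold (𝓡 2) ∞ N] in
theorem chart_symm_chartRep {x₀ : N} {G : N → N × ℝ} {y : Plane}
    (hs : (G ((extChartAt (𝓡 2) x₀).symm y)).1 ∈ (extChartAt (𝓡 2) x₀).source) :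
    (extChartAt (𝓡 2) x₀).symm (chartRep x₀ G y) = (G ((extChartAt (𝓡 2) x₀).symm y)).1 :=
  (extChartAt (𝓡 2) x₀).left_inv hs

theorem coeff_form_symm (σ : SurfaceMetric N) (x₀ : N) (i j : Fin 2) (z : Plane) :
    coeff (form σ) x₀ i j z = coeff (form σ) x₀ j i z := form_symm σ _ _ _

theorem gramRep_symm (σ : SurfaceMetric N) (x₀ : N) (G : N → N × ℝ) (y : Plane) :
    gramRep σ x₀ G 1 0 y = gramRep σ x₀ G 0 1 y := by
  unfold gramRep
  simp only [Fin.sum_univ_two, coeff_form_symm σ x₀ 1 0]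
  ring

section

variable {σ : SurfaceMetric N} {Ω : Set N} (hΩ : IsOpen Ω) {u : N → ℝ}
  (hu : ContMDiffOn (𝓡 2) 𝓘(ℝ, ℝ) ∞ u Ω)

theorem gramDet_pullback_weighted {x₀ : N} {G : N → N × ℝ} {y : Plane}
    (hy : y ∈ (extChartAt (𝓡 2) x₀).target)
    (hG : MDifferentiableAt (𝓡 2) ((𝓡 2).prod 𝓘(ℝ, ℝ)) G ((extChartAt (𝓡 2) x₀).symm y))
    (hs : (G ((extChartAt (𝓡 2) x₀).symm y)).1 ∈ (extChartAt (𝓡 2) x₀).source) :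
    gramDet (pullback ((𝓡 2).prod 𝓘(ℝ, ℝ)) (weightedMetric σ) G) x₀ y =
      Real.exp (heightRep x₀ G y) ^ 2 * detRep σ x₀ G y := by
  rw [gramDet_eq]
  simp only [coeff_pullback_weighted σ hy hG hs, detRep]
  ring

include hΩ hu

theorem pd_defectRep {x₀ : N} {G : N → N × ℝ} {y : Plane}
    (hy : y ∈ (extChartAt (𝓡 2) x₀).target)
    (hG : MDifferentiableAt (𝓡 2) ((𝓡 2).prod 𝓘(ℝ, ℝ)) G ((extChartAt (𝓡 2) x₀).symm y))
    (hs : (G ((extChartAt (𝓡 2) x₀).symm y)).1 ∈ (extChartAt (𝓡 2) x₀).source)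
    (hsΩ : (G ((extChartAt (𝓡 2) x₀).symm y)).1 ∈ Ω) (i : Fin 2) :
    pd i (defectRep x₀ u G) y = pd i (heightRep x₀ G) y -
      ∑ k, pd k (funRep x₀ u) (chartRep x₀ G y) * pd i (fun z => chartRep x₀ G z k) y := by
  obtain ⟨h1, h2, -⟩ := mfderiv_coordVec_prod hy hG i
  have hP := differentiableAt_chartRep hy hG hs
  have hz : chartRep x₀ G y ∈ chartSet x₀ Ω := ⟨(extChartAt (𝓡 2) x₀).map_source hs, by
    rw [mem_preimage, chart_symm_chartRep hs]; exact hsΩ⟩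
  have hd : DifferentiableAt ℝ (funRep x₀ u) (chartRep x₀ G y) :=
    ((contDiffOn_funRep hu x₀).contDiffAt
      ((isOpen_chartSet x₀ hΩ).mem_nhds hz)).differentiableAt (by simp)
  have hev : defectRep x₀ u G =ᶠ[𝓝 y] fun z => heightRep x₀ G z - funRep x₀ u (chartRep x₀ G z) := by
    filter_upwards [h1.continuousAt.eventually ((isOpen_extChartAt_source x₀).mem_nhds hs)] with z hz
    simp only [defectRep, funRep]
    rw [chart_symm_chartRep hz]
  have hc : DifferentiableAt ℝ (fun z => funRep x₀ u (chartRep x₀ G z)) y := hd.comp y hP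
  rw [pd_congr hev, pd_sub h2 hc, pd_comp hd hP]

/-- The calibration inequality together with its exact defect. Expanding the determinant on the left
gives the squared weighted area density minus a cofactor form in `normalRep`, which vanishes where
the image is tangent to the graph. -/
theorem calibRep_sq {x₀ : N} {G : N → N × ℝ} {y : Plane}
    (hy : y ∈ (extChartAt (𝓡 2) x₀).target)
    (hG : MDifferentiableAt (𝓡 2) ((𝓡 2).prod 𝓘(ℝ, ℝ)) G ((extChartAt (𝓡 2) x₀).symm y))
    (hs : (G ((extChartAt (𝓡 2) x₀).symm y)).1 ∈ (extChartAt (𝓡 2) x₀).source)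
    (hsΩ : (G ((extChartAt (𝓡 2) x₀).symm y)).1 ∈ Ω) :
    Real.exp (heightRep x₀ G y) ^ 2 *
      ((gramRep σ x₀ G 0 0 y - normalRep σ u x₀ G 0 y * normalRep σ u x₀ G 0 y) *
        (gramRep σ x₀ G 1 1 y - normalRep σ u x₀ G 1 y * normalRep σ u x₀ G 1 y) -
      (gramRep σ x₀ G 0 1 y - normalRep σ u x₀ G 0 y * normalRep σ u x₀ G 1 y) ^ 2) =
    calibRep σ u x₀ G y ^ 2 := by
  have hz : chartRep x₀ G y ∈ chartSet x₀ Ω := ⟨(extChartAt (𝓡 2) x₀).map_source hs, by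
    rw [mem_preimage, chart_symm_chartRep hs]; exact hsΩ⟩
  have hp0 := (sum_gradCoord_coeff hΩ hu (σ := σ) hz 0).symm
  have hp1 := (sum_gradCoord_coeff hΩ hu (σ := σ) hz 1).symm
  have hθ := angle_sq hΩ hu (σ := σ) hz
  simp only [Fin.sum_univ_two, coeff_form_symm σ x₀ 1 0] at hp0 hp1 hθ
  have key := calibration_det_identity (A := pd 0 (fun w => chartRep x₀ G w 0) y)
    (B := pd 0 (fun w => chartRep x₀ G w 1) y) (C := pd 1 (fun w => chartRep x₀ G w 0) y)
    (E := pd 1 (fun w => chartRep x₀ G w 1) y) (r0 := pd 0 (heightRep x₀ G) y)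
    (r1 := pd 1 (heightRep x₀ G) y) hp0 hp1 hθ
  have hg := gramDet_form_pos σ hz.1
  have hsq := Real.sq_sqrt hg.le
  rw [gramDet_eq, coeff_form_symm σ x₀ 1 0] at hsq
  unfold calibRep normalRep flux gramRep
  rw [← chart_symm_chartRep hs, pd_defectRep hΩ hu hy hG hs hsΩ, pd_defectRep hΩ hu hy hG hs hsΩ,
    gramDet_eq]
  simp only [Fin.sum_univ_two, coeff_form_symm σ x₀ 1 0]
  set Q := √(coeff (form σ) x₀ 0 0 (chartRep x₀ G y) * coeff (form σ) x₀ 1 1 (chartRep x₀ G y) -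
    coeff (form σ) x₀ 0 1 (chartRep x₀ G y) * coeff (form σ) x₀ 0 1 (chartRep x₀ G y)) with hQ
  rw [← hsq] at key
  linear_combination Real.exp (heightRep x₀ G y) ^ 2 * key

/-- This justifies the degenerate metric: its area density is the absolute value of the calibrating
form, so the calibrated area is independent of charts and orientation. The absolute value is
harmless where `calibRep` is positive, whence `posSet`. -/
theorem gramDet_pullback_calibration {x₀ : N} {G : N → N × ℝ} {y : Plane}
    (hy : y ∈ (extChartAt (𝓡 2) x₀).target)
    (hG : MDifferentiableAt (𝓡 2) ((𝓡 2).prod 𝓘(ℝ, ℝ)) G ((extChartAt (𝓡 2) x₀).symm y))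
    (hs : (G ((extChartAt (𝓡 2) x₀).symm y)).1 ∈ (extChartAt (𝓡 2) x₀).source)
    (hsΩ : (G ((extChartAt (𝓡 2) x₀).symm y)).1 ∈ Ω) :
    gramDet (pullback ((𝓡 2).prod 𝓘(ℝ, ℝ)) (calibration σ u) G) x₀ y =
      calibRep σ u x₀ G y ^ 2 := by
  rw [gramDet_eq, ← calibRep_sq hΩ hu hy hG hs hsΩ]
  simp only [coeff_pullback_calibration σ u hy hG hs (mdifferentiableAt_of_mem hΩ hu hsΩ),
    gramRep_symm, normalRep]
  ring

/-- The calibrating form is closed; the primitive is explicit. -/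
theorem calibRep_eq_pd (heq : IsTranslatingSolution σ Ω u) {x₀ : N} {G : N → N × ℝ} {y : Plane}
    (hy : y ∈ (extChartAt (𝓡 2) x₀).target)
    (hG : MDifferentiableAt (𝓡 2) ((𝓡 2).prod 𝓘(ℝ, ℝ)) G ((extChartAt (𝓡 2) x₀).symm y))
    (hs : (G ((extChartAt (𝓡 2) x₀).symm y)).1 ∈ (extChartAt (𝓡 2) x₀).source)
    (hsΩ : (G ((extChartAt (𝓡 2) x₀).symm y)).1 ∈ Ω)
    (hP : ContDiffAt ℝ 2 (chartRep x₀ G) y) :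
    calibRep σ u x₀ G y =
    pd 0 (fun z => Real.exp (heightRep x₀ G z) *
        (flux σ u x₀ 0 (chartRep x₀ G z) * pd 1 (fun w => chartRep x₀ G w 1) z -
          flux σ u x₀ 1 (chartRep x₀ G z) * pd 1 (fun w => chartRep x₀ G w 0) z)) y -
      pd 1 (fun z => Real.exp (heightRep x₀ G z) *
        (flux σ u x₀ 0 (chartRep x₀ G z) * pd 0 (fun w => chartRep x₀ G w 1) z -
          flux σ u x₀ 1 (chartRep x₀ G z) * pd 0 (fun w => chartRep x₀ G w 0) z)) y := by
  have hz : chartRep x₀ G y ∈ chartSet x₀ Ω := ⟨(extChartAt (𝓡 2) x₀).map_source hs, by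
    rw [mem_preimage, chart_symm_chartRep hs]; exact hsΩ⟩
  -- The exterior derivative of the primitive is `e^r (div X dA + dr ∧ ι_X dA)` with `X = Θ Du`.
  -- Here the translating equation enters and replaces `div X` by `Θ`.
  rw [pd_pullback_sub (fun k => ((contDiffOn_flux hΩ hu x₀ k).contDiffAt
    ((isOpen_chartSet x₀ hΩ).mem_nhds hz)).differentiableAt (by simp)) hP
    (mfderiv_coordVec_prod hy hG 0).2.1, flux_divergence hΩ hu heq hz]
  rfl

end

/-! ### Variations in a chart -/

/-- The pairs `(s, y)` for which the points with coordinates `y` and the projections of their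
images under `F s` lie in `Ω` and in the domain of the preferred chart at `x₀`. -/
def goodSet (Ω : Set N) (x₀ : N) (ε : ℝ) (F : ℝ → N → N × ℝ) : Set (ℝ × Plane) :=
  (Ioo (-ε) ε ×ˢ chartSet x₀ Ω) ∩
    (fun q : ℝ × Plane => F q.1 ((extChartAt (𝓡 2) x₀).symm q.2)) ⁻¹'
      (((extChartAt (𝓡 2) x₀).source ∩ Ω) ×ˢ univ)

section

variable {σ : SurfaceMetric N} {Ω : Set N} (hΩ : IsOpen Ω) {u : N → ℝ}
  (hu : ContMDiffOn (𝓡 2) 𝓘(ℝ, ℝ) ∞ u Ω) {K : Set N} {ε : ℝ} {F : ℝ → N → N × ℝ}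
  (hF : IsVariation ((𝓡 2).prod 𝓘(ℝ, ℝ)) Ω (graphMap u) K ε F)

include hF

theorem contMDiffOn_variation_chart (x₀ : N) :
    ContMDiffOn 𝓘(ℝ, ℝ × Plane) ((𝓡 2).prod 𝓘(ℝ, ℝ)) ∞
      (fun q : ℝ × Plane => F q.1 ((extChartAt (𝓡 2) x₀).symm q.2))
      (Ioo (-ε) ε ×ˢ chartSet x₀ Ω) := by
  have h1 : ContMDiffOn 𝓘(ℝ, ℝ × Plane) 𝓘(ℝ, ℝ) ∞ (fun q : ℝ × Plane => q.1)
      (Ioo (-ε) ε ×ˢ chartSet x₀ Ω) := contDiff_fst.contMDiff.contMDiffOn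
  have h2 : ContMDiffOn 𝓘(ℝ, ℝ × Plane) (𝓡 2) ∞
      (fun q : ℝ × Plane => (extChartAt (𝓡 2) x₀).symm q.2) (Ioo (-ε) ε ×ˢ chartSet x₀ Ω) :=
    (contMDiffOn_extChartAt_symm (n := ∞) x₀).comp
      (contDiff_snd.contMDiff.contMDiffOn (s := Ioo (-ε) ε ×ˢ chartSet x₀ Ω))
      fun q hq => hq.2.1
  exact hF.smooth.comp (h1.prodMk h2) fun q hq => ⟨hq.1, hq.2.2⟩

omit [IsManifold (𝓡 2) ∞ N] in
theorem mdifferentiableAt_variation (hΩ : IsOpen Ω) {s : ℝ} (hs : s ∈ Ioo (-ε) ε) {x : N}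
    (hx : x ∈ Ω) : MDifferentiableAt (𝓡 2) ((𝓡 2).prod 𝓘(ℝ, ℝ)) (F s) x := by
  have h1 : ContMDiffAt (𝓡 2) (𝓘(ℝ, ℝ).prod (𝓡 2)) ∞ (fun x : N => (s, x)) x :=
    contMDiffAt_const.prodMk contMDiffAt_id
  have h2 := hF.smooth.contMDiffAt (x := (s, x)) ((isOpen_Ioo.prod hΩ).mem_nhds ⟨hs, hx⟩)
  exact (ContMDiffAt.comp x h2 h1).mdifferentiableAt (by simp)

theorem isOpen_goodSet (hΩ : IsOpen Ω) (x₀ : N) : IsOpen (goodSet Ω x₀ ε F) :=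
  (contMDiffOn_variation_chart hF x₀).continuousOn.isOpen_inter_preimage
    (isOpen_Ioo.prod (isOpen_chartSet x₀ hΩ))
    (((isOpen_extChartAt_source x₀).inter hΩ).prod isOpen_univ)

theorem contDiffOn_chartRep (x₀ : N) :
    ContDiffOn ℝ ∞ (fun q : ℝ × Plane => chartRep x₀ (F q.1) q.2) (goodSet Ω x₀ ε F) := by
  rw [← contMDiffOn_iff_contDiffOn]
  have h1 := contMDiff_fst.comp_contMDiffOn
    ((contMDiffOn_variation_chart hF x₀).mono (inter_subset_left : goodSet Ω x₀ ε F ⊆ _))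
  refine ContMDiffOn.comp (t := (chartAt Plane x₀).source)
    (contMDiffOn_extChartAt (I := 𝓡 2) (n := ∞)) h1 fun q hq => ?_
  have := hq.2.1.1
  rwa [extChartAt_source] at this

theorem contDiffOn_chartRep_coord (x₀ : N) (k : Fin 2) :
    ContDiffOn ℝ ∞ (fun q : ℝ × Plane => chartRep x₀ (F q.1) q.2 k) (goodSet Ω x₀ ε F) :=
  (EuclideanSpace.proj k : Plane →L[ℝ] ℝ).contDiff.comp_contDiffOn (contDiffOn_chartRep hF x₀)

theorem contDiffOn_heightRep (x₀ : N) :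
    ContDiffOn ℝ ∞ (fun q : ℝ × Plane => heightRep x₀ (F q.1) q.2) (goodSet Ω x₀ ε F) := by
  rw [← contMDiffOn_iff_contDiffOn]
  exact contMDiff_snd.comp_contMDiffOn
    ((contMDiffOn_variation_chart hF x₀).mono (inter_subset_left : goodSet Ω x₀ ε F ⊆ _))

omit [IsManifold (𝓡 2) ∞ N] hF in
theorem mapsTo_chartRep (x₀ : N) :
    MapsTo (fun q : ℝ × Plane => chartRep x₀ (F q.1) q.2) (goodSet Ω x₀ ε F) (chartSet x₀ Ω) :=
  fun q hq => ⟨(extChartAt (𝓡 2) x₀).map_source hq.2.1.1, by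
    rw [mem_preimage, chart_symm_chartRep hq.2.1.1]; exact hq.2.1.2⟩

theorem contDiffOn_comp_chartRep {x₀ : N} {f : Plane → ℝ} (hf : ContDiffOn ℝ ∞ f (chartSet x₀ Ω)) :
    ContDiffOn ℝ ∞ (fun q : ℝ × Plane => f (chartRep x₀ (F q.1) q.2)) (goodSet Ω x₀ ε F) :=
  hf.comp (contDiffOn_chartRep hF x₀) (mapsTo_chartRep x₀)

theorem contDiffOn_gramRep (hΩ : IsOpen Ω) (x₀ : N) (i j : Fin 2) :
    ContDiffOn ℝ ∞ (fun q : ℝ × Plane => gramRep σ x₀ (F q.1) i j q.2) (goodSet Ω x₀ ε F) := by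
  have hW := isOpen_goodSet hF hΩ x₀
  have hP : ∀ i k, ContDiffOn ℝ ∞
      (fun q : ℝ × Plane => pd i (fun z => chartRep x₀ (F q.1) z k) q.2) (goodSet Ω x₀ ε F) :=
    fun i k => contDiffOn_pd_snd hW (contDiffOn_chartRep_coord hF x₀ k) i
  have hR : ∀ i, ContDiffOn ℝ ∞
      (fun q : ℝ × Plane => pd i (heightRep x₀ (F q.1)) q.2) (goodSet Ω x₀ ε F) :=
    fun i => contDiffOn_pd_snd hW (contDiffOn_heightRep hF x₀) i
  exact (ContDiffOn.sum fun k _ => ContDiffOn.sum fun l _ => ((hP i k).mul (hP j l)).mul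
    (contDiffOn_comp_chartRep hF ((contDiffOn_coeff_form σ x₀ k l).mono inter_subset_left))).add
    ((hR i).mul (hR j))

include hΩ hu

omit hΩ in
theorem contDiffOn_defectRep (x₀ : N) :
    ContDiffOn ℝ ∞ (fun q : ℝ × Plane => defectRep x₀ u (F q.1) q.2) (goodSet Ω x₀ ε F) := by
  refine ((contDiffOn_heightRep hF x₀).sub (contDiffOn_comp_chartRep hF
    (contDiffOn_funRep hu x₀))).congr fun q hq => ?_
  simp only [defectRep, funRep]
  rw [chart_symm_chartRep hq.2.1.1]

theorem contDiffOn_normalRep (x₀ : N) (i : Fin 2) :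
    ContDiffOn ℝ ∞ (fun q : ℝ × Plane => normalRep σ u x₀ (F q.1) i q.2) (goodSet Ω x₀ ε F) := by
  refine ((contDiffOn_comp_chartRep hF (contDiffOn_angle hΩ hu x₀ (σ := σ))).mul
    (contDiffOn_pd_snd (isOpen_goodSet hF hΩ x₀) (contDiffOn_defectRep hu hF x₀) i)).congr
    fun q hq => ?_
  simp only [normalRep, funRep]
  rw [chart_symm_chartRep hq.2.1.1]

theorem contDiffOn_calibRep (x₀ : N) :
    ContDiffOn ℝ ∞ (fun q : ℝ × Plane => calibRep σ u x₀ (F q.1) q.2) (goodSet Ω x₀ ε F) := by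
  have hW := isOpen_goodSet hF hΩ x₀
  have hP : ∀ i k, ContDiffOn ℝ ∞
      (fun q : ℝ × Plane => pd i (fun z => chartRep x₀ (F q.1) z k) q.2) (goodSet Ω x₀ ε F) :=
    fun i k => contDiffOn_pd_snd hW (contDiffOn_chartRep_coord hF x₀ k) i
  have hR : ∀ i, ContDiffOn ℝ ∞
      (fun q : ℝ × Plane => pd i (heightRep x₀ (F q.1)) q.2) (goodSet Ω x₀ ε F) :=
    fun i => contDiffOn_pd_snd hW (contDiffOn_heightRep hF x₀) i
  have hb : ∀ k, ContDiffOn ℝ ∞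
      (fun q : ℝ × Plane => flux σ u x₀ k (chartRep x₀ (F q.1) q.2)) (goodSet Ω x₀ ε F) :=
    fun k => contDiffOn_comp_chartRep hF (contDiffOn_flux hΩ hu x₀ k)
  have ha : ContDiffOn ℝ ∞ (fun q : ℝ × Plane =>
      √(gramDet (form σ) x₀ (chartRep x₀ (F q.1) q.2)) *
        angle σ u ((extChartAt (𝓡 2) x₀).symm (chartRep x₀ (F q.1) q.2))) (goodSet Ω x₀ ε F) :=
    contDiffOn_comp_chartRep hF ((((contDiffOn_gramDet_form σ x₀).mono inter_subset_left).sqrt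
      fun _ hz => (gramDet_form_pos σ hz.1).ne').mul (contDiffOn_angle hΩ hu x₀ (σ := σ)))
  exact (contDiffOn_heightRep hF x₀).exp.mul (((ha.mul (((hP 0 0).mul (hP 1 1)).sub
    ((hP 0 1).mul (hP 1 0)))).add ((hR 0).mul (((hb 0).mul (hP 1 1)).sub
      ((hb 1).mul (hP 1 0))))).sub ((hR 1).mul (((hb 0).mul (hP 0 1)).sub ((hb 1).mul (hP 0 0)))))

end

end

/-! ### Second derivatives of differences -/

theorem differentiable_of_contDiffAt_two {f : ℝ → ℝ} (hf : ContDiffAt ℝ 2 f 0) :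
    (∀ᶠ s in 𝓝 (0 : ℝ), DifferentiableAt ℝ f s) ∧ DifferentiableAt ℝ (deriv f) 0 := by
  refine ⟨(hf.eventually (by simp)).mono fun s hs => hs.differentiableAt (by norm_num), ?_⟩
  have h1 : ContDiffAt ℝ 1 (fun s => fderiv ℝ f s 1) 0 :=
    (hf.fderiv_right (m := 1) (by norm_num)).clm_apply contDiffAt_const
  exact h1.differentiableAt (by norm_num)

/-- Write `a - c = (a² - c²) / (a + c)`. The numerator is a quadratic form in functions that vanish
at `0`, so only the first derivatives of `n₀` and `n₁`, and the values of everything else,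
contribute to the second derivative. -/
theorem second_deriv_sub_of_sq_sub {a c r n₀ n₁ g₀₀ g₀₁ g₁₁ : ℝ → ℝ}
    (ha : ContDiffAt ℝ 2 a 0) (hc : ContDiffAt ℝ 2 c 0) (hr : ContDiffAt ℝ 2 r 0)
    (hn₀ : ContDiffAt ℝ 2 n₀ 0) (hn₁ : ContDiffAt ℝ 2 n₁ 0) (hg₀₀ : ContDiffAt ℝ 2 g₀₀ 0)
    (hg₀₁ : ContDiffAt ℝ 2 g₀₁ 0) (hg₁₁ : ContDiffAt ℝ 2 g₁₁ 0)
    (hapos : ∀ᶠ s in 𝓝 (0 : ℝ), 0 < a s) (hcpos : ∀ᶠ s in 𝓝 (0 : ℝ), 0 < c s)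
    (hrel : ∀ᶠ s in 𝓝 (0 : ℝ), a s ^ 2 - c s ^ 2 =
      r s ^ 2 * (g₁₁ s * n₀ s ^ 2 - 2 * g₀₁ s * (n₀ s * n₁ s) + g₀₀ s * n₁ s ^ 2))
    (h₀ : n₀ 0 = 0) (h₁ : n₁ 0 = 0) :
    deriv (fun s => a s - c s) 0 = 0 ∧
    deriv (deriv fun s => a s - c s) 0 = r 0 ^ 2 / a 0 * (g₁₁ 0 * deriv n₀ 0 ^ 2 -
      2 * g₀₁ 0 * (deriv n₀ 0 * deriv n₁ 0) + g₀₀ 0 * deriv n₁ 0 ^ 2) := by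
  have ha0 := hapos.self_of_nhds
  have hc0 := hcpos.self_of_nhds
  set E : ℝ → ℝ := fun s => r s ^ 2 / (a s + c s) with hE_def
  have hE : ContDiffAt ℝ 2 E 0 := (hr.pow 2).div (ha.add hc) (add_pos ha0 hc0).ne'
  -- The pair `(m₀, m₁)` is the cofactor matrix of `g` applied to `(n₀, n₁)`. Thus `a - c = n₀ k₀ +
  -- n₁ k₁` with all four factors zero at `0`, as `second_deriv_mul_of_zero` requires.
  set m₀ : ℝ → ℝ := fun s => g₁₁ s * n₀ s - g₀₁ s * n₁ s with hm₀_def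
  set m₁ : ℝ → ℝ := fun s => g₀₀ s * n₁ s - g₀₁ s * n₀ s with hm₁_def
  have hm₀ : ContDiffAt ℝ 2 m₀ 0 := (hg₁₁.mul hn₀).sub (hg₀₁.mul hn₁)
  have hm₁ : ContDiffAt ℝ 2 m₁ 0 := (hg₀₀.mul hn₁).sub (hg₀₁.mul hn₀)
  set k₀ : ℝ → ℝ := fun s => m₀ s * E s with hk₀_def
  set k₁ : ℝ → ℝ := fun s => m₁ s * E s with hk₁_def
  have hk₀ : ContDiffAt ℝ 2 k₀ 0 := hm₀.mul hE
  have hk₁ : ContDiffAt ℝ 2 k₁ 0 := hm₁.mul hE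
  have hm₀0 : m₀ 0 = 0 := by simp [hm₀_def, h₀, h₁]
  have hm₁0 : m₁ 0 = 0 := by simp [hm₁_def, h₀, h₁]
  have hfe : (fun s => a s - c s) =ᶠ[𝓝 0] fun s => n₀ s * k₀ s + n₁ s * k₁ s := by
    filter_upwards [hapos, hcpos, hrel] with s h1 h2 h3
    have hne : a s + c s ≠ 0 := (add_pos h1 h2).ne'
    simp only [hk₀_def, hk₁_def, hm₀_def, hm₁_def, hE_def]
    field_simp
    linear_combination h3
  obtain ⟨hp₀, hq₀⟩ := second_deriv_mul_of_zero hn₀ hk₀ h₀ (by simp [hk₀_def, hm₀0])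
  obtain ⟨hp₁, hq₁⟩ := second_deriv_mul_of_zero hn₁ hk₁ h₁ (by simp [hk₁_def, hm₁0])
  have d₀ := differentiable_of_contDiffAt_two
    (show ContDiffAt ℝ 2 (fun s => n₀ s * k₀ s) 0 from hn₀.mul hk₀)
  have d₁ := differentiable_of_contDiffAt_two
    (show ContDiffAt ℝ 2 (fun s => n₁ s * k₁ s) 0 from hn₁.mul hk₁)
  have hsum : (deriv fun s => n₀ s * k₀ s + n₁ s * k₁ s) =ᶠ[𝓝 0]
      fun s => deriv (fun s => n₀ s * k₀ s) s + deriv (fun s => n₁ s * k₁ s) s := by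
    filter_upwards [d₀.1, d₁.1] with s h1 h2 using deriv_fun_add h1 h2
  refine ⟨by rw [hfe.deriv_eq, hsum.eq_of_nhds, hp₀, hp₁, add_zero], ?_⟩
  rw [hfe.deriv.deriv_eq, hsum.deriv_eq, deriv_fun_add d₀.2 d₁.2]
  change deriv (deriv fun s => n₀ s * k₀ s) 0 + deriv (deriv fun s => n₁ s * k₁ s) 0 = _
  rw [hq₀, hq₁]
  have dn₀ := (differentiable_of_contDiffAt_two hn₀).1.self_of_nhds
  have dn₁ := (differentiable_of_contDiffAt_two hn₁).1.self_of_nhds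
  have dg₀₀ := (differentiable_of_contDiffAt_two hg₀₀).1.self_of_nhds
  have dg₀₁ := (differentiable_of_contDiffAt_two hg₀₁).1.self_of_nhds
  have dg₁₁ := (differentiable_of_contDiffAt_two hg₁₁).1.self_of_nhds
  have dE := (differentiable_of_contDiffAt_two hE).1.self_of_nhds
  have dm₀ := (differentiable_of_contDiffAt_two hm₀).1.self_of_nhds
  have dm₁ := (differentiable_of_contDiffAt_two hm₁).1.self_of_nhds
  have hm₀' : deriv m₀ 0 = g₁₁ 0 * deriv n₀ 0 - g₀₁ 0 * deriv n₁ 0 := by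
    have t₀ : DifferentiableAt ℝ (fun s => g₁₁ s * n₀ s) 0 := dg₁₁.mul dn₀
    have t₁ : DifferentiableAt ℝ (fun s => g₀₁ s * n₁ s) 0 := dg₀₁.mul dn₁
    rw [hm₀_def, deriv_fun_sub t₀ t₁, deriv_fun_mul dg₁₁ dn₀, deriv_fun_mul dg₀₁ dn₁, h₀, h₁]
    ring
  have hm₁' : deriv m₁ 0 = g₀₀ 0 * deriv n₁ 0 - g₀₁ 0 * deriv n₀ 0 := by
    have t₀ : DifferentiableAt ℝ (fun s => g₀₀ s * n₁ s) 0 := dg₀₀.mul dn₁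
    have t₁ : DifferentiableAt ℝ (fun s => g₀₁ s * n₀ s) 0 := dg₀₁.mul dn₀
    rw [hm₁_def, deriv_fun_sub t₀ t₁, deriv_fun_mul dg₀₀ dn₁, deriv_fun_mul dg₀₁ dn₀, h₀, h₁]
    ring
  have hk₀' : deriv k₀ 0 = deriv m₀ 0 * E 0 := by
    rw [hk₀_def, deriv_fun_mul dm₀ dE, hm₀0]; ring
  have hk₁' : deriv k₁ 0 = deriv m₁ 0 * E 0 := by
    rw [hk₁_def, deriv_fun_mul dm₁ dE, hm₁0]; ring
  -- Hence `a + c = 2 a` at `0`, and this factor `2` cancels the one from Leibniz' rule.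
  have hac : a 0 = c 0 := by
    have := hfe.eq_of_nhds
    simp only [h₀, h₁, zero_mul, add_zero] at this
    linarith
  have hE0 : E 0 = r 0 ^ 2 / (2 * a 0) := by
    simp only [hE_def]
    rw [← hac, two_mul]
  rw [hk₀', hk₁', hm₀', hm₁', hE0]
  field_simp
  ring

/-! ### Chart representations along the graph. -/

section

variable {N : Type*} [TopologicalSpace N] [ChartedSpace Plane N]

theorem pd_proj (i k : Fin 2) (y : Plane) : pd i (fun z => z k) y = if i = k then 1 else 0 := by
  have : pd i (fun z => z k) y = (e i) k := by
    have h := (EuclideanSpace.proj k : Plane →L[ℝ] ℝ).fderiv (x := y)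
    exact congrArg (fun L : Plane →L[ℝ] ℝ => L (e i)) h
  rw [this]
  fin_cases i <;> fin_cases k <;> simp [e]

theorem pd_const (i : Fin 2) (c : ℝ) (y : Plane) : pd i (fun _ => c) y = 0 := by simp [pd]

section

variable {Ω : Set N} {u : N → ℝ} {G : N → N × ℝ} (hG : ∀ x ∈ Ω, G x = graphMap u x)

include hG

theorem chartRep_graph {x₀ : N} {y : Plane} (hy : y ∈ chartSet x₀ Ω) : chartRep x₀ G y = y := by
  rw [chartRep, hG _ hy.2]
  exact (extChartAt (𝓡 2) x₀).right_inv hy.1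

theorem heightRep_graph {x₀ : N} {y : Plane} (hy : y ∈ chartSet x₀ Ω) :
    heightRep x₀ G y = funRep x₀ u y := by
  rw [heightRep, hG _ hy.2]; rfl

theorem defectRep_graph {x₀ : N} {y : Plane} (hy : y ∈ chartSet x₀ Ω) :
    defectRep x₀ u G y = 0 := by
  rw [defectRep, heightRep, hG _ hy.2]; simp [graphMap]

variable (hΩ : IsOpen Ω)

include hΩ

theorem pd_chartRep_graph {x₀ : N} {y : Plane} (hy : y ∈ chartSet x₀ Ω) (i k : Fin 2) :
    pd i (fun z => chartRep x₀ G z k) y = if i = k then 1 else 0 := by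
  rw [← pd_proj i k y]
  exact pd_congr (eventually_of_mem ((isOpen_chartSet x₀ hΩ).mem_nhds hy)
    fun z hz => congrArg (fun v : Plane => v k) (chartRep_graph hG hz))

theorem pd_heightRep_graph {x₀ : N} {y : Plane} (hy : y ∈ chartSet x₀ Ω) (i : Fin 2) :
    pd i (heightRep x₀ G) y = pd i (funRep x₀ u) y :=
  pd_congr (eventually_of_mem ((isOpen_chartSet x₀ hΩ).mem_nhds hy)
    fun _ hz => heightRep_graph hG hz)

theorem pd_defectRep_graph {x₀ : N} {y : Plane} (hy : y ∈ chartSet x₀ Ω) (i : Fin 2) :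
    pd i (defectRep x₀ u G) y = 0 := by
  rw [← pd_const i 0 y]
  exact pd_congr (eventually_of_mem ((isOpen_chartSet x₀ hΩ).mem_nhds hy)
    fun _ hz => defectRep_graph hG hz)

end

variable [IsManifold (𝓡 2) ∞ N]

/-- The density of the weighted area of `G` in a chart. -/
def areaRep (σ : SurfaceMetric N) (x₀ : N) (G : N → N × ℝ) (y : Plane) : ℝ :=
  Real.exp (heightRep x₀ G y) * √(detRep σ x₀ G y)

/-- The pairs in `goodSet` at which the area density and the calibrating form are positive. -/
def posSet (σ : SurfaceMetric N) (u : N → ℝ) (Ω : Set N) (x₀ : N) (ε : ℝ) (F : ℝ → N → N × ℝ) :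
    Set (ℝ × Plane) :=
  goodSet Ω x₀ ε F ∩ (fun q : ℝ × Plane =>
    (detRep σ x₀ (F q.1) q.2, calibRep σ u x₀ (F q.1) q.2)) ⁻¹' (Ioi 0 ×ˢ Ioi 0)

/-! ### The graph metric -/

section

variable {σ : SurfaceMetric N} {Ω : Set N} (hΩ : IsOpen Ω) {u : N → ℝ}
  (hu : ContMDiffOn (𝓡 2) 𝓘(ℝ, ℝ) ∞ u Ω)

theorem isBilin_graphMetric (σ : SurfaceMetric N) (u : N → ℝ) : IsBilin (graphMetric σ u) :=
  (isBilin_productMetric σ).pullback (graphMap u)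

theorem graphMetric_symm (σ : SurfaceMetric N) (u : N → ℝ) (x : N) (v w : TangentSpace (𝓡 2) x) :
    graphMetric σ u x v w = graphMetric σ u x w v := by
  exact congrArg₂ (· + ·) (form_symm σ _ _ _) (mul_comm _ _)

theorem graphMetric_nonneg (σ : SurfaceMetric N) (u : N → ℝ) (x : N) (v : TangentSpace (𝓡 2) x) :
    0 ≤ graphMetric σ u x v v :=
  add_nonneg (form_nonneg σ _ _) (mul_self_nonneg _)

include hΩ hu

omit [IsManifold (𝓡 2) ∞ N] hΩ in
theorem contMDiffOn_graphMap : ContMDiffOn (𝓡 2) ((𝓡 2).prod 𝓘(ℝ, ℝ)) ∞ (graphMap u) Ω :=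
  contMDiffOn_id.prodMk hu

omit [IsManifold (𝓡 2) ∞ N] in
theorem mfderiv_graphMap {x : N} (hx : x ∈ Ω) (v : TangentSpace (𝓡 2) x) :
    (mfderiv (𝓡 2) ((𝓡 2).prod 𝓘(ℝ, ℝ)) (graphMap u) x v : Plane × ℝ) = ((v : Plane), diff u x v) := by
  have h := mfderiv_prodMk (mdifferentiableAt_id (I := 𝓡 2) (x := x))
    (mdifferentiableAt_of_mem hΩ hu hx)
  have h' := (congrArg (fun L : Plane →L[ℝ] Plane × ℝ => L v) h :)
  refine Eq.trans h' (Prod.ext ?_ rfl)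
  exact (congrArg (fun L : Plane →L[ℝ] Plane => L v) (mfderiv_id (I := 𝓡 2) (x := x)) :)

omit [IsManifold (𝓡 2) ∞ N] in
theorem graphMap_injective {x : N} (hx : x ∈ Ω) :
    Function.Injective (mfderiv (𝓡 2) ((𝓡 2).prod 𝓘(ℝ, ℝ)) (graphMap u) x) := by
  intro v w hvw
  have h1 := mfderiv_graphMap hΩ hu hx v
  have h2 := mfderiv_graphMap hΩ hu hx w
  exact (congrArg Prod.fst (h1.symm.trans (Eq.trans hvw h2)) :)

theorem graphMetric_pos {x : N} (hx : x ∈ Ω) (v : TangentSpace (𝓡 2) x) (hv : v ≠ 0) :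
    0 < graphMetric σ u x v v := by
  have h1 := mfderiv_graphMap hΩ hu hx v
  have h2 : graphMetric σ u x v v = form σ x v v + diff u x v * diff u x v :=
    congrArg (fun a : Plane × ℝ => productMetric σ (graphMap u x) a a) h1
  rw [h2]
  exact add_pos_of_pos_of_nonneg (form_pos σ x v hv) (mul_self_nonneg _)

end

/-! ### Positivity and the initial values -/

section

variable {σ : SurfaceMetric N} {Ω : Set N} (hΩ : IsOpen Ω) {u : N → ℝ}
  (hu : ContMDiffOn (𝓡 2) 𝓘(ℝ, ℝ) ∞ u Ω) {K : Set N} {ε : ℝ} {F : ℝ → N → N × ℝ}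
  (hF : IsVariation ((𝓡 2).prod 𝓘(ℝ, ℝ)) Ω (graphMap u) K ε F)

include hF hΩ hu

omit hu in
theorem contDiffOn_detRep (x₀ : N) :
    ContDiffOn ℝ ∞ (fun q : ℝ × Plane => detRep σ x₀ (F q.1) q.2) (goodSet Ω x₀ ε F) := by
  have h := fun i j => contDiffOn_gramRep (σ := σ) hF hΩ x₀ i j
  exact ((h 0 0).mul (h 1 1)).sub ((h 0 1).mul (h 1 0))

theorem isOpen_posSet (x₀ : N) : IsOpen (posSet σ u Ω x₀ ε F) :=
  ((contDiffOn_detRep hΩ hF x₀).continuousOn.prodMk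
    (contDiffOn_calibRep hΩ hu hF x₀).continuousOn).isOpen_inter_preimage
      (isOpen_goodSet hF hΩ x₀) (isOpen_Ioi.prod isOpen_Ioi)

omit hu in
theorem contDiffOn_areaRep (x₀ : N) :
    ContDiffOn ℝ ∞ (fun q : ℝ × Plane => areaRep σ x₀ (F q.1) q.2) (posSet σ u Ω x₀ ε F) :=
  ((contDiffOn_heightRep hF x₀).mono inter_subset_left).exp.mul
    (((contDiffOn_detRep hΩ hF x₀).mono inter_subset_left).sqrt fun _ hq => (ne_of_gt hq.2.1))

omit [IsManifold (𝓡 2) ∞ N] hΩ hu in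
theorem zero_mem_goodSet {x₀ : N} {y : Plane} (hy : y ∈ chartSet x₀ Ω) :
    ((0 : ℝ), y) ∈ goodSet Ω x₀ ε F := by
  have h0 : (0 : ℝ) ∈ Ioo (-ε) ε := ⟨by linarith [hF.pos], hF.pos⟩
  refine ⟨⟨h0, hy⟩, ?_⟩
  simp only [mem_preimage]
  rw [hF.start _ hy.2]
  exact ⟨⟨(extChartAt (𝓡 2) x₀).map_target hy.1, hy.2⟩, trivial⟩

omit hu in
theorem normalRep_zero {x₀ : N} {y : Plane} (hy : y ∈ chartSet x₀ Ω) (i : Fin 2) :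
    normalRep σ u x₀ (F 0) i y = 0 := by
  rw [normalRep, pd_defectRep_graph hF.start hΩ hy, mul_zero]

/-- On the graph the calibrating form is `e^u √(det σ) Θ (1 + |Du|²) > 0` in coordinates. There `ν♭`
restricts to zero, so by `calibRep_sq` the weighted area density has the same square and the Gram
determinant is positive too. -/
theorem zero_mem_posSet {x₀ : N} {y : Plane} (hy : y ∈ chartSet x₀ Ω) :
    ((0 : ℝ), y) ∈ posSet σ u Ω x₀ ε F := by
  have hg := zero_mem_goodSet hF hy
  have hθ := angle_sq hΩ hu (σ := σ) hy
  have hpos : 0 < 1 + ∑ k, gradCoord σ u x₀ k ((extChartAt (𝓡 2) x₀).symm y) *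
      pd k (funRep x₀ u) y :=
    pos_of_mul_pos_right (hθ ▸ zero_lt_one) (sq_nonneg _)
  have hc : 0 < calibRep σ u x₀ (F 0) y := by
    have h1 : calibRep σ u x₀ (F 0) y = Real.exp (funRep x₀ u y) * (√(gramDet (form σ) x₀ y) *
        angle σ u ((extChartAt (𝓡 2) x₀).symm y) * (1 + ∑ k, gradCoord σ u x₀ k
          ((extChartAt (𝓡 2) x₀).symm y) * pd k (funRep x₀ u) y)) := by
      unfold calibRep flux
      simp only [pd_chartRep_graph hF.start hΩ hy, pd_heightRep_graph hF.start hΩ hy,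
        chartRep_graph hF.start hy, heightRep_graph hF.start hy, Fin.sum_univ_two]
      norm_num
      ring
    rw [h1]
    have h2 := Real.sqrt_pos.2 (gramDet_form_pos σ hy.1)
    have h3 := angle_pos (σ := σ) (u := u) ((extChartAt (𝓡 2) x₀).symm y)
    positivity
  refine ⟨hg, ?_, hc⟩
  have h2 := calibRep_sq hΩ hu (σ := σ) hy.1
    (mdifferentiableAt_variation hF hΩ hg.1.1 hy.2) hg.2.1.1 hg.2.1.2
  simp only [normalRep_zero hΩ hF hy, mul_zero, sub_zero] at h2
  have h3 : 0 < Real.exp (heightRep x₀ (F 0) y) ^ 2 * detRep σ x₀ (F 0) y := by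
    rw [detRep, gramRep_symm, ← sq, h2]; positivity
  exact pos_of_mul_pos_right h3 (sq_nonneg _)

omit hu in
theorem sqrt_gramDet_weighted {x₀ : N} {s : ℝ} {y : Plane} (h : (s, y) ∈ posSet σ u Ω x₀ ε F) :
    √(gramDet (pullback ((𝓡 2).prod 𝓘(ℝ, ℝ)) (weightedMetric σ) (F s)) x₀ y) =
      areaRep σ x₀ (F s) y := by
  rw [gramDet_pullback_weighted h.1.1.2.1
    (mdifferentiableAt_variation hF hΩ h.1.1.1 h.1.1.2.2) h.1.2.1.1, Real.sqrt_mul (sq_nonneg _),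
    Real.sqrt_sq (Real.exp_pos _).le, areaRep]

theorem sqrt_gramDet_calibration {x₀ : N} {s : ℝ} {y : Plane} (h : (s, y) ∈ posSet σ u Ω x₀ ε F) :
    √(gramDet (pullback ((𝓡 2).prod 𝓘(ℝ, ℝ)) (calibration σ u) (F s)) x₀ y) =
      calibRep σ u x₀ (F s) y := by
  rw [gramDet_pullback_calibration hΩ hu h.1.1.2.1
    (mdifferentiableAt_variation hF hΩ h.1.1.1 h.1.1.2.2) h.1.2.1.1 h.1.2.1.2,
    Real.sqrt_sq (le_of_lt h.2.2)]

/-! ### The second derivative of the density -/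

omit hΩ hu in
theorem gramRep_graphMap (hΩ : IsOpen Ω) {x₀ : N} {y : Plane} (hy : y ∈ chartSet x₀ Ω)
    (i j : Fin 2) : gramRep σ x₀ (F 0) i j y = gramRep σ x₀ (graphMap u) i j y := by
  unfold gramRep
  simp only [pd_chartRep_graph hF.start hΩ hy, pd_heightRep_graph hF.start hΩ hy,
    chartRep_graph hF.start hy, pd_chartRep_graph (fun _ _ => rfl) hΩ hy,
    pd_heightRep_graph (fun _ _ => rfl) hΩ hy, chartRep_graph (fun _ _ => rfl) hy]

theorem coeff_graphMetric {x₀ : N} {y : Plane} (hy : y ∈ chartSet x₀ Ω) (i j : Fin 2) :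
    coeff (graphMetric σ u) x₀ i j y = gramRep σ x₀ (F 0) i j y := by
  rw [gramRep_graphMap hF hΩ hy]
  refine coeff_pullback_product σ hy.1 ?_ ((extChartAt (𝓡 2) x₀).map_target hy.1) i j
  exact ((contMDiffOn_graphMap hu).contMDiffAt (hΩ.mem_nhds hy.2)).mdifferentiableAt (by simp)

theorem gramDet_graphMetric {x₀ : N} {y : Plane} (hy : y ∈ chartSet x₀ Ω) :
    gramDet (graphMetric σ u) x₀ y = detRep σ x₀ (F 0) y := by
  rw [gramDet_eq]
  simp only [coeff_graphMetric hΩ hu hF hy]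
  rfl

/-- The normal speed divided by the angle function is the speed of the height above the graph. -/
theorem normalSpeedOverAngle_eq {x₀ : N} {y : Plane} (hy : y ∈ chartSet x₀ Ω) :
    funRep x₀ (normalSpeedOverAngle σ u F) y = deriv (fun s => defectRep x₀ u (F s) y) 0 := by
  set x := (extChartAt (𝓡 2) x₀).symm y with hx
  have h0 : (0 : ℝ) ∈ Ioo (-ε) ε := ⟨by linarith [hF.pos], hF.pos⟩
  have hxΩ : x ∈ Ω := hy.2
  have hF0 : F 0 x = graphMap u x := hF.start x hxΩ
  have hcurve : MDifferentiableAt 𝓘(ℝ, ℝ) ((𝓡 2).prod 𝓘(ℝ, ℝ)) (fun s => F s x) 0 := by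
    have h1 : ContMDiffAt 𝓘(ℝ, ℝ) (𝓘(ℝ, ℝ).prod (𝓡 2)) ∞ (fun s : ℝ => (s, x)) 0 :=
      contMDiffAt_id.prodMk contMDiffAt_const
    have h2 := hF.smooth.contMDiffAt (x := ((0 : ℝ), x)) ((isOpen_Ioo.prod hΩ).mem_nhds ⟨h0, hxΩ⟩)
    exact (ContMDiffAt.comp (0 : ℝ) h2 h1).mdifferentiableAt (by simp)
  have h1 : MDifferentiableAt 𝓘(ℝ, ℝ) (𝓡 2) (fun s => (F s x).1) 0 :=
    mdifferentiableAt_fst.comp 0 hcurve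
  have h2 : MDifferentiableAt 𝓘(ℝ, ℝ) 𝓘(ℝ, ℝ) (fun s => (F s x).2) 0 :=
    mdifferentiableAt_snd.comp 0 hcurve
  have hux : MDifferentiableAt (𝓡 2) 𝓘(ℝ, ℝ) u (F 0 x).1 := by
    rw [hF0]; exact mdifferentiableAt_of_mem hΩ hu hxΩ
  set V : Plane := mfderiv 𝓘(ℝ, ℝ) (𝓡 2) (fun s => (F s x).1) 0 (1 : ℝ) with hV
  set w : ℝ := deriv (fun s => (F s x).2) 0 with hw
  have hvel : (velocity ((𝓡 2).prod 𝓘(ℝ, ℝ)) F x : Plane × ℝ) = (V, w) := by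
    have h4 := mfderiv_prodMk h1 h2
    refine Eq.trans (congrArg (fun L : ℝ →L[ℝ] Plane × ℝ => L 1) h4 :) (Prod.ext rfl ?_)
    have h5 : (mfderiv 𝓘(ℝ, ℝ) 𝓘(ℝ, ℝ) (fun s => (F s x).2) 0 : ℝ →L[ℝ] ℝ) =
        fderiv ℝ (fun s => (F s x).2) 0 := mfderiv_eq_fderiv
    exact (congrArg (fun L : ℝ →L[ℝ] ℝ => L 1) h5 :)
  have hdu : deriv (fun s => u (F s x).1) 0 = diff u x V := by
    have h5 := mfderiv_comp (0 : ℝ) hux h1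
    have h6 : (mfderiv 𝓘(ℝ, ℝ) 𝓘(ℝ, ℝ) (fun s => u (F s x).1) 0 : ℝ →L[ℝ] ℝ) =
        fderiv ℝ (fun s => u (F s x).1) 0 := mfderiv_eq_fderiv
    have h7 : deriv (fun s => u (F s x).1) 0 = diff u (F 0 x).1 V :=
      ((congrArg (fun L : ℝ →L[ℝ] ℝ => L 1) h6.symm :).trans
        (congrArg (fun L : ℝ →L[ℝ] ℝ => L 1) h5 :))
    have h8 : ∀ x' : N, x' = x → diff u x' V = diff u x V := by rintro _ rfl; rfl
    rw [h7]; exact h8 _ (by rw [hF0]; rfl)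
  have hderiv : deriv (fun s => defectRep x₀ u (F s) y) 0 = w - diff u x V := by
    rw [← hdu, hw]
    exact deriv_fun_sub h2.differentiableAt (hux.comp (0 : ℝ) h1).differentiableAt
  rw [hderiv]
  change normalSpeedOverAngle σ u F x = _
  have hθ := angle_pos (σ := σ) (u := u) x
  unfold normalSpeedOverAngle
  rw [div_eq_iff hθ.ne']
  refine (congrArg (fun a : Plane × ℝ => productMetric σ (graphMap u x) a (upNormal σ u x)) hvel
    ).trans ?_
  -- Since `σ(V, Du) = du(V)`, the normal speed is `Θ (w - du(V))`; dividing by `Θ` leaves the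
  -- derivative of `r - u` along the curve.
  have h9 : form σ x V ((-angle σ u x) • grad (form σ) u x) = -angle σ u x * diff u x V :=
    ((isBilin_form σ).smul_right x _ _ _).trans (congrArg (-angle σ u x * ·)
      ((form_symm σ x _ _).trans (form_grad (isBilin_form σ) (form_symm σ x) (form_pos σ x) u _)))
  refine (congrArg (· + w * angle σ u x) h9).trans ?_
  ring

/-- `η` is smooth. -/
theorem mdifferentiableAt_normalSpeedOverAngle {x : N} (hx : x ∈ Ω) :
    MDifferentiableAt (𝓡 2) 𝓘(ℝ, ℝ) (normalSpeedOverAngle σ u F) x := by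
  have hy : extChartAt (𝓡 2) x x ∈ chartSet x Ω :=
    ⟨mem_extChartAt_target x, by rw [mem_preimage, extChartAt_to_inv]; exact hx⟩
  have hW := isOpen_goodSet hF hΩ x
  have hc := (contDiffOn_deriv_fst hW (contDiffOn_defectRep hu hF x)).contDiffAt
    (hW.mem_nhds (zero_mem_goodSet hF hy))
  have hd : DifferentiableAt ℝ (fun z => deriv (fun s => defectRep x u (F s) z) 0)
      (extChartAt (𝓡 2) x x) :=
    (hc.differentiableAt (by simp)).comp (extChartAt (𝓡 2) x x)
      ((differentiableAt_const (0 : ℝ)).prodMk differentiableAt_id)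
  have hcomp : MDifferentiableAt (𝓡 2) 𝓘(ℝ, ℝ)
      ((fun z => deriv (fun s => defectRep x u (F s) z) 0) ∘ extChartAt (𝓡 2) x) x :=
    hd.mdifferentiableAt.comp x
      ((contMDiffAt_chart (mem_extChartAt_source x)).mdifferentiableAt (by simp))
  refine hcomp.congr_of_eventuallyEq ?_
  filter_upwards [hΩ.mem_nhds hx, extChartAt_source_mem_nhds (I := 𝓡 2) x] with z hz hzs
  have hz' : extChartAt (𝓡 2) x z ∈ chartSet x Ω :=
    ⟨(extChartAt (𝓡 2) x).map_source hzs, by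
      rw [mem_preimage, (extChartAt (𝓡 2) x).left_inv hzs]; exact hz⟩
  simp only [Function.comp_apply]
  rw [← normalSpeedOverAngle_eq hΩ hu hF (σ := σ) hz', funRep, (extChartAt (𝓡 2) x).left_inv hzs]

/-- In the product `Θ · ∂_i (r - u)` the second factor vanishes at `s = 0`, so the derivative of `Θ`
along the variation drops out. Exchanging `∂_s` and `∂_i` in the other term produces `∂_i η`. -/
theorem deriv_normalRep {x₀ : N} {y : Plane} (hy : y ∈ chartSet x₀ Ω) (i : Fin 2) :
    deriv (fun s => normalRep σ u x₀ (F s) i y) 0 =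
      angle σ u ((extChartAt (𝓡 2) x₀).symm y) *
        diff (normalSpeedOverAngle σ u F) ((extChartAt (𝓡 2) x₀).symm y) (coordVec x₀ y i) := by
  have hW := isOpen_goodSet hF hΩ x₀
  have h0 := zero_mem_goodSet hF hy
  have hdef := contDiffOn_defectRep hu hF x₀
  have hm := deriv_pd_comm hW hdef h0 i
  rw [diff_coordVec hy.1 (mdifferentiableAt_normalSpeedOverAngle hΩ hu hF hy.2)]
  have hpd : pd i (funRep x₀ (normalSpeedOverAngle σ u F)) y =
      pd i (fun z => deriv (fun s => defectRep x₀ u (F s) z) 0) y :=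
    pd_congr (eventually_of_mem ((isOpen_chartSet x₀ hΩ).mem_nhds hy)
      fun z hz => normalSpeedOverAngle_eq hΩ hu hF hz)
  rw [hpd, ← hm]
  have hcurve : ∀ {f : ℝ × Plane → ℝ}, ContDiffOn ℝ ∞ f (goodSet Ω x₀ ε F) →
      DifferentiableAt ℝ (fun s => f (s, y)) 0 := fun hf =>
    (hasDerivAt_fst_param hW hf h0).differentiableAt
  have h1 := hcurve (contDiffOn_comp_chartRep hF (contDiffOn_angle hΩ hu x₀ (σ := σ)))
  have h2 := hcurve (contDiffOn_pd_snd hW hdef i)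
  have hev : (fun s => normalRep σ u x₀ (F s) i y) =ᶠ[𝓝 0] fun s =>
      funRep x₀ (angle σ u) (chartRep x₀ (F s) y) * pd i (defectRep x₀ u (F s)) y := by
    have : ∀ᶠ s in 𝓝 (0 : ℝ), (s, y) ∈ goodSet Ω x₀ ε F :=
      (by fun_prop : ContinuousAt (fun s : ℝ => (s, y)) 0).eventually (hW.mem_nhds h0)
    filter_upwards [this] with s hs
    rw [normalRep, funRep, chart_symm_chartRep hs.2.1.1]
  rw [hev.deriv_eq, deriv_fun_mul h1 h2]
  simp only [pd_defectRep_graph hF.start hΩ hy, mul_zero, zero_add, chartRep_graph hF.start hy]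
  rfl

/-- The first and second derivative at `s = 0` of the difference between the area density and the
calibrating form. -/
theorem second_deriv_density {x₀ : N} {y : Plane} (hy : y ∈ chartSet x₀ Ω) :
    deriv (fun s => areaRep σ x₀ (F s) y - calibRep σ u x₀ (F s) y) 0 = 0 ∧
    deriv (deriv fun s => areaRep σ x₀ (F s) y - calibRep σ u x₀ (F s) y) 0 =
      (angle σ u ((extChartAt (𝓡 2) x₀).symm y) ^ 2 *
        graphMetric σ u ((extChartAt (𝓡 2) x₀).symm y)
          (grad (graphMetric σ u) (normalSpeedOverAngle σ u F) ((extChartAt (𝓡 2) x₀).symm y))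
          (grad (graphMetric σ u) (normalSpeedOverAngle σ u F) ((extChartAt (𝓡 2) x₀).symm y)) *
        Real.exp (u ((extChartAt (𝓡 2) x₀).symm y))) * √(detRep σ x₀ (F 0) y) := by
  have hW := isOpen_posSet (σ := σ) hΩ hu hF x₀
  have h0 := zero_mem_posSet (σ := σ) hΩ hu hF hy
  have hev : ∀ᶠ s in 𝓝 (0 : ℝ), (s, y) ∈ posSet σ u Ω x₀ ε F :=
    (by fun_prop : ContinuousAt (fun s : ℝ => (s, y)) 0).eventually (hW.mem_nhds h0)
  have hcurve : ∀ {f : ℝ × Plane → ℝ}, ContDiffOn ℝ ∞ f (posSet σ u Ω x₀ ε F) →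
      ContDiffAt ℝ 2 (fun s => f (s, y)) 0 := fun hf =>
    ((hf.contDiffAt (hW.mem_nhds h0)).comp (0 : ℝ)
      (contDiffAt_id.prodMk contDiffAt_const)).of_le two_le_infty
  have hn := fun i => hcurve ((contDiffOn_normalRep (σ := σ) hΩ hu hF x₀ i).mono inter_subset_left)
  have hg := fun i j => hcurve ((contDiffOn_gramRep (σ := σ) hF hΩ x₀ i j).mono inter_subset_left)
  have ha := hcurve (contDiffOn_areaRep (σ := σ) hΩ hF x₀)
  have hc := hcurve ((contDiffOn_calibRep (σ := σ) hΩ hu hF x₀).mono inter_subset_left)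
  have hr := (hcurve ((contDiffOn_heightRep hF x₀).mono inter_subset_left)).exp
  have hapos : ∀ s, (s, y) ∈ posSet σ u Ω x₀ ε F → 0 < areaRep σ x₀ (F s) y := fun s hs =>
    mul_pos (Real.exp_pos _) (Real.sqrt_pos.2 hs.2.1)
  have hposa : ∀ᶠ s in 𝓝 (0 : ℝ), 0 < areaRep σ x₀ (F s) y := hev.mono hapos
  have hposc : ∀ᶠ s in 𝓝 (0 : ℝ), 0 < calibRep σ u x₀ (F s) y := hev.mono fun s hs => hs.2.2
  -- This is `det g - det (g - n nᵀ)`, the cofactor form of `g` at `n`, multiplied by `e^{2R}`.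
  have hrel : ∀ᶠ s in 𝓝 (0 : ℝ), areaRep σ x₀ (F s) y ^ 2 - calibRep σ u x₀ (F s) y ^ 2 =
      Real.exp (heightRep x₀ (F s) y) ^ 2 * (gramRep σ x₀ (F s) 1 1 y *
        normalRep σ u x₀ (F s) 0 y ^ 2 - 2 * gramRep σ x₀ (F s) 0 1 y *
        (normalRep σ u x₀ (F s) 0 y * normalRep σ u x₀ (F s) 1 y) +
        gramRep σ x₀ (F s) 0 0 y * normalRep σ u x₀ (F s) 1 y ^ 2) := by
    filter_upwards [hev] with s hs
    have h2 := calibRep_sq hΩ hu (σ := σ) hs.1.1.2.1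
      (mdifferentiableAt_variation hF hΩ hs.1.1.1 hs.1.1.2.2) hs.1.2.1.1 hs.1.2.1.2
    have h4 := Real.sq_sqrt (le_of_lt hs.2.1)
    simp only [detRep, gramRep_symm σ x₀ (F s) y] at h4
    rw [areaRep, detRep, gramRep_symm σ x₀ (F s) y, mul_pow, h4]
    simp only at h2
    linear_combination h2
  have hn0 : ∀ i, normalRep σ u x₀ (F 0) i y = 0 := fun i => normalRep_zero hΩ hF hy i
  obtain ⟨hd1, hd2⟩ := second_deriv_sub_of_sq_sub ha hc hr (hn 0) (hn 1) (hg 0 0) (hg 0 1) (hg 1 1)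
    hposa hposc hrel (hn0 0) (hn0 1)
  refine ⟨hd1, hd2.trans ?_⟩
  have hdet : 0 < detRep σ x₀ (F 0) y := h0.2.1
  have hsq := Real.sq_sqrt hdet.le
  have hspos := Real.sqrt_pos.2 hdet
  -- The cofactor form evaluated at `dη` is `|∇η|² det g`; division by `a = e^R √(det g)` leaves one
  -- factor `√(det g)`, the area element.
  have hgg := form_grad_grad (isBilin_graphMetric σ u) (graphMetric_symm σ u _)
    (graphMetric_pos hΩ hu hy.2) (normalSpeedOverAngle σ u F) (v := coordVec x₀ y)
    (ξ := fun i => diff (normalSpeedOverAngle σ u F) ((extChartAt (𝓡 2) x₀).symm y)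
      (coordVec x₀ y i)) ⟨_, coordVec_mfderiv_chart hy.1 _⟩ fun i => rfl
  have hcf : ∀ i j, graphMetric σ u ((extChartAt (𝓡 2) x₀).symm y) (coordVec x₀ y i)
      (coordVec x₀ y j) = gramRep σ x₀ (F 0) i j y := fun i j => coeff_graphMetric hΩ hu hF hy i j
  simp only [hcf] at hgg
  change _ * detRep σ x₀ (F 0) y = _ at hgg
  simp only [deriv_normalRep (σ := σ) hΩ hu hF hy]
  rw [areaRep, heightRep_graph hF.start hy, funRep]
  rw [← hsq] at hgg
  field_simp
  linear_combination (-angle σ u ((extChartAt (𝓡 2) x₀).symm y) ^ 2) * hgg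

end

end

/-! ### The expansion of the area to second order -/

section

variable {N : Type*} [TopologicalSpace N] [ChartedSpace Plane N] [IsManifold (𝓡 2) ∞ N]
  [MeasurableSpace N]

/-- The integrand of the second variation formula. -/
def secondVariationDensity (σ : SurfaceMetric N) (u : N → ℝ) (F : ℝ → N → N × ℝ) (x : N) : ℝ :=
  angle σ u x ^ 2 *
    graphMetric σ u x
      (grad (graphMetric σ u) (normalSpeedOverAngle σ u F) x)
      (grad (graphMetric σ u) (normalSpeedOverAngle σ u F) x) *
    Real.exp (u x)

/-- The area of `F s` over `B` with respect to the weighted metric. -/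
def weightedAreaOn (σ : SurfaceMetric N) (F : ℝ → N → N × ℝ) (B : Set N) (s : ℝ) : ENNReal :=
  areaMeasure (pullback ((𝓡 2).prod 𝓘(ℝ, ℝ)) (weightedMetric σ) (F s)) B

/-- The area of `F s` over `B` with respect to the degenerate metric `calibration σ u`. -/
def calibratedAreaOn (σ : SurfaceMetric N) (u : N → ℝ) (F : ℝ → N → N × ℝ) (B : Set N)
    (s : ℝ) : ENNReal :=
  areaMeasure (pullback ((𝓡 2).prod 𝓘(ℝ, ℝ)) (calibration σ u) (F s)) B

/-- Over `B`, the difference of the weighted and the calibrated area of `F s` is differentiable near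
`s = 0`, and it is critical at `s = 0` with the expected second derivative. -/
structure HasSecondVariationOn (σ : SurfaceMetric N) (u : N → ℝ) (F : ℝ → N → N × ℝ)
    (B : Set N) : Prop where
  weighted_ne_top : ∀ᶠ s in 𝓝 (0 : ℝ), weightedAreaOn σ F B s ≠ ⊤
  calibrated_ne_top : ∀ᶠ s in 𝓝 (0 : ℝ), calibratedAreaOn σ u F B s ≠ ⊤
  integrableOn : IntegrableOn (secondVariationDensity σ u F) B (areaMeasure (graphMetric σ u))
  exists_deriv : ∃ D : ℝ → ℝ,
    (∀ᶠ s in 𝓝 (0 : ℝ), HasDerivAt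
      (fun s => (weightedAreaOn σ F B s).toReal - (calibratedAreaOn σ u F B s).toReal) (D s) s) ∧
    D 0 = 0 ∧
    HasDerivAt D (∫ x in B, secondVariationDensity σ u F x ∂(areaMeasure (graphMetric σ u))) 0

theorem HasSecondVariationOn.empty (σ : SurfaceMetric N) (u : N → ℝ) (F : ℝ → N → N × ℝ) :
    HasSecondVariationOn σ u F ∅ where
  weighted_ne_top := by simp [weightedAreaOn]
  calibrated_ne_top := by simp [calibratedAreaOn]
  integrableOn := integrableOn_empty
  exists_deriv := ⟨fun _ => 0, by
    simpa [weightedAreaOn, calibratedAreaOn] using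
      (Eventually.of_forall fun s => hasDerivAt_const s (0 : ℝ)), rfl, by
    simpa using hasDerivAt_const (0 : ℝ) (0 : ℝ)⟩

/-- Additivity of the measures; finiteness of the areas for `s` near `0` is part of the structure
because `ENNReal.toReal` is additive only on finite values. -/
theorem HasSecondVariationOn.union {σ : SurfaceMetric N} {u : N → ℝ} {F : ℝ → N → N × ℝ}
    {B C : Set N} (hB : HasSecondVariationOn σ u F B) (hC : HasSecondVariationOn σ u F C)
    (hd : Disjoint B C) (hm : MeasurableSet C) : HasSecondVariationOn σ u F (B ∪ C) := by
  have hw : ∀ s, weightedAreaOn σ F (B ∪ C) s = weightedAreaOn σ F B s + weightedAreaOn σ F C s :=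
    fun s => measure_union hd hm
  have hc : ∀ s, calibratedAreaOn σ u F (B ∪ C) s =
      calibratedAreaOn σ u F B s + calibratedAreaOn σ u F C s := fun s => measure_union hd hm
  obtain ⟨D₁, h₁, z₁, d₁⟩ := hB.exists_deriv
  obtain ⟨D₂, h₂, z₂, d₂⟩ := hC.exists_deriv
  refine ⟨?_, ?_, hB.integrableOn.union hC.integrableOn, fun s => D₁ s + D₂ s, ?_, ?_, ?_⟩
  · filter_upwards [hB.weighted_ne_top, hC.weighted_ne_top] with s h h'
    rw [hw]; exact ENNReal.add_ne_top.2 ⟨h, h'⟩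
  · filter_upwards [hB.calibrated_ne_top, hC.calibrated_ne_top] with s h h'
    rw [hc]; exact ENNReal.add_ne_top.2 ⟨h, h'⟩
  · filter_upwards [h₁, h₂, eventually_eventually_nhds.2 hB.weighted_ne_top,
      eventually_eventually_nhds.2 hC.weighted_ne_top,
      eventually_eventually_nhds.2 hB.calibrated_ne_top,
      eventually_eventually_nhds.2 hC.calibrated_ne_top] with s a₁ a₂ b₁ b₂ b₃ b₄
    refine (a₁.add a₂).congr_of_eventuallyEq ?_
    filter_upwards [b₁, b₂, b₃, b₄] with t c₁ c₂ c₃ c₄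
    rw [hw, hc, ENNReal.toReal_add c₁ c₂, ENNReal.toReal_add c₃ c₄, Pi.add_apply]
    ring
  · simp [z₁, z₂]
  · rw [setIntegral_union hd hm hB.integrableOn hC.integrableOn]
    exact d₁.add d₂

end

/-! ### The second variation over a piece of a single chart. -/

section

variable {N : Type*} [TopologicalSpace N] [ChartedSpace Plane N] [IsManifold (𝓡 2) ∞ N]
  [MeasurableSpace N] [BorelSpace N] [SecondCountableTopology N]
  {σ : SurfaceMetric N} {Ω : Set N} (hΩ : IsOpen Ω) {u : N → ℝ}
  (hu : ContMDiffOn (𝓡 2) 𝓘(ℝ, ℝ) ∞ u Ω) {K : Set N} {ε : ℝ} {F : ℝ → N → N × ℝ}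
  (hF : IsVariation ((𝓡 2).prod 𝓘(ℝ, ℝ)) Ω (graphMap u) K ε F)

omit [IsManifold (𝓡 2) ∞ N] [MeasurableSpace N] [BorelSpace N] [SecondCountableTopology N] in
theorem isCompact_chartSet {x₀ : N} {L : Set N} (hL : IsCompact L)
    (hLs : L ⊆ (extChartAt (𝓡 2) x₀).source) : IsCompact (chartSet x₀ L) := by
  rw [chartSet_eq_image hLs]
  exact hL.image_of_continuousOn ((continuousOn_extChartAt x₀).mono hLs)

include hΩ hu hF

omit [MeasurableSpace N] [BorelSpace N] [SecondCountableTopology N] in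
theorem eventually_mem_posSet {x₀ : N} {L : Set N} (hL : IsCompact L)
    (hLs : L ⊆ (extChartAt (𝓡 2) x₀).source) (hLΩ : L ⊆ Ω) :
    ∀ᶠ s in 𝓝 (0 : ℝ), ∀ y ∈ chartSet x₀ L, (s, y) ∈ posSet σ u Ω x₀ ε F :=
  eventually_param_mem (isOpen_posSet hΩ hu hF x₀) (isCompact_chartSet hL hLs)
    fun _ hy => zero_mem_posSet hΩ hu hF ⟨hy.1, hLΩ hy.2⟩

omit hu in
theorem weightedAreaOn_eq {x₀ : N} {L B : Set N} (hL : IsCompact L)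
    (hLs : L ⊆ (extChartAt (𝓡 2) x₀).source) (hB : MeasurableSet B) (hBL : B ⊆ L) {s : ℝ}
    (hW : IsOpen (posSet σ u Ω x₀ ε F))
    (hs : ∀ y ∈ chartSet x₀ L, (s, y) ∈ posSet σ u Ω x₀ ε F) :
    IntegrableOn (fun y => areaRep σ x₀ (F s) y) (chartSet x₀ B) ∧
    weightedAreaOn σ F B s = ENNReal.ofReal (∫ y in chartSet x₀ B, areaRep σ x₀ (F s) y) := by
  have hsub : chartSet x₀ B ⊆ chartSet x₀ L := fun y hy => ⟨hy.1, hBL hy.2⟩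
  have hi := (hasDerivAt_setIntegral_param hW (contDiffOn_areaRep hΩ hF x₀)
    (isCompact_chartSet hL hLs) (measurableSet_chartSet x₀ hB) hsub hs).1
  exact ⟨hi, areaMeasure_eq_ofReal ((isBilin_weightedMetric σ).pullback (F s)) hB
    (hBL.trans hLs) hi fun y hy => sqrt_gramDet_weighted hΩ hF (hs y (hsub hy))⟩

theorem calibratedAreaOn_eq {x₀ : N} {L B : Set N} (hL : IsCompact L)
    (hLs : L ⊆ (extChartAt (𝓡 2) x₀).source) (hB : MeasurableSet B) (hBL : B ⊆ L) {s : ℝ}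
    (hs : ∀ y ∈ chartSet x₀ L, (s, y) ∈ posSet σ u Ω x₀ ε F) :
    IntegrableOn (fun y => calibRep σ u x₀ (F s) y) (chartSet x₀ B) ∧
    calibratedAreaOn σ u F B s =
      ENNReal.ofReal (∫ y in chartSet x₀ B, calibRep σ u x₀ (F s) y) := by
  have hsub : chartSet x₀ B ⊆ chartSet x₀ L := fun y hy => ⟨hy.1, hBL hy.2⟩
  have hi := (hasDerivAt_setIntegral_param (isOpen_posSet hΩ hu hF x₀)
    ((contDiffOn_calibRep (σ := σ) hΩ hu hF x₀).mono inter_subset_left)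
    (isCompact_chartSet hL hLs) (measurableSet_chartSet x₀ hB) hsub hs).1
  exact ⟨hi, areaMeasure_eq_ofReal ((isBilin_calibration σ u).pullback (F s)) hB
    (hBL.trans hLs) hi fun y hy => sqrt_gramDet_calibration hΩ hu hF (hs y (hsub hy))⟩

/-- The difference of the two areas is the integral of `areaRep - calibRep`, which is differentiated
twice under the integral sign. The compact set `L` supplies uniform bounds, while `B` need only be
measurable, so that disjoint pieces can be used for patching. -/
theorem hasSecondVariationOn_of_subset_chart {x₀ : N} {L B : Set N} (hL : IsCompact L)
    (hLs : L ⊆ (extChartAt (𝓡 2) x₀).source) (hLΩ : L ⊆ Ω) (hB : MeasurableSet B) (hBL : B ⊆ L) :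
    HasSecondVariationOn σ u F B := by
  have hW := isOpen_posSet (σ := σ) hΩ hu hF x₀
  have hLc := isCompact_chartSet hL hLs
  have hBm := measurableSet_chartSet x₀ hB
  have hsub : chartSet x₀ B ⊆ chartSet x₀ L := fun y hy => ⟨hy.1, hBL hy.2⟩
  have hsΩ : chartSet x₀ B ⊆ chartSet x₀ Ω := fun y hy => ⟨hy.1, hLΩ (hBL hy.2)⟩
  have h0 : ∀ y ∈ chartSet x₀ L, ((0 : ℝ), y) ∈ posSet σ u Ω x₀ ε F :=
    fun y hy => zero_mem_posSet hΩ hu hF ⟨hy.1, hLΩ hy.2⟩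
  have hev := eventually_mem_posSet (σ := σ) hΩ hu hF hL hLs hLΩ
  set f : ℝ × Plane → ℝ :=
    fun q => areaRep σ x₀ (F q.1) q.2 - calibRep σ u x₀ (F q.1) q.2 with hf_def
  have hf : ContDiffOn ℝ ∞ f (posSet σ u Ω x₀ ε F) := (contDiffOn_areaRep hΩ hF x₀).sub
    ((contDiffOn_calibRep (σ := σ) hΩ hu hF x₀).mono inter_subset_left)
  have hf' := contDiffOn_deriv_fst hW hf
  have hf'' := contDiffOn_deriv_fst hW hf'
  have hpt : ∀ s, (∀ y ∈ chartSet x₀ L, (s, y) ∈ posSet σ u Ω x₀ ε F) →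
      (weightedAreaOn σ F B s).toReal - (calibratedAreaOn σ u F B s).toReal =
        ∫ y in chartSet x₀ B, f (s, y) := by
    intro s hs
    obtain ⟨i1, e1⟩ := weightedAreaOn_eq hΩ hF hL hLs hB hBL hW hs
    obtain ⟨i2, e2⟩ := calibratedAreaOn_eq hΩ hu hF hL hLs hB hBL hs
    rw [e1, e2, ENNReal.toReal_ofReal, ENNReal.toReal_ofReal, ← integral_sub i1 i2]
    · exact setIntegral_nonneg hBm fun y hy => le_of_lt (hs y (hsub hy)).2.2
    · exact setIntegral_nonneg hBm fun y _ => mul_nonneg (Real.exp_pos _).le (Real.sqrt_nonneg _)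
  have hsecond : ∀ y ∈ chartSet x₀ B, deriv (fun s => deriv (fun s => f (s, y)) s) 0 =
      secondVariationDensity σ u F ((extChartAt (𝓡 2) x₀).symm y) *
        √(detRep σ x₀ (F 0) y) := fun y hy => (second_deriv_density hΩ hu hF (hsΩ hy)).2
  obtain ⟨hi2, hd2⟩ := hasDerivAt_setIntegral_param hW hf' hLc hBm hsub h0
  obtain ⟨hi3, -⟩ := hasDerivAt_setIntegral_param hW hf'' hLc hBm hsub h0
  have hslice : ContinuousOn (fun y : Plane => ((0 : ℝ), y)) (chartSet x₀ B) := by fun_prop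
  have hmaps : MapsTo (fun y : Plane => ((0 : ℝ), y)) (chartSet x₀ B) (posSet σ u Ω x₀ ε F) :=
    fun y hy => h0 y (hsub hy)
  have hdet : ContinuousOn (fun y => √(detRep σ x₀ (F 0) y)) (chartSet x₀ B) :=
    (((contDiffOn_detRep (σ := σ) hΩ hF x₀).continuousOn.mono inter_subset_left).comp hslice
      hmaps).sqrt
  have hdpos : ∀ y ∈ chartSet x₀ B, √(detRep σ x₀ (F 0) y) ≠ 0 := fun y hy =>
    (Real.sqrt_pos.2 (h0 y (hsub hy)).2.1).ne'
  -- Continuity of the second variation density is obtained by writing it as the smooth function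
  -- `∂_s² (areaRep - calibRep)` divided by the area element.
  have hgc : ContinuousOn (fun y => deriv (fun s => deriv (fun s => f (s, y)) s) 0 /
      √(detRep σ x₀ (F 0) y)) (chartSet x₀ B) :=
    (hf''.continuousOn.comp hslice hmaps).div hdet hdpos
  have hgd : EqOn (fun y => deriv (fun s => deriv (fun s => f (s, y)) s) 0 /
      √(detRep σ x₀ (F 0) y) * √(detRep σ x₀ (F 0) y))
      (fun y => deriv (fun s => deriv (fun s => f (s, y)) s) 0) (chartSet x₀ B) :=
    fun y hy => div_mul_cancel₀ _ (hdpos y hy)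
  obtain ⟨hint, hval⟩ := setIntegral_areaMeasure (isBilin_graphMetric σ u) hB (hBL.trans hLs)
    (f := secondVariationDensity σ u F) hdet hgc (hi3.congr_fun hgd.symm hBm)
    (fun y hy => by rw [gramDet_graphMetric hΩ hu hF (hsΩ hy)])
    (fun y hy => by rw [hsecond y hy, mul_div_cancel_right₀ _ (hdpos y hy)])
  refine ⟨?_, ?_, hint, fun s => ∫ y in chartSet x₀ B, deriv (fun s => f (s, y)) s, ?_, ?_, ?_⟩
  · filter_upwards [hev] with s hs
    rw [(weightedAreaOn_eq hΩ hF hL hLs hB hBL hW hs).2]; exact ENNReal.ofReal_ne_top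
  · filter_upwards [hev] with s hs
    rw [(calibratedAreaOn_eq hΩ hu hF hL hLs hB hBL hs).2]; exact ENNReal.ofReal_ne_top
  · filter_upwards [eventually_eventually_nhds.2 hev] with s hs
    exact (hasDerivAt_setIntegral_param hW hf hLc hBm hsub hs.self_of_nhds).2.congr_of_eventuallyEq
      (hs.mono hpt)
  · exact (setIntegral_congr_fun hBm fun y hy =>
      (second_deriv_density hΩ hu hF (hsΩ hy)).1).trans (by simp)
  · rw [hval, setIntegral_congr_fun hBm hgd]
    exact hd2

end

/-! ### From charts to the compact set `K`. -/

section

variable {N : Type*} [TopologicalSpace N] [T2Space N] [SecondCountableTopology N]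
  [ChartedSpace Plane N]

omit [T2Space N] [SecondCountableTopology N] in
theorem exists_compact_chart_nhds {Ω : Set N} (hΩ : IsOpen Ω) {x : N} (hx : x ∈ Ω) :
    ∃ L ∈ 𝓝 x, IsCompact L ∧ L ⊆ Ω ∧ L ⊆ (extChartAt (𝓡 2) x).source := by
  have := ChartedSpace.locallyCompactSpace Plane N
  obtain ⟨L, hL, hsub, hc⟩ := local_compact_nhds
    (inter_mem (hΩ.mem_nhds hx) (extChartAt_source_mem_nhds (I := 𝓡 2) x))
  exact ⟨L, hL, hc, hsub.trans inter_subset_left, hsub.trans inter_subset_right⟩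

theorem hasSecondVariationOn [IsManifold (𝓡 2) ∞ N] [MeasurableSpace N] [BorelSpace N]
    {σ : SurfaceMetric N} {Ω : Set N} (hΩ : IsOpen Ω) {u : N → ℝ}
    (hu : ContMDiffOn (𝓡 2) 𝓘(ℝ, ℝ) ∞ u Ω) {K : Set N} {ε : ℝ} {F : ℝ → N → N × ℝ}
    (hF : IsVariation ((𝓡 2).prod 𝓘(ℝ, ℝ)) Ω (graphMap u) K ε F) :
    HasSecondVariationOn σ u F K := by
  obtain ⟨S, hSm, hKS, hS⟩ : ∃ S : Set N, MeasurableSet S ∧ K ⊆ S ∧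
      ∀ B, MeasurableSet B → B ⊆ S → HasSecondVariationOn σ u F B := by
    -- The predicate speaks of all measurable subsets of `S`. This allows overlaps to be removed in
    -- the union step, by cutting `B` into `B ∩ S` and `B \ S`.
    refine hF.isCompact.induction_on (p := fun K => ∃ S : Set N, MeasurableSet S ∧ K ⊆ S ∧
      ∀ B, MeasurableSet B → B ⊆ S → HasSecondVariationOn σ u F B) ?_ ?_ ?_ ?_
    · refine ⟨∅, MeasurableSet.empty, subset_rfl, fun B _ hB => ?_⟩
      rw [subset_empty_iff.1 hB]; exact .empty σ u F
    · rintro s t hst ⟨S, h1, h2, h3⟩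
      exact ⟨S, h1, hst.trans h2, h3⟩
    · rintro s t ⟨S, h1, h2, h3⟩ ⟨T, h4, h5, h6⟩
      refine ⟨S ∪ T, h1.union h4, union_subset_union h2 h5, fun B hB hBs => ?_⟩
      rw [← inter_union_sdiff B S]
      exact (h3 _ (hB.inter h1) inter_subset_right).union
        (h6 _ (hB.diff h1) fun x hx => (hBs hx.1).resolve_left hx.2)
        (disjoint_sdiff_right.mono_left inter_subset_right) (hB.diff h1)
    · intro x hx
      obtain ⟨L, hL, hLc, hLΩ, hLs⟩ := exists_compact_chart_nhds hΩ (hF.subset hx)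
      exact ⟨L, mem_nhdsWithin_of_mem_nhds hL, L, hLc.measurableSet, subset_rfl, fun B hB hBL =>
        hasSecondVariationOn_of_subset_chart hΩ hu hF hLc hLs hLΩ hB hBL⟩
  exact hS K hF.isCompact.measurableSet hKS

end

/-! ### Locality of the area measure -/

section

variable {N : Type*} [TopologicalSpace N] [ChartedSpace Plane N]

theorem pullback_congr_of_eventuallyEq {E H M : Type*} [NormedAddCommGroup E] [NormedSpace ℝ E]
    [TopologicalSpace H] {J : ModelWithCorners ℝ E H} [TopologicalSpace M] [ChartedSpace H M]
    (G : ∀ p : M, TangentSpace J p → TangentSpace J p → ℝ) {f g : N → M} {x : N}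
    (h : f =ᶠ[𝓝 x] g) : pullback J G f x = pullback J G g x := by
  have key : ∀ (p q : M) (A B : Plane →L[ℝ] E), p = q → A = B → ∀ v w : Plane,
      G p (A v) (A w) = G q (B v) (B w) := by
    rintro p _ A _ rfl rfl v w; rfl
  funext v w
  exact key _ _ _ _ h.eq_of_nhds h.mfderiv_eq v w

variable [IsManifold (𝓡 2) ∞ N] [MeasurableSpace N] [BorelSpace N] [SecondCountableTopology N]

theorem areaMeasure_congr {h h' : ∀ x : N, TangentSpace (𝓡 2) x → TangentSpace (𝓡 2) x → ℝ}
    (hb : IsBilin h) (hb' : IsBilin h') {B : Set N} (hB : MeasurableSet B)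
    (heq : ∀ x ∈ B, h x = h' x) : areaMeasure h B = areaMeasure h' B := by
  rcases isEmpty_or_nonempty N with hN | hN
  · rw [B.eq_empty_of_isEmpty]; simp
  obtain ⟨f, D, hDm, hDd, hDs, hDu⟩ := exists_disjoint_chart_cover N
  have hu : B = ⋃ n, B ∩ D n := by rw [← inter_iUnion, hDu, inter_univ]
  have hd : Pairwise (Function.onFun Disjoint fun n => B ∩ D n) := fun i j hij =>
    (hDd hij).mono inter_subset_right inter_subset_right
  rw [hu, measure_iUnion hd fun n => hB.inter (hDm n), measure_iUnion hd fun n => hB.inter (hDm n)]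
  refine tsum_congr fun n => ?_
  have hs : B ∩ D n ⊆ _ := inter_subset_right.trans (hDs n)
  have hm := hB.inter (hDm n)
  rw [areaMeasure_apply hb hm hs, areaMeasure_apply hb' hm hs]
  refine setLIntegral_congr_fun (measurableSet_chartSet _ hm) fun y hy => ?_
  rw [gramDet, gramDet, heq _ hy.2.1]

end

/-! ### Invariance of the calibrated area -/

section

variable {N : Type*} [TopologicalSpace N] [ChartedSpace Plane N] [IsManifold (𝓡 2) ∞ N]
  {σ : SurfaceMetric N} {Ω : Set N} (hΩ : IsOpen Ω) {u : N → ℝ}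
  (hu : ContMDiffOn (𝓡 2) 𝓘(ℝ, ℝ) ∞ u Ω) {K : Set N} {ε : ℝ} {F G : ℝ → N → N × ℝ}

/-- The coefficients of a primitive of the calibrating form. -/
def primitiveRep (σ : SurfaceMetric N) (u : N → ℝ) (x₀ : N) (G : N → N × ℝ) (j : Fin 2)
    (z : Plane) : ℝ :=
  Real.exp (heightRep x₀ G z) *
    (flux σ u x₀ 0 (chartRep x₀ G z) * pd j (fun w => chartRep x₀ G w 1) z -
      flux σ u x₀ 1 (chartRep x₀ G z) * pd j (fun w => chartRep x₀ G w 0) z)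

include hΩ hu in
theorem contDiffOn_primitiveRep
    (hF : IsVariation ((𝓡 2).prod 𝓘(ℝ, ℝ)) Ω (graphMap u) K ε F) (x₀ : N) (j : Fin 2) :
    ContDiffOn ℝ ∞ (fun q : ℝ × Plane => primitiveRep σ u x₀ (F q.1) j q.2)
      (goodSet Ω x₀ ε F) := by
  have hP : ∀ k, ContDiffOn ℝ ∞
      (fun q : ℝ × Plane => pd j (fun z => chartRep x₀ (F q.1) z k) q.2) (goodSet Ω x₀ ε F) :=
    fun k => contDiffOn_pd_snd (isOpen_goodSet hF hΩ x₀) (contDiffOn_chartRep_coord hF x₀ k) j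
  have hb : ∀ k, ContDiffOn ℝ ∞
      (fun q : ℝ × Plane => flux σ u x₀ k (chartRep x₀ (F q.1) q.2)) (goodSet Ω x₀ ε F) :=
    fun k => contDiffOn_comp_chartRep hF (contDiffOn_flux hΩ hu x₀ k)
  exact (contDiffOn_heightRep hF x₀).exp.mul (((hb 0).mul (hP 1)).sub ((hb 1).mul (hP 0)))

omit [IsManifold (𝓡 2) ∞ N] in
theorem contDiffOn_slice {f : ℝ × Plane → ℝ} {W : Set (ℝ × Plane)} (hf : ContDiffOn ℝ ∞ f W)
    (s : ℝ) : ContDiffOn ℝ ∞ (fun y => f (s, y)) ((fun y => (s, y)) ⁻¹' W) :=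
  hf.comp (contDiff_const.prodMk contDiff_id).contDiffOn fun _ hy => hy

/-- The primitive involves first derivatives of the map, so equality of germs is required and not
only of values. -/
theorem primitiveRep_congr (σ : SurfaceMetric N) (u : N → ℝ) {x₀ : N} {G G' : N → N × ℝ}
    {y : Plane} (hy : y ∈ (extChartAt (𝓡 2) x₀).target)
    (h : G =ᶠ[𝓝 ((extChartAt (𝓡 2) x₀).symm y)] G') (j : Fin 2) :
    primitiveRep σ u x₀ G j y = primitiveRep σ u x₀ G' j y := by
  have hev : ∀ᶠ z in 𝓝 y, G ((extChartAt (𝓡 2) x₀).symm z) = G' ((extChartAt (𝓡 2) x₀).symm z) :=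
    ((continuousOn_extChartAt_symm x₀).continuousAt
      ((isOpen_extChartAt_target x₀).mem_nhds hy)).eventually h
  have hpd : ∀ k, pd j (fun w => chartRep x₀ G w k) y = pd j (fun w => chartRep x₀ G' w k) y :=
    fun k => pd_congr (hev.mono fun z hz => by simp only [chartRep, hz])
  have h0 := hev.self_of_nhds
  have h1 : chartRep x₀ G y = chartRep x₀ G' y := by simp only [chartRep, h0]
  have h2 : heightRep x₀ G y = heightRep x₀ G' y := by simp only [heightRep, h0]
  simp only [primitiveRep, hpd, h1, h2]

include hΩ hu in
theorem calibRep_eq_pd_primitiveRep (heq : IsTranslatingSolution σ Ω u)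
    (hF : IsVariation ((𝓡 2).prod 𝓘(ℝ, ℝ)) Ω (graphMap u) K ε F) {x₀ : N} {s : ℝ} {y : Plane}
    (h : (s, y) ∈ goodSet Ω x₀ ε F) :
    calibRep σ u x₀ (F s) y =
      pd 0 (primitiveRep σ u x₀ (F s) 1) y - pd 1 (primitiveRep σ u x₀ (F s) 0) y := by
  refine calibRep_eq_pd hΩ hu heq h.1.2.1 (mdifferentiableAt_variation hF hΩ h.1.1 h.1.2.2)
    h.2.1.1 h.2.1.2 ?_
  have h1 := (contDiffOn_chartRep hF x₀).contDiffAt ((isOpen_goodSet hF hΩ x₀).mem_nhds h)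
  exact (h1.comp y (contDiffAt_const.prodMk contDiffAt_id)).of_le two_le_infty

-- Stokes' theorem inside one chart. The two pulled-back forms have primitives whose difference
-- vanishes outside `C`, since a primitive depends only on the germ of the variation; Green's
-- theorem then makes the integral zero.
include hΩ hu in
theorem setIntegral_calibRep_sub_eq_zero (heq : IsTranslatingSolution σ Ω u)
    (hF : IsVariation ((𝓡 2).prod 𝓘(ℝ, ℝ)) Ω (graphMap u) K ε F)
    (hG : IsVariation ((𝓡 2).prod 𝓘(ℝ, ℝ)) Ω (graphMap u) K ε G) {x₀ : N} {C : Set Plane}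
    (hC : IsCompact C) {s : ℝ} (h1 : ∀ y ∈ C, (s, y) ∈ goodSet Ω x₀ ε F)
    (h2 : ∀ y ∈ C, (s, y) ∈ goodSet Ω x₀ ε G)
    (hFG : ∀ y ∈ chartSet x₀ Ω \ C, F s =ᶠ[𝓝 ((extChartAt (𝓡 2) x₀).symm y)] G s) :
    ∫ y in C, (calibRep σ u x₀ (F s) y - calibRep σ u x₀ (G s) y) = 0 := by
  set U : Set Plane := (fun y => (s, y)) ⁻¹' goodSet Ω x₀ ε F ∩
    (fun y => (s, y)) ⁻¹' goodSet Ω x₀ ε G with hU_def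
  have hU : IsOpen U := ((isOpen_goodSet hF hΩ x₀).preimage (by fun_prop)).inter
    ((isOpen_goodSet hG hΩ x₀).preimage (by fun_prop))
  have hCU : C ⊆ U := fun y hy => ⟨h1 y hy, h2 y hy⟩
  have hcF : ∀ j, ContDiffOn ℝ ∞ (primitiveRep σ u x₀ (F s) j) U := fun j =>
    (contDiffOn_slice (contDiffOn_primitiveRep hΩ hu hF x₀ j) s).mono inter_subset_left
  have hcG : ∀ j, ContDiffOn ℝ ∞ (primitiveRep σ u x₀ (G s) j) U := fun j =>
    (contDiffOn_slice (contDiffOn_primitiveRep hΩ hu hG x₀ j) s).mono inter_subset_right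
  set P : Fin 2 → Plane → ℝ :=
    fun j y => primitiveRep σ u x₀ (F s) j y - primitiveRep σ u x₀ (G s) j y with hP_def
  have hP : ∀ j, ContDiffOn ℝ ∞ (P j) U := fun j => (hcF j).sub (hcG j)
  have hP0 : ∀ j, ∀ y ∈ U \ C, P j y = 0 := fun j y hy =>
    sub_eq_zero.2 (primitiveRep_congr σ u hy.1.1.1.2.1 (hFG y ⟨hy.1.1.1.2, hy.2⟩) j)
  have hdiff : ∀ {f : Plane → ℝ}, ContDiffOn ℝ ∞ f U → ∀ {y}, y ∈ U → DifferentiableAt ℝ f y :=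
    fun hf y hy => (hf.contDiffAt (hU.mem_nhds hy)).differentiableAt (by simp)
  have hpt : EqOn (fun y => calibRep σ u x₀ (F s) y - calibRep σ u x₀ (G s) y)
      (fun y => pd 0 (P 1) y - pd 1 (P 0) y) (C) := by
    intro y hy
    beta_reduce
    rw [calibRep_eq_pd_primitiveRep hΩ hu heq hF (h1 y hy),
      calibRep_eq_pd_primitiveRep hΩ hu heq hG (h2 y hy), hP_def,
      pd_sub (hdiff (hcF 1) (hCU hy)) (hdiff (hcG 1) (hCU hy)),
      pd_sub (hdiff (hcF 0) (hCU hy)) (hdiff (hcG 0) (hCU hy))]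
    ring
  have hpdc : ∀ i j, IntegrableOn (pd i (P j)) (C) := fun i j =>
    ContinuousOn.integrableOn_compact hC (fun y hy => (contDiffAt_pd
      (((hP j).contDiffAt (hU.mem_nhds (hCU hy))).of_le two_le_infty) (m := 1)
        (by norm_num) i).continuousAt.continuousWithinAt)
  have h1le : (1 : WithTop ℕ∞) ≤ ∞ := by simp
  rw [setIntegral_congr_fun hC.measurableSet hpt, integral_sub (hpdc 0 1) (hpdc 1 0),
    setIntegral_pd_eq_zero hU hC hCU ((hP 1).of_le h1le) (hP0 1) 0,
    setIntegral_pd_eq_zero hU hC hCU ((hP 0).of_le h1le) (hP0 0) 1, sub_zero]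

variable [SecondCountableTopology N] [MeasurableSpace N] [BorelSpace N]

theorem calibratedAreaOn_congr {B : Set N} (hB : MeasurableSet B) {s : ℝ}
    (h : ∀ x ∈ B, F s =ᶠ[𝓝 x] G s) :
    calibratedAreaOn σ u F B s = calibratedAreaOn σ u G B s :=
  areaMeasure_congr ((isBilin_calibration σ u).pullback (F s))
    ((isBilin_calibration σ u).pullback (G s)) hB fun x hx =>
      pullback_congr_of_eventuallyEq (calibration σ u) (h x hx)

omit [SecondCountableTopology N] [BorelSpace N] in
theorem calibratedAreaOn_eq_add {B C : Set N} (hB : MeasurableSet B) (hC : MeasurableSet C)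
    (hCB : C ⊆ B) (F : ℝ → N → N × ℝ) (s : ℝ) : calibratedAreaOn σ u F B s =
      calibratedAreaOn σ u F C s + calibratedAreaOn σ u F (B \ C) s := by
  unfold calibratedAreaOn
  rw [← measure_union disjoint_sdiff_right (hB.diff hC), union_sdiff_cancel hCB]

variable [T2Space N]

include hΩ hu in
/-- The calibrated area does not change if a variation is modified inside a compact subset of a
chart domain. -/
theorem calibratedAreaOn_congr_of_eqOn_compl (heq : IsTranslatingSolution σ Ω u)
    (hF : IsVariation ((𝓡 2).prod 𝓘(ℝ, ℝ)) Ω (graphMap u) K ε F)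
    (hG : IsVariation ((𝓡 2).prod 𝓘(ℝ, ℝ)) Ω (graphMap u) K ε G) {x₀ : N} {L : Set N}
    (hL : IsCompact L) (hLK : L ⊆ K) (hLs : L ⊆ (extChartAt (𝓡 2) x₀).source)
    (hFG : ∀ s ∈ Ioo (-ε) ε, ∀ x ∈ Ω \ L, F s x = G s x) :
    ∀ᶠ s in 𝓝 (0 : ℝ), calibratedAreaOn σ u F K s = calibratedAreaOn σ u G K s := by
  have hLΩ := hLK.trans hF.subset
  have hLm := hL.measurableSet
  have hKm := hF.isCompact.measurableSet
  filter_upwards [eventually_mem_posSet (σ := σ) hΩ hu hF hL hLs hLΩ,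
    eventually_mem_posSet (σ := σ) hΩ hu hG hL hLs hLΩ,
    Ioo_mem_nhds (neg_lt_zero.2 hF.pos) hF.pos] with s h1 h2 hs
  -- Because `Ω \ L` is open, equality there is equality of germs, and the calibrated areas over `K
  -- \ L` coincide. Only the part over `L`, which lies in one chart, remains.
  have hgerm : ∀ x ∈ Ω \ L, F s =ᶠ[𝓝 x] G s := fun x hx =>
    eventually_of_mem ((hΩ.sdiff hL.isClosed).mem_nhds hx) (hFG s hs)
  rw [calibratedAreaOn_eq_add hKm hLm hLK F, calibratedAreaOn_eq_add hKm hLm hLK G,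
    calibratedAreaOn_congr (hKm.diff hLm) fun x hx => hgerm x ⟨hF.subset hx.1, hx.2⟩]
  refine congrArg (· + calibratedAreaOn σ u G (K \ L) s) ?_
  obtain ⟨i1, e1⟩ := calibratedAreaOn_eq hΩ hu hF hL hLs hLm subset_rfl h1
  obtain ⟨i2, e2⟩ := calibratedAreaOn_eq hΩ hu hG hL hLs hLm subset_rfl h2
  refine e1.trans (Eq.trans (congrArg ENNReal.ofReal ?_) e2.symm)
  refine sub_eq_zero.1 ((integral_sub i1 i2).symm.trans ?_)
  exact setIntegral_calibRep_sub_eq_zero hΩ hu heq hF hG (isCompact_chartSet hL hLs)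
    (fun y hy => (h1 y hy).1) (fun y hy => (h2 y hy).1)
    fun y hy => hgerm _ ⟨hy.1.2, fun h => hy.2 ⟨hy.1.1, h⟩⟩

omit [IsManifold (𝓡 2) ∞ N] [T2Space N] [SecondCountableTopology N] [MeasurableSpace N]
  [BorelSpace N] in
/-- Slowing down a variation by a smooth factor `χ` with values in `[0, 1]`. -/
theorem IsVariation.slowed
    (hF : IsVariation ((𝓡 2).prod 𝓘(ℝ, ℝ)) Ω (graphMap u) K ε F) {χ : N → ℝ}
    (hχ : ContMDiff (𝓡 2) 𝓘(ℝ, ℝ) ∞ χ) (h0 : ∀ x, 0 ≤ χ x) (h1 : ∀ x, χ x ≤ 1) :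
    IsVariation ((𝓡 2).prod 𝓘(ℝ, ℝ)) Ω (graphMap u) K ε fun s x => F (s * χ x) x := by
  have hmem : ∀ s ∈ Ioo (-ε) ε, ∀ x, s * χ x ∈ Ioo (-ε) ε := by
    intro s hs x
    have := abs_lt.2 ⟨hs.1, hs.2⟩
    refine abs_lt.1 (lt_of_le_of_lt ?_ this)
    rw [abs_mul, abs_of_nonneg (h0 x)]
    exact mul_le_of_le_one_right (abs_nonneg s) (h1 x)
  refine ⟨hF.isCompact, hF.subset, hF.pos, ?_, ?_, ?_⟩
  · have h2 : ContMDiff (𝓘(ℝ, ℝ).prod (𝓡 2)) 𝓘(ℝ, ℝ) ∞ fun q : ℝ × N => q.1 * χ q.2 :=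
      contMDiff_fst.mul (hχ.comp contMDiff_snd)
    exact hF.smooth.comp (h2.prodMk contMDiff_snd).contMDiffOn
      fun q hq => ⟨hmem _ hq.1 _, hq.2⟩
  · intro x hx
    simp only [zero_mul]
    exact hF.start x hx
  · intro s hs x hx
    exact hF.supported _ (hmem s hs x) x hx

include hΩ hu in
/-- The calibrated area is constant along a variation. -/
theorem eventually_calibratedAreaOn_eq (heq : IsTranslatingSolution σ Ω u)
    (hF : IsVariation ((𝓡 2).prod 𝓘(ℝ, ℝ)) Ω (graphMap u) K ε F) :
    ∀ᶠ s in 𝓝 (0 : ℝ), calibratedAreaOn σ u F K s = calibratedAreaOn σ u F K 0 := by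
  classical
  have := ChartedSpace.locallyCompactSpace Plane N
  choose! L hL hLc hLΩ hLs using fun x (hx : x ∈ Ω) => exists_compact_chart_nhds hΩ hx
  obtain ⟨t, htK, htc⟩ := hF.isCompact.elim_nhds_subcover (fun x => interior (L x))
    fun x hx => interior_mem_nhds.2 (hL x (hF.subset hx))
  -- A finite partition of unity on `K`, each member supported in a compact subset of a chart
  -- domain. It is used to slow time down, so that consecutive variations differ in one chart only.
  obtain ⟨ρ, hρ⟩ := SmoothPartitionOfUnity.exists_isSubordinate (𝓡 2) hF.isCompact.isClosed
    (fun x : t => interior (L x)) (fun _ => isOpen_interior) (by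
      intro x hx
      obtain ⟨z, hz, hxz⟩ := mem_iUnion₂.1 (htc hx)
      exact mem_iUnion.2 ⟨⟨z, hz⟩, hxz⟩)
  set χ : Finset t → N → ℝ := fun T x => ∑ i ∈ T, ρ i x with hχ_def
  have hχ0 : ∀ T x, 0 ≤ χ T x := fun T x => Finset.sum_nonneg fun i _ => ρ.nonneg i x
  have hχ1 : ∀ T x, χ T x ≤ 1 := fun T x =>
    (Finset.sum_le_univ_sum_of_nonneg fun i => ρ.nonneg i x).trans
      ((finsum_eq_sum_of_fintype fun i => ρ i x).symm.trans_le (ρ.sum_le_one x))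
  have hχc : ∀ T, ContMDiff (𝓡 2) 𝓘(ℝ, ℝ) ∞ (χ T) := fun T =>
    contMDiff_finsetSum fun i _ => (ρ i).contMDiff
  have hV := fun T => hF.slowed (hχc T) (hχ0 T) (hχ1 T)
  have hχuniv : ∀ x ∈ K, χ Finset.univ x = 1 := fun x hx =>
    (finsum_eq_sum_of_fintype fun i => ρ i x).symm.trans (ρ.sum_eq_one hx)
  -- Induction on the set of partition functions switched on. For `T = ∅` the time factor is `0` and
  -- the variation rests at `F 0`.
  have hmain : ∀ T : Finset t, ∀ᶠ s in 𝓝 (0 : ℝ),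
      calibratedAreaOn σ u (fun s x => F (s * χ T x) x) K s = calibratedAreaOn σ u F K 0 := by
    intro T
    induction T using Finset.induction_on with
    | empty => simp [hχ_def, calibratedAreaOn]
    | insert i T hi ih =>
      have hiΩ : (i : N) ∈ Ω := hF.subset (htK i i.2)
      -- Adding `ρ i` changes nothing outside `K ∩ L i`: where `ρ i` vanishes the time factors
      -- agree, and off `K` both variations rest.
      have hstep := calibratedAreaOn_congr_of_eqOn_compl hΩ hu heq (hV (insert i T)) (hV T)
        (x₀ := (i : N)) (L := K ∩ L i) (hF.isCompact.inter (hLc i hiΩ)) inter_subset_left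
        (inter_subset_right.trans (hLs i hiΩ)) (by
          intro s hs x hx
          by_cases hxK : x ∈ K
          · have hxL : x ∉ L i := fun h => hx.2 ⟨hxK, h⟩
            have : ρ i x = 0 := by
              by_contra hne
              exact hxL (interior_subset (hρ i (subset_tsupport _ hne)))
            simp only [hχ_def, Finset.sum_insert hi, this, zero_add]
          · rw [(hV (insert i T)).supported s hs x ⟨hx.1, hxK⟩, (hV T).supported s hs x ⟨hx.1, hxK⟩])
      filter_upwards [hstep, ih] with s h1 h2 using h1.trans h2
  filter_upwards [hmain Finset.univ, Ioo_mem_nhds (neg_lt_zero.2 hF.pos) hF.pos] with s h hs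
  rw [← h]
  -- On `K` the full time factor is `1`, and off `K` both maps are the graph. So the fully switched
  -- on variation equals `F s` throughout the open set `Ω`, in particular as a germ at boundary
  -- points of `K`.
  refine calibratedAreaOn_congr hF.isCompact.measurableSet fun x hx => ?_
  filter_upwards [hΩ.mem_nhds (hF.subset hx)] with z hz
  by_cases hzK : z ∈ K
  · rw [hχuniv z hzK, mul_one]
  · rw [(hV Finset.univ).supported s hs z ⟨hz, hzK⟩, hF.supported s hs z ⟨hz, hzK⟩]

end

/-! ### The second variation formula -/

section

variable {N : Type*} [TopologicalSpace N] [T2Space N] [ChartedSpace Plane N]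
  [IsManifold (𝓡 2) ∞ N]
  {σ : SurfaceMetric N} {Ω : Set N} (hΩ : IsOpen Ω) {u : N → ℝ}
  (hu : ContMDiffOn (𝓡 2) 𝓘(ℝ, ℝ) ∞ u Ω) {K : Set N} {ε : ℝ} {F : ℝ → N → N × ℝ}
  (hF : IsVariation ((𝓡 2).prod 𝓘(ℝ, ℝ)) Ω (graphMap u) K ε F)

-- Since `K` is closed, every `F s` rests near such a point. Hence `η` vanishes on a neighbourhood
-- and so does its gradient, which lets the integral over `K` be written over `Ω`.
include hΩ hu hF in
theorem secondVariationDensity_eq_zero {x : N} (hx : x ∈ Ω \ K) :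
    secondVariationDensity σ u F x = 0 := by
  have hη : normalSpeedOverAngle σ u F =ᶠ[𝓝 x] fun _ => 0 := by
    filter_upwards [(hΩ.sdiff hF.isCompact.isClosed).mem_nhds hx] with z hz
    have hy : extChartAt (𝓡 2) z z ∈ chartSet z Ω :=
      ⟨mem_extChartAt_target z, by rw [mem_preimage, extChartAt_to_inv]; exact hz.1⟩
    have h := normalSpeedOverAngle_eq (σ := σ) hΩ hu hF hy
    rw [funRep, extChartAt_to_inv] at h
    rw [h]
    have hev : (fun s => defectRep z u (F s) (extChartAt (𝓡 2) z z)) =ᶠ[𝓝 0] fun _ => 0 := by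
      filter_upwards [Ioo_mem_nhds (neg_lt_zero.2 hF.pos) hF.pos] with s hs
      rw [defectRep, heightRep, extChartAt_to_inv, hF.supported s hs z hz]
      exact sub_self _
    rw [hev.deriv_eq, deriv_const]
  have hd : (mfderiv (𝓡 2) 𝓘(ℝ, ℝ) (normalSpeedOverAngle σ u F) x : Plane →L[ℝ] ℝ) = 0 :=
    hη.mfderiv_eq.trans (mfderiv_const (I := 𝓡 2) (I' := 𝓘(ℝ, ℝ)) (c := (0 : ℝ)))
  have hg : grad (graphMetric σ u) (normalSpeedOverAngle σ u F) x = 0 := by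
    have h0 : (fun j => (mfderiv (𝓡 2) 𝓘(ℝ, ℝ) (normalSpeedOverAngle σ u F) x (stdVec x j) : ℝ)) =
        0 := funext fun j => (congrArg (fun A : Plane →L[ℝ] ℝ => A (stdVec x j)) hd :)
    have key : ∀ (A : Matrix (Fin 2) (Fin 2) ℝ) (ξ : Fin 2 → ℝ), ξ = 0 → ∀ (i : Fin 2) (w : Plane),
        A.mulVec ξ i • w = 0 := by
      rintro A _ rfl i w
      rw [Matrix.mulVec_zero, Pi.zero_apply, zero_smul]
    exact Finset.sum_eq_zero fun i _ => key _ _ h0 i _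
  have hz : graphMetric σ u x 0 0 = 0 := by
    have := (isBilin_graphMetric σ u).smul_left x 0 0 0
    rwa [zero_smul, zero_mul] at this
  rw [secondVariationDensity, hg, hz, mul_zero, zero_mul]

omit [T2Space N] in
theorem secondVariationDensity_nonneg (σ : SurfaceMetric N) (u : N → ℝ) (F : ℝ → N → N × ℝ)
    (x : N) : 0 ≤ secondVariationDensity σ u F x :=
  mul_nonneg (mul_nonneg (sq_nonneg _) (graphMetric_nonneg σ u x _)) (Real.exp_pos _).le

variable [SecondCountableTopology N] [MeasurableSpace N] [BorelSpace N]

include hΩ hu hF in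
/-- First and second variation of the weighted area of a translating graph. -/
theorem exists_deriv_area (heq : IsTranslatingSolution σ Ω u) : ∃ D : ℝ → ℝ,
    (∀ᶠ s in 𝓝 (0 : ℝ), HasDerivAt
      (fun s => area ((𝓡 2).prod 𝓘(ℝ, ℝ)) (weightedMetric σ) (F s) K) (D s) s) ∧
    D 0 = 0 ∧
    HasDerivAt D (∫ x in Ω, secondVariationDensity σ u F x ∂(areaMeasure (graphMetric σ u))) 0 := by
  obtain ⟨D, h1, h2, h3⟩ := (hasSecondVariationOn (σ := σ) hΩ hu hF).exists_deriv
  refine ⟨D, ?_, h2, ?_⟩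
  · filter_upwards [h1, eventually_eventually_nhds.2
      (eventually_calibratedAreaOn_eq (σ := σ) hΩ hu heq hF)] with s hs hc
    -- Near `s` the area is the difference of the two areas plus the constant calibrated area at
    -- time `0`.
    refine (hs.add_const (calibratedAreaOn σ u F K 0).toReal).congr_of_eventuallyEq ?_
    filter_upwards [hc] with t ht
    rw [ht, sub_add_cancel]
    rfl
  · rwa [← setIntegral_eq_of_subset_of_forall_sdiff_eq_zero hΩ.measurableSet hF.subset
      fun x hx => secondVariationDensity_eq_zero hΩ hu hF hx] at h3

end

end TranslatingGraph

end

/-! ### Stability and the second variation formula. -/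

open TranslatingGraph in
theorem theorem2p1 {N : Type*} [TopologicalSpace N] [T2Space N] [SecondCountableTopology N]
    [ChartedSpace Plane N] [IsManifold (𝓡 2) ∞ N] [MeasurableSpace N] [BorelSpace N]
    (σ : SurfaceMetric N) (Ω : Set N) (hΩ : IsOpen Ω)
    (u : N → ℝ) (hu : ContMDiffOn (𝓡 2) 𝓘(ℝ, ℝ) ∞ u Ω)
    (heq : IsTranslatingSolution σ Ω u) :
    IsStableMinimalSurface ((𝓡 2).prod 𝓘(ℝ, ℝ)) (weightedMetric σ) Ω (graphMap u) ∧
    ∀ (K : Set N) (ε : ℝ) (F : ℝ → N → N × ℝ),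
      IsVariation ((𝓡 2).prod 𝓘(ℝ, ℝ)) Ω (graphMap u) K ε F →
      deriv (deriv fun s => area ((𝓡 2).prod 𝓘(ℝ, ℝ)) (weightedMetric σ) (F s) K) 0 =
        ∫ x in Ω, angle σ u x ^ 2 *
            graphMetric σ u x
              (grad (graphMetric σ u) (normalSpeedOverAngle σ u F) x)
              (grad (graphMetric σ u) (normalSpeedOverAngle σ u F) x) *
            Real.exp (u x) ∂(areaMeasure (graphMetric σ u)) := by
  have key : ∀ (K : Set N) (ε : ℝ) (F : ℝ → N → N × ℝ),
      IsVariation ((𝓡 2).prod 𝓘(ℝ, ℝ)) Ω (graphMap u) K ε F →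
      HasDerivAt (fun s => area ((𝓡 2).prod 𝓘(ℝ, ℝ)) (weightedMetric σ) (F s) K) 0 0 ∧
      (∀ᶠ s in 𝓝 (0 : ℝ), DifferentiableAt ℝ
        (fun s => area ((𝓡 2).prod 𝓘(ℝ, ℝ)) (weightedMetric σ) (F s) K) s) ∧
      HasDerivAt (deriv fun s => area ((𝓡 2).prod 𝓘(ℝ, ℝ)) (weightedMetric σ) (F s) K)
        (∫ x in Ω, secondVariationDensity σ u F x ∂(areaMeasure (graphMetric σ u))) 0 := by
    intro K ε F hF
    obtain ⟨D, h1, h2, h3⟩ := exists_deriv_area hΩ hu hF heq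
    have h4 := h1.self_of_nhds
    rw [h2] at h4
    -- `D` is the derivative of the area on a neighbourhood of `0`, so its derivative at `0` is also
    -- that of `deriv` of the area.
    exact ⟨h4, h1.mono fun s hs => hs.differentiableAt,
      h3.congr_of_eventuallyEq (h1.mono fun s hs => hs.deriv)⟩
  refine ⟨⟨⟨contMDiffOn_graphMap hu, fun x hx => graphMap_injective hΩ hu hx,
    fun K ε F hF => (key K ε F hF).1⟩, fun K ε F hF => ?_⟩, fun K ε F hF => (key K ε F hF).2.2.deriv⟩
  obtain ⟨-, hd, hdd⟩ := key K ε F hF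
  refine ⟨hd, hdd.differentiableAt, ?_⟩
  rw [hdd.deriv]
  exact integral_nonneg (secondVariationDensity_nonneg σ u F)
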